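/- All structures are real. A *Banach structure* (in the signature used here) is a real Banach space $X$, viewed as the metric structure on its closed unit ball with a symbol for $0$, the predicates $\|\sum_i a_ix_i\|$ and the functions $\sigma_{\bar a}(\bar x)=\sum_i a_ix_i$ (divided by its norm if the norm exceeds $1$) for all finite tuples $\bar a$ of reals, together with a $1$-Lipschitz unary predicate $D$ with values in $[0,2]$. Formulas are those of continuous first-order logic. A *Hilbert theory* is the theory of such a structure for which $X$ is a Hilbert space. Let $T$ be the theory of (the unit ball of) the Hilbert space sum $\ell_2\oplus\ell_2\oplus\cdots$ of countably infinitely many copies of the real Hilbert space $\ell_2$, where $D(x)$ is the distance from $x$ to the union $S^\infty\sqcup S^\infty\sqcup\cdots$ of the unit spheres of the summands. Then $T$ is a Hilbert theory, and $T$ is $\omega$-stable: for every countable set $A$ of parameters in a model of $T$, the space $S_1(A)$ of complete types has a countable subset that is dense in the metric $d(p,q)=\inf\{d(a,b): a\models p,\ b\models q\}$. A complete type over a set $A$ is *wide* if, in some elementary extension, its set of realizations contains the unit sphere of an infinite dimensional real subspace; it is *minimal wide* if it is wide and has a unique wide extension to every set of parameters $B\supseteq A$. Let $\mathfrak C$ be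 a $\kappa$-saturated model of $T$ for some uncountable $\kappa$ (for instance a monster model). A *global* type is a complete type over $\mathfrak C$. It *forks* over $\varnothing$ if it implies a finite disjunction of conditions $\varphi(x,b)=0$ each of which divides over $\varnothing$, i.e. for which there is an indiscernible sequence $b=b_0,b_1,\dots$ with $\{\varphi(x,b_i)=0:i<\omega\}$ inconsistent. A sequence $(c_i)$ in $\mathfrak C$ indexed by a well-ordered set is a *Morley sequence over $B$* in the global type $p$ if each $c_i$ realizes $p{\upharpoonright}(B\cup\{c_j:j<i\})$. A real subspace $V$ of $\mathfrak C$ is an *indiscernible subspace in* a type $r$ over $\varnothing$ if all its unit vectors realize $r$ and, for all $n<\omega$, two $n$-tuples $\bar b,\bar c$ from (the unit ball of) $V$ have the same type over $\varnothing$ if and only if $\|b_i\|=\|c_i\|$ and $\|b_i-b_j\|=\|c_i-c_j\|$ for all $i,j$. Then there is a global type $p$ such that: 1. $p$ is the unique global type that contains the condition $D(x)=0$ and does not fork over $\varnothing$, and $p$ is wide. 2. For every $B\subseteq\mathfrak C$ and every Morley sequence $(c_i)$ in $p$ over $B$ with at least two terms, the unit sphere of the linear span of $(c_i)$ is not contained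 in $p(\mathfrak C)$, the set of realizations in $\mathfrak C$ of the restriction $p{\upharpoonright}\varnothing$. 3. $p{\upharpoonright}\varnothing$ is wide but not minimal wide, and there is an infinite Morley sequence $(c_i)_{i<\omega}$ in $p$ over $\varnothing$ that is not an orthonormal basis of any indiscernible subspace in $p{\upharpoonright}\varnothing$ (over $\varnothing$). Thus the theorem ``an infinite sequence is a Morley sequence in a minimal wide type if and only if it is an orthonormal basis of an indiscernible subspace in that type'' fails for wide types that are not minimal. -/

import Mathlib

universe u v

/-! ### Banach structures with one additional unary predicate

The signature consists of the metric, the constant `0`, the truncated linear combinations `σ_a`,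
the predicates `‖∑ i, a i • x i‖` (for all finite tuples `a` of reals) and a unary predicate symbol
`D`, which is `1`-Lipschitz with range `[0, 2]`. -/

/-- A real Banach structure in this signature. Its underlying metric space is the closed unit ball
of the Banach space `X`; everything except `D` is interpreted in the standard way. -/
structure BanachStr where
  X : Type u
  [grp : NormedAddCommGroup X]
  [spc : NormedSpace ℝ X]
  [cpl : CompleteSpace X]
  D : Metric.closedBall (0 : X) 1 → ℝ
  lip : LipschitzWith 1 D
  nonneg : ∀ x, 0 ≤ D x
  le_two : ∀ x, D x ≤ 2

attribute [instance] BanachStr.grp BanachStr.spc BanachStr.cpl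

/-- The underlying set of the structure: the closed unit ball. -/
abbrev BanachStr.Ball (M : BanachStr.{u}) : Type u := Metric.closedBall (0 : M.X) 1

/-- `x` if `‖x‖ ≤ 1`, and `x / ‖x‖` otherwise. -/
noncomputable def BanachStr.truncate (M : BanachStr.{u}) (x : M.X) : M.Ball :=
  ⟨(max 1 ‖x‖)⁻¹ • x, by
    have h : (0 : ℝ) < max 1 ‖x‖ := lt_of_lt_of_le one_pos (le_max_left _ _)
    rw [mem_closedBall_zero_iff, norm_smul, norm_inv, Real.norm_of_nonneg h.le,
      inv_mul_le_iff₀ h, mul_one]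
    exact le_max_right _ _⟩

/-- Terms in the variables `x₀, …, x_{n-1}`. -/
inductive CTerm (n : ℕ) : Type
  | var (i : Fin n) : CTerm n
  | zero : CTerm n
  | sigma {k : ℕ} (a : Fin k → ℝ) (t : Fin k → CTerm n) : CTerm n

noncomputable def CTerm.eval (M : BanachStr.{u}) {n : ℕ} (v : Fin n → M.Ball) : CTerm n → M.Ball
  | .var i => v i
  | .zero => ⟨0, by simp⟩
  | .sigma a t => M.truncate (∑ i, a i • ((t i).eval M v : M.X))

/-- Formulas of continuous logic in the free variables `x₀, …, x_{n-1}`. The connectives are all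
continuous functions; the quantifiers `sup` and `inf` bind the variable `x₀`. -/
inductive CFormula : ℕ → Type
  | dist {n : ℕ} (s t : CTerm n) : CFormula n
  | norm {n k : ℕ} (a : Fin k → ℝ) (t : Fin k → CTerm n) : CFormula n
  | D {n : ℕ} (t : CTerm n) : CFormula n
  | conn {n k : ℕ} (c : C(Fin k → ℝ, ℝ)) (φ : Fin k → CFormula n) : CFormula n
  | sup {n : ℕ} (φ : CFormula (n + 1)) : CFormula n
  | inf {n : ℕ} (φ : CFormula (n + 1)) : CFormula n

/-- The value of a formula. Values of a formula are uniformly bounded, so that the suprema and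
infima are those of nonempty bounded sets of reals. -/
noncomputable def CFormula.eval (M : BanachStr.{u}) :
    {n : ℕ} → CFormula n → (Fin n → M.Ball) → ℝ
  | _, .dist s t, v => Dist.dist (s.eval M v) (t.eval M v)
  | _, .norm a t, v => ‖∑ i, a i • ((t i).eval M v : M.X)‖
  | _, .D t, v => M.D (t.eval M v)
  | _, .conn c φ, v => c (fun i => (φ i).eval M v)
  | _, .sup φ, v => ⨆ x : M.Ball, φ.eval M (Fin.cons x v)
  | _, .inf φ, v => ⨅ x : M.Ball, φ.eval M (Fin.cons x v)

/-- The theory of `M`: the set of sentences `φ` such that the condition `φ = 0` holds in `M`. -/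
def BanachStr.theory (M : BanachStr.{u}) : Set (CFormula 0) :=
  {φ | φ.eval M Fin.elim0 = 0}

def BanachStr.Models (M : BanachStr.{u}) (T : Set (CFormula 0)) : Prop :=
  ∀ φ ∈ T, φ.eval M Fin.elim0 = 0

/-- A Hilbert theory is the theory of a structure whose Banach space is a Hilbert space (that is,
satisfies the parallelogram law). -/
def IsHilbertTheory (T : Set (CFormula 0)) : Prop :=
  ∃ M : BanachStr.{u}, InnerProductSpaceable M.X ∧ T = M.theory

/-- Elementary embeddings. An elementary extension of `M` is a structure `N` together with an
elementary embedding `M → N`. -/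
def IsElementary {M N : BanachStr.{u}} (f : M.Ball → N.Ball) : Prop :=
  ∀ (n : ℕ) (φ : CFormula n) (v : Fin n → M.Ball), φ.eval N (fun i => f (v i)) = φ.eval M v

/-- The families `b` and `c` have the same type over `A`. -/
def EquivOver {M : BanachStr.{u}} (A : Set M.Ball) {J : Type*} (b c : J → M.Ball) : Prop :=
  ∀ (k : ℕ) (φ : CFormula k) (v : Fin k → J ⊕ A),
    φ.eval M (fun i => Sum.elim b (fun a => (a : M.Ball)) (v i)) =
      φ.eval M (fun i => Sum.elim c (fun a => (a : M.Ball)) (v i))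

/-! ### Types -/

/-- The type over `A ⊆ M` of an element `b` of an extension `f : M → N`, as the function that sends
a formula `φ(x, a)` with parameters `a` in `A` to its value at `x = b`. -/
noncomputable def tpFun {M N : BanachStr.{u}} (f : M.Ball → N.Ball) (A : Set M.Ball) (b : N.Ball) :
    ∀ m : ℕ, CFormula (m + 1) → (Fin m → A) → ℝ :=
  fun _ φ a => φ.eval N (Fin.cons b (fun i => f (a i)))

/-- The space `S₁(A)` of complete `1`-types over `A ⊆ M`. A type assigns a value to every formula
`φ(x, a)` with parameters in `A`, and is realized in some elementary extension of `M`. -/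
def CType (M : BanachStr.{u}) (A : Set M.Ball) : Type u :=
  {p : ∀ m : ℕ, CFormula (m + 1) → (Fin m → A) → ℝ //
    ∃ (N : BanachStr.{u}) (f : M.Ball → N.Ball) (b : N.Ball), IsElementary f ∧ tpFun f A b = p}

/-- The type over `A` of an element of `M`. -/
noncomputable def tp {M : BanachStr.{u}} (A : Set M.Ball) (b : M.Ball) : CType M A :=
  ⟨tpFun id A b, M, id, b, fun _ _ _ => rfl, rfl⟩

/-- The restriction of a type to a smaller set of parameters. -/
def CType.restrict {M : BanachStr.{u}} {B : Set M.Ball} (p : CType M B) (A : Set M.Ball)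
    (h : A ⊆ B) : CType M A :=
  ⟨fun m φ a => p.1 m φ (fun i => ⟨a i, h (a i).2⟩), by
    obtain ⟨N, f, b, hf, hp⟩ := p.2
    exact ⟨N, f, b, hf, by rw [← hp]; rfl⟩⟩

/-- The element `b` of the extension `f : M → N` realizes `p`. -/
def CType.RealizedBy {M N : BanachStr.{u}} {A : Set M.Ball} (p : CType M A)
    (f : M.Ball → N.Ball) (b : N.Ball) : Prop :=
  tpFun f A b = p.1

/-- The set `p(M)` of realizations of `p` in `M`. -/
def CType.realizations {M : BanachStr.{u}} {A : Set M.Ball} (p : CType M A) : Set M.Ball :=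
  {b | tp A b = p}

/-- The type `p` contains the condition `D(x) = 0`. -/
def CType.ContainsDZero {M : BanachStr.{u}} {A : Set M.Ball} (p : CType M A) : Prop :=
  p.1 0 (CFormula.D (CTerm.var 0)) Fin.elim0 = 0

/-- Every type over fewer than `κ` parameters is realized. -/
def BanachStr.IsSaturated (M : BanachStr.{u}) (κ : Cardinal.{u}) : Prop :=
  ∀ A : Set M.Ball, Cardinal.mk A < κ → ∀ p : CType M A, p.realizations.Nonempty

/-- Being at distance less than `ε` in the `d`-metric on `S₁(A)`, where `d(p, q)` is the infimum of
the distances between realizations of `p` and of `q` in a common elementary extension. -/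
def CType.DistLT {M : BanachStr.{u}} {A : Set M.Ball} (p q : CType M A) (ε : ℝ) : Prop :=
  ∃ (N : BanachStr.{u}) (f : M.Ball → N.Ball) (b c : N.Ball),
    IsElementary f ∧ p.RealizedBy f b ∧ q.RealizedBy f c ∧ dist b c < ε

/-- `T` is `ω`-stable: for every countable set `A` of parameters in a model of `T`, the space
`S₁(A)` has a countable subset that is dense in the `d`-metric. -/
def IsOmegaStable (T : Set (CFormula 0)) : Prop :=
  ∀ M : BanachStr.{u}, M.Models T → ∀ A : Set M.Ball, A.Countable →
    ∃ Q : Set (CType M A), Q.Countable ∧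
      ∀ (p : CType M A) (ε : ℝ), 0 < ε → ∃ q ∈ Q, p.DistLT q ε

/-! ### Dividing and forking (in a sufficiently saturated model `M`) -/

/-- The sequence `b` of `m`-tuples is indiscernible over `A`. -/
def IsIndiscernibleSeq {M : BanachStr.{u}} (A : Set M.Ball) {m : ℕ} (b : ℕ → Fin m → M.Ball) :
    Prop :=
  ∀ (n : ℕ) (s t : Fin n → ℕ), StrictMono s → StrictMono t →
    EquivOver A (fun ij : Fin n × Fin m => b (s ij.1) ij.2)
      (fun ij : Fin n × Fin m => b (t ij.1) ij.2)

/-- The condition `φ(x, b) = 0` divides over `A`: there is an `A`-indiscernible sequence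
`b = b₀, b₁, …` such that `{φ(x, bᵢ) = 0 : i < ω}` is inconsistent. -/
def Divides {M : BanachStr.{u}} (A : Set M.Ball) {m : ℕ} (φ : CFormula (m + 1))
    (b : Fin m → M.Ball) : Prop :=
  ∃ s : ℕ → Fin m → M.Ball, s 0 = b ∧ IsIndiscernibleSeq A s ∧
    ¬ ∃ (N : BanachStr.{u}) (f : M.Ball → N.Ball) (x : N.Ball), IsElementary f ∧
      ∀ i, φ.eval N (Fin.cons x (fun j => f (s i j))) = 0

/-- The type `p` forks over `A`: it implies a finite disjunction of conditions each of which
divides over `A`. -/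
def CType.Forks {M : BanachStr.{u}} {B : Set M.Ball} (p : CType M B) (A : Set M.Ball) : Prop :=
  ∃ (k : ℕ) (m : Fin k → ℕ) (φ : ∀ i, CFormula (m i + 1)) (b : ∀ i, Fin (m i) → M.Ball),
    (∀ i, Divides A (φ i) (b i)) ∧
    ∀ (N : BanachStr.{u}) (f : M.Ball → N.Ball) (x : N.Ball), IsElementary f →
      p.RealizedBy f x → ∃ i, (φ i).eval N (Fin.cons x (fun j => f (b i j))) = 0

/-! ### Wide types, Morley sequences, indiscernible subspaces -/

/-- The type `p` is wide: consistently, its set of realizations contains the unit sphere of an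
infinite dimensional real subspace. -/
def CType.IsWide {M : BanachStr.{u}} {A : Set M.Ball} (p : CType M A) : Prop :=
  ∃ (N : BanachStr.{u}) (f : M.Ball → N.Ball) (V : Submodule ℝ N.X),
    IsElementary f ∧ ¬ FiniteDimensional ℝ V ∧
    ∀ x : N.Ball, (x : N.X) ∈ V → ‖(x : N.X)‖ = 1 → p.RealizedBy f x

/-- The type `p` is minimal wide: it is wide and has a unique wide extension to every set of
parameters. -/
def CType.IsMinimalWide {M : BanachStr.{u}} {A : Set M.Ball} (p : CType M A) : Prop :=
  p.IsWide ∧ ∀ (B : Set M.Ball) (h : A ⊆ B), ∃! q : CType M B, q.restrict A h = p ∧ q.IsWide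

/-- `c` is a Morley sequence over `B` in the global type `p`: each `c i` realizes the restriction of
`p` to `B ∪ {c j : j < i}`. -/
def IsMorleySequence {M : BanachStr.{u}} (p : CType M Set.univ) (B : Set M.Ball)
    {ι : Type v} [LinearOrder ι] (c : ι → M.Ball) : Prop :=
  ∀ i, c i ∈ (p.restrict (B ∪ c '' Set.Iio i) (Set.subset_univ _)).realizations

/-- The linear span (inside the Banach space of `M`) of a family of elements of `M`. -/
def spanOf {M : BanachStr.{u}} {ι : Type v} (c : ι → M.Ball) : Submodule ℝ M.X :=
  Submodule.span ℝ (Set.range fun i => (c i : M.X))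

/-- The unit sphere of a subspace. -/
def unitSphereOf {M : BanachStr.{u}} (V : Submodule ℝ M.X) : Set M.Ball :=
  {x | (x : M.X) ∈ V ∧ ‖(x : M.X)‖ = 1}

/-- Congruent tuples, the zero vector being added to both of them. -/
def CongruentTuples {M : BanachStr.{u}} {n : ℕ} (b c : Fin n → M.Ball) : Prop :=
  (∀ i, ‖(b i : M.X)‖ = ‖(c i : M.X)‖) ∧
    ∀ i j, ‖(b i : M.X) - b j‖ = ‖(c i : M.X) - c j‖

/-- `V` is an indiscernible subspace in `p`, for `p` a type over `A`. -/
def CType.IsIndiscernibleSubspace {M : BanachStr.{u}} {A : Set M.Ball} (p : CType M A)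
    (V : Submodule ℝ M.X) : Prop :=
  (∀ (n : ℕ) (b c : Fin n → M.Ball), (∀ i, (b i : M.X) ∈ V) → (∀ i, (c i : M.X) ∈ V) →
    (EquivOver A b c ↔ CongruentTuples b c)) ∧
  unitSphereOf V ⊆ p.realizations

/-- `c` is an orthonormal basis of the subspace `V` (which is then isometric to a real Hilbert
space): it is orthonormal and its closed linear span is `V`. -/
def IsOrthonormalBasisOf {M : BanachStr.{u}} {ι : Type v} (c : ι → M.Ball)
    (V : Submodule ℝ M.X) : Prop :=
  (∀ (s : Finset ι) (a : ι → ℝ), ‖∑ i ∈ s, a i • (c i : M.X)‖ ^ 2 = ∑ i ∈ s, a i ^ 2) ∧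
    (spanOf c).topologicalClosure = V

/-! ### The example -/

/-- The real Hilbert space `ℓ₂`. -/
abbrev EllTwo : Type := lp (fun _ : ℕ => ℝ) 2

/-- The Hilbert space sum `ℓ₂ ⊕ ℓ₂ ⊕ …`. -/
abbrev EllTwoSum : Type := lp (fun _ : ℕ => EllTwo) 2

/-- The union of the unit spheres of the summands of `ℓ₂ ⊕ ℓ₂ ⊕ …`. -/
def unionOfSpheres : Set EllTwoSum :=
  {y | ∃ (n : ℕ) (s : EllTwo), ‖s‖ = 1 ∧ y = lp.single 2 n s}

theorem unionOfSpheres_nonempty : unionOfSpheres.Nonempty :=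
  ⟨_, 0, lp.single 2 0 (1 : ℝ), by
    rw [lp.norm_single (by norm_num)]; simp, rfl⟩

theorem norm_of_mem_unionOfSpheres {y : EllTwoSum} (h : y ∈ unionOfSpheres) : ‖y‖ = 1 := by
  obtain ⟨n, s, hs, rfl⟩ := h
  rw [lp.norm_single (by norm_num), hs]

/-- The unit ball of `ℓ₂ ⊕ ℓ₂ ⊕ …`, where `D` is the distance to the union of the unit spheres of
the summands. -/
noncomputable def sumOfSpheres : BanachStr.{0} where
  X := EllTwoSum
  D x := Metric.infDist (x : EllTwoSum) unionOfSpheres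
  lip := LipschitzWith.of_dist_le_mul fun x y => by
    simpa [Subtype.dist_eq] using
      (Metric.lipschitz_infDist_pt unionOfSpheres).dist_le_mul (x : EllTwoSum) y
  nonneg _ := Metric.infDist_nonneg
  le_two x := by
    obtain ⟨y, hy⟩ := unionOfSpheres_nonempty
    refine (Metric.infDist_le_dist_of_mem hy).trans ?_
    have h1 := mem_closedBall_zero_iff.1 x.2
    have h2 := norm_of_mem_unionOfSpheres hy
    rw [dist_eq_norm]
    linarith [norm_sub_le (x : EllTwoSum) y]

-- The zero set of `D` in the example is a union of unit spheres of infinitely many pairwise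
-- orthogonal, infinite dimensional closed subspaces, called components, and `D` is the distance to
-- it. Expanding squares gives `D x ^ 2 = ‖x‖ ^ 2 + 1 - 2 * g`, where `g` is the supremum of the
-- norms of the projections of `x` to the components (`Decomp.D_sq`). So the structure is nothing
-- but a Hilbert space split into components and the orthogonal complement of their sum.
--
-- Every model of the theory has this shape (`nonempty_decomp_of_models`). By transfer, the cone
-- over the zero set of `D` is closed and contains the sum of any two of its non-orthogonal
-- elements. Such a cone falls apart into maximal subspaces that are equal or orthogonal
-- (`IsMergingCone.sub_eq_sub`), and approximate sentences show that these are infinite dimensional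
-- and infinite in number.
--
-- The theory has quantifier elimination in geometric form (`CFormula.eval_eq_of_match`): the type
-- of a tuple is given by the Gram matrices of its projections, up to a renaming of the components.
-- This is a back-and-forth argument in structures with uncountably many components and an infinite
-- dimensional complement. Every model embeds elementarily into such a structure, its ultrapower
-- over `ℕ`.
--
-- The global type `p` is that of a unit vector in a component orthogonal to all parameters
-- (`CType.IsGeneric`). The unit sphere of one new component realizes it, so it is wide; it is
-- invariant, so it does not fork. Any other global type with `D = 0` places its realizations in the
-- component of some parameter, and this condition divides along unit vectors from distinct
-- components. Terms of a Morley sequence in `p` lie in distinct components, so the normalized sum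
-- of two of them lies in none: the span leaves the zero set of `D`. Minimality fails because, over
-- a unit vector `t` of a component, a unit vector of that component orthogonal to `t` and a unit
-- vector of a new component have different types, both wide.
--
-- For `ω`-stability, all types over a countable set are realized in one separable subspace of the
-- ultrapower (`Decomp.Emb.exists_isSeparable`). It is generated by the projections of the
-- parameters, a new orthogonal direction for each component they meet and for the complement, and
-- countably many new components.

universe w

open Filter Topology
open scoped RealInnerProductSpace BoundedContinuousFunction

/-! ### Uniform continuity and boundedness of formulas -/

section Formulas

variable {M : BanachStr.{u}}

instance : Inhabited M.Ball := ⟨⟨0, by simp⟩⟩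

theorem BanachStr.Ball.norm_le (x : M.Ball) : ‖(x : M.X)‖ ≤ 1 :=
  mem_closedBall_zero_iff.1 x.2

theorem BanachStr.truncate_coe (x : M.X) :
    (M.truncate x : M.X) = (max 1 ‖x‖)⁻¹ • x := rfl

theorem BanachStr.truncate_of_norm_le {x : M.X} (h : ‖x‖ ≤ 1) : (M.truncate x : M.X) = x := by
  rw [BanachStr.truncate_coe, max_eq_left h, inv_one, one_smul]

theorem BanachStr.truncate_of_one_le {x : M.X} (h : 1 ≤ ‖x‖) :
    (M.truncate x : M.X) = ‖x‖⁻¹ • x := by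
  rw [BanachStr.truncate_coe, max_eq_right h]

theorem BanachStr.lipschitzWith_truncate (M : BanachStr.{u}) : LipschitzWith 2 M.truncate := by
  refine LipschitzWith.of_dist_le_mul fun x y => ?_
  rw [Subtype.dist_eq, dist_eq_norm, dist_eq_norm, M.truncate_coe, M.truncate_coe]
  set m := max 1 ‖x‖
  set n := max 1 ‖y‖
  have hm : 1 ≤ m := le_max_left _ _
  have hn : 1 ≤ n := le_max_left _ _
  have hm0 : 0 < m := by linarith
  have hn0 : 0 < n := by linarith
  have hmn : |m - n| ≤ ‖x - y‖ := by
    refine (abs_max_sub_max_le_max 1 ‖x‖ 1 ‖y‖).trans ?_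
    simpa using abs_norm_sub_norm_le x y
  -- The difference splits into a rescaled `x - y` and a change of scale applied to `y`. Each part
  -- is at most `‖x - y‖`, whence the constant `2`.
  have hd : m⁻¹ • x - n⁻¹ • y = m⁻¹ • (x - y) + ((n - m) / (m * n)) • y := by
    have : (n - m) / (m * n) = m⁻¹ - n⁻¹ := by field_simp
    rw [this, smul_sub, sub_smul]; abel
  rw [hd]
  refine (norm_add_le _ _).trans ?_
  rw [norm_smul, norm_smul, Real.norm_eq_abs, Real.norm_eq_abs, abs_of_pos (inv_pos.2 hm0), abs_div,
    abs_of_pos (mul_pos hm0 hn0), abs_sub_comm n m]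
  have h1 : m⁻¹ * ‖x - y‖ ≤ ‖x - y‖ :=
    mul_le_of_le_one_left (norm_nonneg _) (inv_le_one_of_one_le₀ hm)
  have h2 : |m - n| / (m * n) * ‖y‖ ≤ ‖x - y‖ := by
    have hy : ‖y‖ ≤ n := le_max_right _ _
    rw [div_mul_eq_mul_div, div_le_iff₀ (mul_pos hm0 hn0)]
    have h3 : n ≤ m * n := by nlinarith
    exact mul_le_mul hmn (hy.trans h3) (norm_nonneg _) (norm_nonneg _)
  simp only [NNReal.coe_ofNat]
  linarith

theorem uniformContinuous_sum_smul {α : Type*} [UniformSpace α] {k : ℕ} (a : Fin k → ℝ)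
    (f : Fin k → α → M.Ball) (hf : ∀ i, UniformContinuous (f i)) :
    UniformContinuous fun v => ∑ i, a i • (f i v : M.X) := by
  have : ∀ s : Finset (Fin k), UniformContinuous fun v => ∑ i ∈ s, a i • (f i v : M.X) := by
    classical
    intro s
    induction s using Finset.induction_on with
    | empty => simpa using uniformContinuous_const
    | insert i s hi ih =>
      simp only [Finset.sum_insert hi]
      exact ((uniformContinuous_subtype_val.comp (hf i)).const_smul (a i)).add ih
  exact this Finset.univ

theorem CTerm.uniformContinuous_eval {n : ℕ} (t : CTerm n) : UniformContinuous fun v => t.eval M v := by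
  induction t with
  | var i => exact Pi.uniformContinuous_proj _ i
  | zero => exact uniformContinuous_const
  | sigma a t ih =>
    exact M.lipschitzWith_truncate.uniformContinuous.comp (uniformContinuous_sum_smul a _ ih)

/-- The bound is the same for all structures and valuations. It confines the arguments of a
connective to a compact cube, on which a continuous function is bounded and uniformly continuous. -/
theorem CFormula.exists_bound {n : ℕ} (φ : CFormula n) :
    ∃ B : ℝ, 0 ≤ B ∧ ∀ (M : BanachStr.{u}) (v : Fin n → M.Ball), |φ.eval M v| ≤ B := by
  induction φ with
  | dist s t =>
    refine ⟨2, by norm_num, fun M v => ?_⟩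
    rw [CFormula.eval, abs_of_nonneg dist_nonneg, Subtype.dist_eq, dist_eq_norm]
    refine (norm_sub_le _ _).trans ?_
    linarith [(s.eval M v).norm_le, (t.eval M v).norm_le]
  | @norm n k a t =>
    refine ⟨∑ i, |a i|, Finset.sum_nonneg fun _ _ => abs_nonneg _, fun M v => ?_⟩
    rw [CFormula.eval, abs_of_nonneg (norm_nonneg _)]
    refine (norm_sum_le _ _).trans (Finset.sum_le_sum fun i _ => ?_)
    rw [norm_smul, Real.norm_eq_abs]
    exact mul_le_of_le_one_right (abs_nonneg _) ((t i).eval M v).norm_le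
  | D t =>
    refine ⟨2, by norm_num, fun M v => ?_⟩
    rw [CFormula.eval, abs_of_nonneg (M.nonneg _)]
    exact M.le_two _
  | @conn n k c φ ih =>
    choose B hB0 hB using ih
    obtain ⟨C, hC⟩ := (isCompact_univ_pi fun i => isCompact_Icc (a := -B i) (b := B i)).exists_bound_of_continuousOn
      c.continuous.continuousOn
    refine ⟨max C 0, le_max_right _ _, fun M v => ?_⟩
    refine (hC _ ?_).trans (le_max_left _ _)
    exact fun i _ => abs_le.1 (hB i M v)
  | sup φ ih =>
    obtain ⟨B, hB0, hB⟩ := ih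
    refine ⟨B, hB0, fun M v => abs_le.2 ⟨?_, ?_⟩⟩
    · exact (abs_le.1 (hB M (Fin.cons default v))).1.trans
        (le_ciSup (f := fun x => φ.eval M (Fin.cons x v))
          ⟨B, by rintro _ ⟨x, rfl⟩; exact (abs_le.1 (hB M _)).2⟩ default)
    · exact ciSup_le fun x => (abs_le.1 (hB M _)).2
  | inf φ ih =>
    obtain ⟨B, hB0, hB⟩ := ih
    refine ⟨B, hB0, fun M v => abs_le.2 ⟨?_, ?_⟩⟩
    · exact le_ciInf fun x => (abs_le.1 (hB M _)).1
    · exact (ciInf_le (f := fun x => φ.eval M (Fin.cons x v))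
        ⟨-B, by rintro _ ⟨x, rfl⟩; exact (abs_le.1 (hB M _)).1⟩ default).trans
        (abs_le.1 (hB M (Fin.cons default v))).2

theorem CFormula.bddAbove {n : ℕ} (φ : CFormula (n + 1)) (v : Fin n → M.Ball) :
    BddAbove (Set.range fun x : M.Ball => φ.eval M (Fin.cons x v)) := by
  obtain ⟨B, -, hB⟩ := φ.exists_bound
  exact ⟨B, by rintro _ ⟨x, rfl⟩; exact (abs_le.1 (hB M _)).2⟩

theorem CFormula.bddBelow {n : ℕ} (φ : CFormula (n + 1)) (v : Fin n → M.Ball) :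
    BddBelow (Set.range fun x : M.Ball => φ.eval M (Fin.cons x v)) := by
  obtain ⟨B, -, hB⟩ := φ.exists_bound
  exact ⟨-B, by rintro _ ⟨x, rfl⟩; exact (abs_le.1 (hB M _)).1⟩

theorem CFormula.eval_le_sup {n : ℕ} (φ : CFormula (n + 1)) (v : Fin n → M.Ball) (x : M.Ball) :
    φ.eval M (Fin.cons x v) ≤ φ.sup.eval M v :=
  le_ciSup (φ.bddAbove v) x

theorem CFormula.inf_le_eval {n : ℕ} (φ : CFormula (n + 1)) (v : Fin n → M.Ball) (x : M.Ball) :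
    φ.inf.eval M v ≤ φ.eval M (Fin.cons x v) :=
  ciInf_le (φ.bddBelow v) x

theorem CFormula.exists_lt_of_inf_lt {n : ℕ} (φ : CFormula (n + 1)) (v : Fin n → M.Ball) {r : ℝ}
    (h : φ.inf.eval M v < r) : ∃ x, φ.eval M (Fin.cons x v) < r :=
  exists_lt_of_ciInf_lt h

theorem CFormula.exists_lt_of_lt_sup {n : ℕ} (φ : CFormula (n + 1)) (v : Fin n → M.Ball) {r : ℝ}
    (h : r < φ.sup.eval M v) : ∃ x, r < φ.eval M (Fin.cons x v) :=
  exists_lt_of_lt_ciSup h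

theorem CFormula.sup_le {n : ℕ} (φ : CFormula (n + 1)) (v : Fin n → M.Ball) {r : ℝ}
    (h : ∀ x, φ.eval M (Fin.cons x v) ≤ r) : φ.sup.eval M v ≤ r := ciSup_le h

theorem CFormula.le_inf {n : ℕ} (φ : CFormula (n + 1)) (v : Fin n → M.Ball) {r : ℝ}
    (h : ∀ x, r ≤ φ.eval M (Fin.cons x v)) : r ≤ φ.inf.eval M v := le_ciInf h

theorem dist_cons_cons {α : Type*} [PseudoMetricSpace α] {n : ℕ} (x : α) (v w : Fin n → α) :
    dist (Fin.cons x v : Fin (n + 1) → α) (Fin.cons x w) ≤ dist v w := by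
  rw [dist_pi_le_iff dist_nonneg]
  intro i
  cases i using Fin.cases with
  | zero => simp
  | succ i => simpa using dist_le_pi_dist v w i

theorem CFormula.uniformContinuous_eval {n : ℕ} (φ : CFormula n) :
    UniformContinuous fun v => φ.eval M v := by
  induction φ with
  | dist s t => exact s.uniformContinuous_eval.dist t.uniformContinuous_eval
  | norm a t =>
    exact uniformContinuous_norm.comp
      (uniformContinuous_sum_smul a _ fun i => (t i).uniformContinuous_eval)
  | D t => exact M.lip.uniformContinuous.comp t.uniformContinuous_eval
  | @conn n k c φ ih =>
    choose B hB0 hB using fun i => (φ i).exists_bound.{u}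
    have hc := (isCompact_univ_pi fun i => isCompact_Icc (a := -B i) (b := B i)).uniformContinuousOn_of_continuous
      c.continuous.continuousOn
    rw [uniformContinuousOn_iff_restrict] at hc
    exact hc.comp (UniformContinuous.subtype_mk (uniformContinuous_pi.2 ih)
      fun v i _ => abs_le.1 (hB i M v))
  | sup φ ih =>
    rw [Metric.uniformContinuous_iff] at ih ⊢
    intro ε hε
    obtain ⟨δ, hδ, h⟩ := ih (ε / 2) (half_pos hε)
    refine ⟨δ, hδ, fun v w hvw => lt_of_le_of_lt ?_ (half_lt_self hε)⟩
    have key : ∀ v w : Fin _ → M.Ball, Dist.dist v w < δ → φ.sup.eval M v ≤ φ.sup.eval M w + ε / 2 := by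
      intro v w hvw
      refine φ.sup_le v fun x => ?_
      have h1 := h ((dist_cons_cons x v w).trans_lt hvw)
      rw [Real.dist_eq, abs_lt] at h1
      linarith [φ.eval_le_sup w x]
    rw [Real.dist_eq, abs_le]
    constructor
    · linarith [key w v (by rwa [dist_comm])]
    · linarith [key v w hvw]
  | inf φ ih =>
    rw [Metric.uniformContinuous_iff] at ih ⊢
    intro ε hε
    obtain ⟨δ, hδ, h⟩ := ih (ε / 2) (half_pos hε)
    refine ⟨δ, hδ, fun v w hvw => lt_of_le_of_lt ?_ (half_lt_self hε)⟩
    have key : ∀ v w : Fin _ → M.Ball, Dist.dist v w < δ → φ.inf.eval M v - ε / 2 ≤ φ.inf.eval M w := by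
      intro v w hvw
      refine φ.le_inf w fun x => ?_
      have h1 := h ((dist_cons_cons x v w).trans_lt hvw)
      rw [Real.dist_eq, abs_lt] at h1
      linarith [φ.inf_le_eval v x]
    rw [Real.dist_eq, abs_le]
    constructor
    · linarith [key w v (by rwa [dist_comm])]
    · linarith [key v w hvw]

/-! ### Transfer of universal sentences -/

/-- Induction on the number of free variables: taking the supremum of `|φ|` over one variable turns
a universal condition into one with fewer variables, until a sentence of the theory is reached. -/
theorem eval_eq_zero_of_models {N : BanachStr.{v}} (h : N.Models M.theory) {n : ℕ} (φ : CFormula n)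
    (hM : ∀ w : Fin n → M.Ball, φ.eval M w = 0) (w : Fin n → N.Ball) : φ.eval N w = 0 := by
  induction n with
  | zero =>
    rw [Subsingleton.elim w Fin.elim0]
    exact h φ (hM _)
  | succ n ih =>
    let ψ : CFormula (n + 1) := .conn (k := 1) ⟨fun t => |t 0|, by fun_prop⟩ fun _ => φ
    have hψ : ∀ (K : BanachStr.{v}) (w : Fin (n + 1) → K.Ball), ψ.eval K w = |φ.eval K w| :=
      fun _ _ => rfl
    have hψ' : ∀ w : Fin (n + 1) → M.Ball, ψ.eval M w = |φ.eval M w| := fun _ => rfl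
    have h1 := ih ψ.sup (fun w => by
      refine le_antisymm (ψ.sup_le w fun x => by rw [hψ', hM, abs_zero])
        (le_trans ?_ (ψ.eval_le_sup w default))
      rw [hψ', hM, abs_zero]) (Fin.tail w)
    have h2 := ψ.eval_le_sup (Fin.tail w) (w 0)
    rw [h1, Fin.cons_self_tail, hψ] at h2
    exact abs_eq_zero.1 (le_antisymm h2 (abs_nonneg _))

/-- If `D` is the distance to its zero set in `M`, then universal conditions relativized to the zero
set of `D` are inherited by the models of the theory of `M`. -/
theorem eval_eq_zero_of_models_of_zeros {N : BanachStr.{v}} (h : N.Models M.theory)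
    (hD : ∀ (x : M.Ball) (ε : ℝ), 0 < ε → ∃ z, M.D z = 0 ∧ dist x z < M.D x + ε)
    {n : ℕ} (φ : CFormula n) (hM : ∀ w : Fin n → M.Ball, (∀ i, M.D (w i) = 0) → φ.eval M w = 0)
    (w : Fin n → N.Ball) (hw : ∀ i, N.D (w i) = 0) : φ.eval N w = 0 := by
  rw [← abs_eq_zero]
  refine le_antisymm (le_of_forall_pos_le_add fun ε hε => ?_) (abs_nonneg _)
  obtain ⟨δ, hδ, hu⟩ := Metric.uniformContinuous_iff.1 (φ.uniformContinuous_eval (M := M)) ε hε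
  -- In `M` the product vanishes: if the values of `D` add up to less than `δ`, then `w` is
  -- `δ`-close to zeros of `D` and `|φ| ≤ ε` by uniform continuity. At zeros of `D` in `N` the
  -- second factor is `δ > 0`, so the first must vanish.
  let θ : CFormula n := .conn (k := n + 1)
    ⟨fun t => max (|t 0| - ε) 0 * max (δ - ∑ i : Fin n, t i.succ) 0, by fun_prop⟩
    (Fin.cons φ fun i => .D (.var i))
  have hθ := eval_eq_zero_of_models h θ (fun w => by
    change max (|φ.eval M w| - ε) 0 * max (δ - ∑ i, M.D (w i)) 0 = 0
    by_cases hs : ∑ i, M.D (w i) < δ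
    · have hlt : ∀ i, M.D (w i) < δ := fun i =>
        (Finset.single_le_sum (fun j _ => M.nonneg (w j)) (Finset.mem_univ i)).trans_lt hs
      choose z hz hwz using fun i => hD (w i) (δ - M.D (w i)) (sub_pos.2 (hlt i))
      have := hu (a := w) (b := z) ((dist_pi_lt_iff hδ).2 fun i => by linarith [hwz i])
      rw [hM z hz, Real.dist_eq, sub_zero] at this
      rw [max_eq_right (by linarith), zero_mul]
    · rw [max_eq_right (b := (0 : ℝ)) (a := δ - _) (by linarith), mul_zero]) w
  change max (|φ.eval N w| - ε) 0 * max (δ - ∑ i, N.D (w i)) 0 = 0 at hθ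
  simp only [hw, Finset.sum_const_zero, sub_zero, max_eq_left hδ.le, mul_eq_zero, hδ.ne',
    or_false] at hθ
  linarith [max_eq_right_iff.1 hθ]

end Formulas

/-! ### Ultrapowers over a nonprincipal ultrafilter on `ℕ` -/

theorem exists_tendsto_hyperfilter {f : ℕ → ℝ} {a b : ℝ} (h : ∀ k, f k ∈ Set.Icc a b) :
    ∃ l ∈ Set.Icc a b, Tendsto f (hyperfilter ℕ : Filter ℕ) (𝓝 l) := by
  obtain ⟨l, hl, hle⟩ := isCompact_Icc.ultrafilter_le_nhds ((hyperfilter ℕ).map f)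
    (le_principal_iff.2 (Filter.Eventually.of_forall (f := (hyperfilter ℕ : Filter ℕ)) h))
  exact ⟨l, hl, hle⟩

section Ultrapower

variable {X : Type u} [NormedAddCommGroup X] [NormedSpace ℝ X]

variable (X) in
/-- The bounded sequences with limit `0` along the ultrafilter. -/
def nullSequences : Submodule ℝ (ℕ →ᵇ X) where
  carrier := {f | Tendsto (fun k => f k) (hyperfilter ℕ : Filter ℕ) (𝓝 0)}
  add_mem' hf hg := by simpa using Tendsto.add hf hg
  zero_mem' := by simp
  smul_mem' c f hf := by simpa using Tendsto.const_smul hf c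

theorem mem_nullSequences {f : ℕ →ᵇ X} :
    f ∈ nullSequences X ↔ Tendsto (fun k => f k) (hyperfilter ℕ : Filter ℕ) (𝓝 0) := Iff.rfl

instance : IsClosed (nullSequences X : Set (ℕ →ᵇ X)) := by
  refine isClosed_of_closure_subset fun f hf => ?_
  rw [SetLike.mem_coe, mem_nullSequences, Metric.tendsto_nhds]
  intro ε hε
  obtain ⟨g, hg, hfg⟩ := Metric.mem_closure_iff.1 hf (ε / 2) (half_pos hε)
  filter_upwards [Metric.tendsto_nhds.1 (mem_nullSequences.1 hg) (ε / 2) (half_pos hε)] with k hk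
  linarith [dist_triangle (f k) (g k) 0, BoundedContinuousFunction.dist_coe_le_dist (f := f) (g := g) k]

/-- Entries outside a set of the ultrafilter do not affect the class, so the sequence may be
replaced by `0` wherever the bound fails. -/
theorem norm_mk_nullSequences_le {f : ℕ →ᵇ X} {c : ℝ} (hc : 0 ≤ c)
    (h : ∀ᶠ k in (hyperfilter ℕ : Filter ℕ), ‖f k‖ ≤ c) :
    ‖(nullSequences X).mkQ f‖ ≤ c := by
  classical
  let g : ℕ →ᵇ X := BoundedContinuousFunction.ofNormedAddCommGroupDiscrete
    (fun k => if ‖f k‖ ≤ c then f k else 0) c (fun k => by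
      split_ifs with hk
      · exact hk
      · simpa using hc)
  have hfg : (nullSequences X).mkQ f = (nullSequences X).mkQ g := by
    rw [Submodule.mkQ_apply, Submodule.mkQ_apply, Submodule.Quotient.eq, mem_nullSequences]
    refine tendsto_const_nhds.congr' ?_
    filter_upwards [h] with k hk
    simp [g, hk]
  rw [hfg]
  refine (Submodule.Quotient.norm_mk_le (S := nullSequences X) g).trans ?_
  exact (BoundedContinuousFunction.norm_le hc).2 fun k => by
    change ‖if ‖f k‖ ≤ c then f k else 0‖ ≤ c
    split_ifs with hk
    · exact hk
    · simpa using hc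

/-- The limit `l` of the norms bounds the quotient norm by truncation of the representative.
Conversely any other representative differs by a null sequence, so its supremum norm is at least
`l`. -/
theorem tendsto_norm_mk_nullSequences (f : ℕ →ᵇ X) :
    Tendsto (fun k => ‖f k‖) (hyperfilter ℕ : Filter ℕ) (𝓝 ‖(nullSequences X).mkQ f‖) := by
  obtain ⟨l, hl, hfl⟩ := exists_tendsto_hyperfilter (f := fun k => ‖f k‖) (a := 0) (b := ‖f‖)
    fun k => ⟨norm_nonneg _, f.norm_coe_le_norm k⟩
  suffices h : ‖(nullSequences X).mkQ f‖ = l by rwa [h]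
  refine le_antisymm (le_of_forall_pos_le_add fun ε hε => ?_)
    (le_of_forall_pos_le_add fun ε hε => ?_)
  · refine norm_mk_nullSequences_le (by linarith [hl.1]) ?_
    filter_upwards [hfl.eventually (gt_mem_nhds (lt_add_of_pos_right l hε))] with k hk using hk.le
  · obtain ⟨g, hg, hgn⟩ := Submodule.Quotient.norm_mk_lt ((nullSequences X).mkQ f) hε
    have hd := (Submodule.Quotient.eq _).1 hg
    rw [mem_nullSequences] at hd
    have h1 := (hd.norm.const_add ‖g‖)
    rw [norm_zero, add_zero] at h1
    have : l ≤ ‖g‖ := by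
      have h2 := hfl.sub hd.norm
      rw [norm_zero, sub_zero] at h2
      refine le_of_tendsto h2 (Eventually.of_forall fun k => ?_)
      have h3 := norm_sub_norm_le (f k) (f k - g k)
      rw [sub_sub_cancel] at h3
      have h4 : ‖(g - f) k‖ = ‖f k - g k‖ := by
        rw [BoundedContinuousFunction.sub_apply, norm_sub_rev]
      rw [h4]
      exact h3.trans (g.norm_coe_le_norm k)
    exact this.trans hgn.le

end Ultrapower

/-! ### The ultrapower as a Banach structure -/

namespace BanachStr

variable (M : BanachStr.{u})

/-- The sequence of elements of the unit ball as a bounded function. -/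
noncomputable def ballSeq (x : ℕ → M.Ball) : ℕ →ᵇ M.X :=
  BoundedContinuousFunction.ofNormedAddCommGroupDiscrete (fun k => (x k : M.X)) 1
    fun k => (x k).norm_le

variable {M}

/-- Truncating a representative moves its `k`-th term by at most `max 1 ‖f k‖ - 1`, which tends to
`0` because the norms have a limit at most `1`. -/
theorem exists_ballSeq_eq {x : (ℕ →ᵇ M.X) ⧸ nullSequences M.X} (hx : ‖x‖ ≤ 1) :
    ∃ y : ℕ → M.Ball, (nullSequences M.X).mkQ (M.ballSeq y) = x := by
  obtain ⟨f, rfl⟩ := (nullSequences M.X).mkQ_surjective x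
  refine ⟨fun k => M.truncate (f k), ?_⟩
  rw [Submodule.mkQ_apply, Submodule.mkQ_apply, Submodule.Quotient.eq, mem_nullSequences]
  have h1 : Tendsto (fun k => max 1 ‖f k‖ - 1) (hyperfilter ℕ : Filter ℕ) (𝓝 0) := by
    have := ((tendsto_const_nhds (x := (1 : ℝ))).max (tendsto_norm_mk_nullSequences f)).sub_const 1
    rwa [max_eq_left hx, sub_self] at this
  refine squeeze_zero_norm (fun k => ?_) h1
  have hm : 1 ≤ max 1 ‖f k‖ := le_max_left _ _
  have hm0 : 0 < max 1 ‖f k‖ := by linarith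
  change ‖(M.truncate (f k) : M.X) - f k‖ ≤ _
  rw [truncate_coe]
  have : (max 1 ‖f k‖)⁻¹ • f k - f k = (-((max 1 ‖f k‖ - 1) / max 1 ‖f k‖)) • f k := by
    rw [sub_div, div_self hm0.ne', neg_sub, sub_smul, one_smul, one_div]
  rw [this, norm_smul, Real.norm_eq_abs, abs_neg, abs_of_nonneg (div_nonneg (by linarith) hm0.le),
    div_mul_eq_mul_div, div_le_iff₀ hm0]
  exact mul_le_mul_of_nonneg_left (le_max_right _ _) (by linarith)

theorem mkQ_ballSeq_eq_iff {x y : ℕ → M.Ball} :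
    (nullSequences M.X).mkQ (M.ballSeq x) = (nullSequences M.X).mkQ (M.ballSeq y) ↔
      Tendsto (fun k => dist (x k) (y k)) (hyperfilter ℕ : Filter ℕ) (𝓝 0) := by
  rw [Submodule.mkQ_apply, Submodule.mkQ_apply, Submodule.Quotient.eq, mem_nullSequences,
    tendsto_zero_iff_norm_tendsto_zero]
  simp only [Subtype.dist_eq, dist_eq_norm]
  rfl

theorem tendsto_dist_ballSeq (x y : ℕ → M.Ball) :
    Tendsto (fun k => dist (x k) (y k)) (hyperfilter ℕ : Filter ℕ)
      (𝓝 (dist ((nullSequences M.X).mkQ (M.ballSeq x)) ((nullSequences M.X).mkQ (M.ballSeq y)))) := by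
  rw [dist_eq_norm, ← map_sub]
  simp only [Subtype.dist_eq, dist_eq_norm]
  exact tendsto_norm_mk_nullSequences (M.ballSeq x - M.ballSeq y)

theorem norm_mkQ_ballSeq_le (x : ℕ → M.Ball) : ‖(nullSequences M.X).mkQ (M.ballSeq x)‖ ≤ 1 :=
  norm_mk_nullSequences_le zero_le_one (Eventually.of_forall fun k => (x k).norm_le)

/-- A sequence that represents an element of the unit ball of the ultrapower. -/
noncomputable def rep (x : Metric.closedBall (0 : (ℕ →ᵇ M.X) ⧸ nullSequences M.X) 1) :
    ℕ → M.Ball :=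
  (exists_ballSeq_eq (mem_closedBall_zero_iff.1 x.2)).choose

theorem mkQ_rep (x : Metric.closedBall (0 : (ℕ →ᵇ M.X) ⧸ nullSequences M.X) 1) :
    (nullSequences M.X).mkQ (M.ballSeq (rep x)) = x :=
  (exists_ballSeq_eq (mem_closedBall_zero_iff.1 x.2)).choose_spec

theorem exists_tendsto_D (x : ℕ → M.Ball) :
    ∃ l ∈ Set.Icc (0 : ℝ) 2, Tendsto (fun k => M.D (x k)) (hyperfilter ℕ : Filter ℕ) (𝓝 l) :=
  exists_tendsto_hyperfilter fun _ => ⟨M.nonneg _, M.le_two _⟩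

variable (M) in
/-- The ultrapower of `M` over a nonprincipal ultrafilter on `ℕ`. -/
noncomputable def ultrapower : BanachStr.{u} where
  X := (ℕ →ᵇ M.X) ⧸ nullSequences M.X
  D x := (exists_tendsto_D (rep x)).choose
  lip := LipschitzWith.of_dist_le_mul fun x y => by
    have hx := (exists_tendsto_D (rep x)).choose_spec.2
    have hy := (exists_tendsto_D (rep y)).choose_spec.2
    have h := tendsto_dist_ballSeq (rep x) (rep y)
    rw [mkQ_rep x, mkQ_rep y] at h
    rw [NNReal.coe_one, one_mul]
    refine le_of_tendsto_of_tendsto' (hx.dist hy) h fun k => ?_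
    simpa using M.lip.dist_le_mul (rep x k) (rep y k)
  nonneg x := (exists_tendsto_D (rep x)).choose_spec.1.1
  le_two x := (exists_tendsto_D (rep x)).choose_spec.1.2

/-- The class in the ultrapower of a sequence in the unit ball. -/
noncomputable def cls (x : ℕ → M.Ball) : M.ultrapower.Ball :=
  ⟨(nullSequences M.X).mkQ (M.ballSeq x), mem_closedBall_zero_iff.2 (norm_mkQ_ballSeq_le x)⟩

theorem cls_surjective (x : M.ultrapower.Ball) : ∃ y, cls (M := M) y = x :=
  ⟨rep x, Subtype.ext (mkQ_rep x)⟩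

/-- `D` on the ultrapower is defined through a chosen representative; the Lipschitz condition makes
the limit independent of that choice. -/
theorem tendsto_D_cls (x : ℕ → M.Ball) :
    Tendsto (fun k => M.D (x k)) (hyperfilter ℕ : Filter ℕ) (𝓝 (M.ultrapower.D (cls x))) := by
  have h1 : Tendsto (fun k => M.D (rep (cls x) k)) (hyperfilter ℕ : Filter ℕ)
    (𝓝 (M.ultrapower.D (cls x))) := (exists_tendsto_D (rep (cls x))).choose_spec.2
  have h2 := mkQ_ballSeq_eq_iff.1 (mkQ_rep (M := M) (cls x))
  refine tendsto_of_tendsto_of_dist h1 (squeeze_zero (fun _ => dist_nonneg) (fun k => ?_) h2)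
  simpa using M.lip.dist_le_mul _ _

theorem tendsto_norm_sum_cls {k : ℕ} (a : Fin k → ℝ) (x : Fin k → ℕ → M.Ball) :
    Tendsto (fun n => ‖∑ i, a i • (x i n : M.X)‖) (hyperfilter ℕ : Filter ℕ)
      (𝓝 ‖∑ i, a i • (cls (x i) : M.ultrapower.X)‖) := by
  have h := tendsto_norm_mk_nullSequences (∑ i, a i • M.ballSeq (x i))
  have h1 : (nullSequences M.X).mkQ (∑ i, a i • M.ballSeq (x i)) =
      (∑ i, a i • (cls (x i) : M.ultrapower.X) : M.ultrapower.X) := by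
    rw [map_sum]
    exact Finset.sum_congr rfl fun i _ => by rw [map_smul]; rfl
  rw [h1] at h
  refine h.congr fun n => ?_
  congr 1
  rw [BoundedContinuousFunction.coe_sum, Finset.sum_apply]
  rfl

theorem truncate_sum_cls {k : ℕ} (a : Fin k → ℝ) (x : Fin k → ℕ → M.Ball) :
    M.ultrapower.truncate (∑ i, a i • (cls (x i) : M.ultrapower.X)) =
      cls fun n => M.truncate (∑ i, a i • (x i n : M.X)) := by
  have h := tendsto_norm_sum_cls a x
  set s := ∑ i, a i • (cls (x i) : M.ultrapower.X) with hs
  apply Subtype.ext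
  rw [truncate_coe]
  have h1 : s = (nullSequences M.X).mkQ (∑ i, a i • M.ballSeq (x i)) := by
    rw [map_sum]
    exact Finset.sum_congr rfl fun i _ => by rw [map_smul]; rfl
  have h2 : (max 1 ‖s‖)⁻¹ • s =
      (nullSequences M.X).mkQ ((max 1 ‖s‖)⁻¹ • ∑ i, a i • M.ballSeq (x i)) := by
    rw [map_smul, ← h1]; rfl
  rw [h2]
  change (nullSequences M.X).mkQ _ = (nullSequences M.X).mkQ _
  rw [Submodule.mkQ_apply, Submodule.mkQ_apply, Submodule.Quotient.eq, mem_nullSequences]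
  have h3 : Tendsto (fun n => ((max 1 ‖s‖)⁻¹ - (max 1 ‖∑ i, a i • (x i n : M.X)‖)⁻¹))
      (hyperfilter ℕ : Filter ℕ) (𝓝 0) := by
    have := ((tendsto_const_nhds (x := (1 : ℝ))).max h).inv₀ (lt_of_lt_of_le one_pos (le_max_left 1 ‖s‖)).ne'
    simpa using this.const_sub ((max 1 ‖s‖)⁻¹)
  have h4 : Tendsto (fun n => ‖(max 1 ‖s‖)⁻¹ - (max 1 ‖∑ i, a i • (x i n : M.X)‖)⁻¹‖ *
      ‖∑ i, a i • (x i n : M.X)‖) (hyperfilter ℕ : Filter ℕ) (𝓝 0) := by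
    simpa using h3.norm.mul h
  refine squeeze_zero_norm (fun n => ?_) h4
  rw [← norm_smul, sub_smul, BoundedContinuousFunction.sub_apply,
    BoundedContinuousFunction.smul_apply, BoundedContinuousFunction.coe_sum, Finset.sum_apply]
  exact le_rfl

end BanachStr

open BanachStr

/-! ### Łoś's theorem and elementarity of the diagonal embedding -/

section Los

variable {M : BanachStr.{u}}

theorem CTerm.eval_ultrapower {n : ℕ} (t : CTerm n) (v : Fin n → ℕ → M.Ball) :
    t.eval M.ultrapower (fun i => cls (v i)) = cls fun k => t.eval M fun i => v i k := by
  induction t with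
  | var i => rfl
  | zero =>
    apply Subtype.ext
    change (0 : (ℕ →ᵇ M.X) ⧸ nullSequences M.X) = (nullSequences M.X).mkQ _
    rw [← map_zero (nullSequences M.X).mkQ]
    rfl
  | sigma a t ih =>
    simp only [CTerm.eval, ih]
    exact truncate_sum_cls a fun i k => (t i).eval M fun j => v j k

theorem cls_cons {n : ℕ} (x : ℕ → M.Ball) (v : Fin n → ℕ → M.Ball) :
    (fun i => cls ((Fin.cons x v : Fin (n + 1) → ℕ → M.Ball) i)) =
      (Fin.cons (cls x) fun i => cls (v i) : Fin (n + 1) → M.ultrapower.Ball) := by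
  funext i
  cases i using Fin.cases <;> rfl

theorem apply_cons {α : Type*} {n : ℕ} (x : ℕ → α) (v : Fin n → ℕ → α) (k : ℕ) :
    (fun i => (Fin.cons x v : Fin (n + 1) → ℕ → α) i k) =
      (Fin.cons (x k) fun i => v i k : Fin (n + 1) → α) := by
  funext i
  cases i using Fin.cases <;> rfl

/-- Łoś's theorem. -/
theorem CFormula.tendsto_eval_ultrapower {n : ℕ} (φ : CFormula n) (v : Fin n → ℕ → M.Ball) :
    Tendsto (fun k => φ.eval M fun i => v i k) (hyperfilter ℕ : Filter ℕ)
      (𝓝 (φ.eval M.ultrapower fun i => cls (v i))) := by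
  induction φ with
  | dist s t =>
    simp only [CFormula.eval, CTerm.eval_ultrapower]
    exact tendsto_dist_ballSeq _ _
  | norm a t =>
    simp only [CFormula.eval, CTerm.eval_ultrapower]
    exact tendsto_norm_sum_cls a _
  | D t =>
    simp only [CFormula.eval, CTerm.eval_ultrapower]
    exact tendsto_D_cls _
  | conn c φ ih =>
    exact (c.continuous.tendsto _).comp (tendsto_pi_nhds.2 fun i => ih i v)
  | sup φ ih =>
    have ih' : ∀ x : ℕ → M.Ball, Tendsto (fun k => φ.eval M (Fin.cons (x k) fun i => v i k))
        (hyperfilter ℕ : Filter ℕ)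
        (𝓝 (φ.eval M.ultrapower (Fin.cons (cls x) fun i => cls (v i)))) := by
      intro x
      have := ih (Fin.cons x v)
      rw [cls_cons] at this
      simpa only [apply_cons] using this
    rw [Metric.tendsto_nhds]
    intro ε hε
    -- A nearly optimal point of the ultrapower bounds the suprema in `M` from below along the
    -- ultrafilter. The class of a sequence of nearly optimal points of `M` bounds them from above.
    obtain ⟨y, hy⟩ := φ.exists_lt_of_lt_sup (M := M.ultrapower) (fun i => cls (v i))
      (sub_lt_self _ (half_pos hε))
    obtain ⟨x, rfl⟩ := cls_surjective y
    choose z hz using fun k => φ.exists_lt_of_lt_sup (M := M) (fun i => v i k)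
      (sub_lt_self _ (half_pos hε))
    have hz' := φ.eval_le_sup (M := M.ultrapower) (fun i => cls (v i)) (cls z)
    filter_upwards [Metric.tendsto_nhds.1 (ih' x) (ε / 2) (half_pos hε),
      Metric.tendsto_nhds.1 (ih' z) (ε / 2) (half_pos hε)] with k h1 h2
    rw [Real.dist_eq, abs_lt] at *
    have h3 := φ.eval_le_sup (fun i => v i k) (x k)
    have h4 := hz k
    constructor <;> linarith
  | inf φ ih =>
    have ih' : ∀ x : ℕ → M.Ball, Tendsto (fun k => φ.eval M (Fin.cons (x k) fun i => v i k))
        (hyperfilter ℕ : Filter ℕ)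
        (𝓝 (φ.eval M.ultrapower (Fin.cons (cls x) fun i => cls (v i)))) := by
      intro x
      have := ih (Fin.cons x v)
      rw [cls_cons] at this
      simpa only [apply_cons] using this
    rw [Metric.tendsto_nhds]
    intro ε hε
    obtain ⟨y, hy⟩ := φ.exists_lt_of_inf_lt (M := M.ultrapower) (fun i => cls (v i))
      (lt_add_of_pos_right _ (half_pos hε))
    obtain ⟨x, rfl⟩ := cls_surjective y
    choose z hz using fun k => φ.exists_lt_of_inf_lt (M := M) (fun i => v i k)
      (lt_add_of_pos_right _ (half_pos hε))
    have hz' := φ.inf_le_eval (M := M.ultrapower) (fun i => cls (v i)) (cls z)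
    filter_upwards [Metric.tendsto_nhds.1 (ih' x) (ε / 2) (half_pos hε),
      Metric.tendsto_nhds.1 (ih' z) (ε / 2) (half_pos hε)] with k h1 h2
    rw [Real.dist_eq, abs_lt] at *
    have h3 := φ.inf_le_eval (fun i => v i k) (x k)
    have h4 := hz k
    constructor <;> linarith

/-- The diagonal embedding of `M` into its ultrapower. -/
noncomputable def diag (x : M.Ball) : M.ultrapower.Ball := cls fun _ => x

theorem isElementary_diag : IsElementary (diag (M := M)) := fun _ φ v =>
  (tendsto_nhds_unique (φ.tendsto_eval_ultrapower fun i _ => v i) tendsto_const_nhds)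

/-- If a formula takes arbitrarily small values in `M` in absolute value, it takes the value `0`
in the ultrapower. -/
theorem exists_eval_diag_eq_zero {n : ℕ} (φ : CFormula (n + 1)) (v : Fin n → M.Ball)
    (h : ∀ ε > 0, ∃ x : M.Ball, |φ.eval M (Fin.cons x v)| < ε) :
    ∃ x : M.ultrapower.Ball, φ.eval M.ultrapower (Fin.cons x fun i => diag (v i)) = 0 := by
  choose x hx using fun k : ℕ => h (1 / ((k : ℝ) + 1)) (by positivity)
  refine ⟨cls x, ?_⟩
  have h1 := φ.tendsto_eval_ultrapower (Fin.cons x fun i _ => v i)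
  rw [cls_cons] at h1
  simp only [apply_cons] at h1
  refine tendsto_nhds_unique h1 (squeeze_zero_norm (fun k => (hx k).le) ?_)
  exact tendsto_one_div_add_atTop_nhds_zero_nat.mono_left
    (hyperfilter_le_cofinite.trans_eq Nat.cofinite_eq_atTop)

end Los

/-! ### Orthogonal families of closed subspaces -/

/-- An infinite family of pairwise orthogonal infinite dimensional closed subspaces. -/
structure Comps (H : Type u) [NormedAddCommGroup H] [InnerProductSpace ℝ H] where
  I : Type u
  V : I → Submodule ℝ H
  closed : ∀ i, IsClosed (V i : Set H)
  orth : ∀ i j, i ≠ j → ∀ x ∈ V i, ∀ y ∈ V j, ⟪x, y⟫ = 0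
  infd : ∀ i, ¬ FiniteDimensional ℝ (V i)
  infI : Infinite I

namespace Comps

variable {H : Type u} [NormedAddCommGroup H] [InnerProductSpace ℝ H] (d : Comps H)

instance : Infinite d.I := d.infI

/-- The subspaces of the family, together with the orthogonal complement of their sum. -/
noncomputable def W : Option d.I → Submodule ℝ H
  | none => (⨆ i, d.V i)ᗮ
  | some i => d.V i

@[simp] theorem W_some (i : d.I) : d.W (some i) = d.V i := rfl

theorem isClosed_W (o : Option d.I) : IsClosed (d.W o : Set H) := by
  cases o with
  | none => exact Submodule.isClosed_orthogonal _
  | some i => exact d.closed i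

theorem mem_W_none {x : H} : x ∈ d.W none ↔ ∀ i, ∀ y ∈ d.V i, ⟪y, x⟫ = 0 := by
  rw [W, ← Submodule.iInf_orthogonal, Submodule.mem_iInf]
  exact forall_congr' fun i => Submodule.mem_orthogonal _ _

theorem inner_eq_zero {o o' : Option d.I} (h : o ≠ o') {x y : H} (hx : x ∈ d.W o)
    (hy : y ∈ d.W o') : ⟪x, y⟫ = 0 := by
  cases o with
  | none =>
    cases o' with
    | none => exact absurd rfl h
    | some j => rw [real_inner_comm]; exact d.mem_W_none.1 hx j y hy
  | some i =>
    cases o' with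
    | none => exact d.mem_W_none.1 hy i x hx
    | some j => exact d.orth i j (fun e => h (by rw [e])) x hx y hy

theorem eq_of_inner_ne_zero {o o' : Option d.I} {x y : H} (hx : x ∈ d.W o) (hy : y ∈ d.W o')
    (h : ⟪x, y⟫ ≠ 0) : o = o' := by
  by_contra hne
  exact h (d.inner_eq_zero hne hx hy)

theorem orthogonalFamily :
    OrthogonalFamily ℝ (fun o => d.W o) fun o => (d.W o).subtypeₗᵢ := fun _ _ h x y =>
  d.inner_eq_zero h x.2 y.2

variable [CompleteSpace H]

instance (o : Option d.I) : CompleteSpace (d.W o) := (d.isClosed_W o).completeSpace_coe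

/-- The orthogonal projections. -/
noncomputable def P (o : Option d.I) : H →L[ℝ] H := (d.W o).starProjection

theorem P_mem (o : Option d.I) (x : H) : d.P o x ∈ d.W o := Submodule.starProjection_apply_mem _ _

theorem P_eq_self {o : Option d.I} {x : H} (hx : x ∈ d.W o) : d.P o x = x :=
  Submodule.starProjection_eq_self_iff.2 hx

theorem P_eq_zero {o o' : Option d.I} (h : o ≠ o') {x : H} (hx : x ∈ d.W o') : d.P o x = 0 :=
  Submodule.eq_starProjection_of_mem_of_inner_eq_zero (Submodule.zero_mem _) fun w hw => by
    rw [sub_zero]; exact d.inner_eq_zero h.symm hx hw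

theorem inner_P_left (o : Option d.I) (x : H) {y : H} (hy : y ∈ d.W o) : ⟪d.P o x, y⟫ = ⟪x, y⟫ := by
  have := Submodule.starProjection_inner_eq_zero (K := d.W o) x y hy
  rw [inner_sub_left, sub_eq_zero] at this
  exact this.symm

theorem inner_P_right (o : Option d.I) (x : H) {y : H} (hy : y ∈ d.W o) :
    ⟪y, d.P o x⟫ = ⟪y, x⟫ := by
  rw [real_inner_comm, d.inner_P_left o x hy, real_inner_comm]

theorem norm_P_le (o : Option d.I) (x : H) : ‖d.P o x‖ ≤ ‖x‖ :=
  Submodule.norm_starProjection_apply_le _ _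

/-- Density is automatic: a vector orthogonal to every component belongs to `W none`, hence is
orthogonal to itself. -/
theorem isHilbertSum : IsHilbertSum ℝ (fun o => d.W o) fun o => (d.W o).subtypeₗᵢ := by
  refine IsHilbertSum.mkInternal d.W d.orthogonalFamily ?_
  rw [top_le_iff, Submodule.topologicalClosure_eq_top_iff, eq_bot_iff]
  intro x hx
  have h1 : ∀ o, ∀ y ∈ d.W o, ⟪y, x⟫ = 0 := fun o y hy =>
    (Submodule.mem_orthogonal _ _).1 hx y (Submodule.mem_iSup_of_mem o hy)
  have h2 : x ∈ d.W none := d.mem_W_none.2 fun i y hy => h1 (some i) y hy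
  exact inner_self_eq_zero.1 (h1 none x h2)

theorem P_eq_of_hasSum {x : H} {y : Option d.I → H} (hy : ∀ o, y o ∈ d.W o) (h : HasSum y x)
    (o : Option d.I) : d.P o x = y o := by
  refine (h.mapL (d.P o)).unique ?_
  have := hasSum_single (f := fun o' => d.P o (y o')) o fun o' ho' =>
    d.P_eq_zero (Ne.symm ho') (hy o')
  rwa [d.P_eq_self (hy o)] at this

theorem hasSum_P (x : H) : HasSum (fun o => d.P o x) x := by
  set e := d.isHilbertSum.linearIsometryEquiv
  have h := d.isHilbertSum.hasSum_linearIsometryEquiv_symm (e x)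
  rw [LinearIsometryEquiv.symm_apply_apply] at h
  have h1 := fun o => d.P_eq_of_hasSum (y := fun o => (e x o : H)) (fun o => (e x o).2) h o
  simp only [h1]
  exact h

theorem hasSum_inner (x y : H) : HasSum (fun o => ⟪d.P o x, d.P o y⟫) ⟪x, y⟫ := by
  have h := (d.hasSum_P x).mapL (innerSL ℝ y)
  simp only [innerSL_apply_apply] at h
  rw [real_inner_comm] at h
  refine h.congr_fun fun o => ?_
  rw [real_inner_comm, ← d.inner_P_left o y (d.P_mem o x), real_inner_comm]

theorem hasSum_norm_sq (x : H) : HasSum (fun o => ‖d.P o x‖ ^ 2) (‖x‖ ^ 2) := by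
  have := d.hasSum_inner x x
  simpa only [real_inner_self_eq_norm_sq] using this

/-- A vector meets only countably many components. This is why uncountably many components suffice
for the back-and-forth argument. -/
theorem countable_support (x : H) : {o | d.P o x ≠ 0}.Countable := by
  have := (d.hasSum_norm_sq x).summable.countable_support
  refine this.mono fun o ho => ?_
  simpa using ho

theorem exists_of_components {y : Option d.I → H} (hy : ∀ o, y o ∈ d.W o)
    (hs : Summable fun o => ‖y o‖ ^ 2) : ∃ x, ∀ o, d.P o x = y o := by
  let f : lp (fun o => d.W o) 2 := ⟨fun o => ⟨y o, hy o⟩, memℓp_gen (by simpa using hs)⟩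
  exact ⟨d.isHilbertSum.linearIsometryEquiv.symm f,
    d.P_eq_of_hasSum hy (d.isHilbertSum.hasSum_linearIsometryEquiv_symm f)⟩

end Comps

theorem exists_unit_orthogonal {H : Type*} [NormedAddCommGroup H] [InnerProductSpace ℝ H]
    (V : Submodule ℝ H) (hV : ¬ FiniteDimensional ℝ V) {ι : Type*} [Finite ι] (w : ι → H) :
    ∃ e ∈ V, ‖e‖ = 1 ∧ ∀ i, ⟪w i, e⟫ = 0 := by
  have : Fintype ι := Fintype.ofFinite ι
  let f : V →ₗ[ℝ] (ι → ℝ) := LinearMap.pi fun i => (innerₛₗ ℝ (w i)).comp V.subtype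
  have hf : ¬ Function.Injective f := fun h => hV (FiniteDimensional.of_injective f h)
  rw [← LinearMap.ker_eq_bot] at hf
  obtain ⟨x, hx, hx0⟩ := Submodule.exists_mem_ne_zero_of_ne_bot hf
  have hx0' : (x : H) ≠ 0 := by simpa using hx0
  refine ⟨‖(x : H)‖⁻¹ • x, V.smul_mem _ x.2, ?_, fun i => ?_⟩
  · rw [norm_smul, norm_inv, norm_norm, inv_mul_cancel₀ (norm_ne_zero_iff.2 hx0')]
  · have : f x i = 0 := by rw [LinearMap.mem_ker.1 hx]; rfl
    rw [real_inner_smul_right]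
    have h2 : ⟪w i, (x : H)⟫ = 0 := this
    rw [h2, mul_zero]

/-- Extension of isometries by one point. -/
theorem exists_inner_eq {H K : Type*} [NormedAddCommGroup H] [InnerProductSpace ℝ H]
    [NormedAddCommGroup K] [InnerProductSpace ℝ K] (V : Submodule ℝ K)
    (hV : ¬ FiniteDimensional ℝ V) {ι : Type*} [Finite ι] (v : ι → H) (w : ι → K)
    (hw : ∀ i, w i ∈ V) (hvw : ∀ i j, ⟪v i, v j⟫ = ⟪w i, w j⟫) (x : H) :
    ∃ y ∈ V, ‖y‖ = ‖x‖ ∧ ∀ i, ⟪y, w i⟫ = ⟪x, v i⟫ := by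
  have : Fintype ι := Fintype.ofFinite ι
  obtain ⟨e, heV, he, hew⟩ := exists_unit_orthogonal V hV w
  have : FiniteDimensional ℝ (Submodule.span ℝ (Set.range v)) :=
    FiniteDimensional.span_of_finite ℝ (Set.finite_range v)
  set S := Submodule.span ℝ (Set.range v)
  obtain ⟨c, hc⟩ := (Submodule.mem_span_range_iff_exists_fun ℝ).1 (S.starProjection_apply_mem x)
  set q := x - S.starProjection x with hq
  have hqv : ∀ i, ⟪q, v i⟫ = 0 := fun i =>
    S.starProjection_inner_eq_zero x (v i) (Submodule.subset_span ⟨i, rfl⟩)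
  have hx : x = ∑ i, c i • v i + q := by rw [hc, hq]; abel
  have hin : ∀ j, ⟪∑ i, c i • w i, w j⟫ = ⟪∑ i, c i • v i, v j⟫ := fun j => by
    simp only [sum_inner, real_inner_smul_left, hvw]
  have hn : ‖∑ i, c i • w i‖ ^ 2 = ‖∑ i, c i • v i‖ ^ 2 := by
    rw [← real_inner_self_eq_norm_sq, ← real_inner_self_eq_norm_sq, inner_sum, inner_sum]
    simp only [real_inner_smul_right, hin]
  -- The part of `x` in the span of `v` is carried over with the same coefficients; the remainder
  -- `q` is replaced by a vector of the same length in the direction `e` orthogonal to all `w i`.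
  refine ⟨∑ i, c i • w i + ‖q‖ • e, V.add_mem (V.sum_mem fun i _ => V.smul_mem _ (hw i))
    (V.smul_mem _ heV), ?_, fun j => ?_⟩
  · have h1 : ⟪∑ i, c i • v i, q⟫ = 0 := by
      rw [real_inner_comm, inner_sum]
      simp [real_inner_smul_right, hqv]
    have h2 : ⟪∑ i, c i • w i, ‖q‖ • e⟫ = 0 := by
      simp [sum_inner, real_inner_smul_left, real_inner_smul_right, hew]
    have h3 : ‖∑ i, c i • w i + ‖q‖ • e‖ ^ 2 = ‖x‖ ^ 2 := by
      conv_rhs => rw [hx]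
      rw [norm_add_sq_real, norm_add_sq_real, h1, h2, hn, norm_smul, he, norm_norm, mul_one]
    exact (sq_eq_sq₀ (norm_nonneg _) (norm_nonneg _)).1 h3
  · rw [inner_add_left, hin, real_inner_smul_left, real_inner_comm (w j) e, hew, mul_zero, add_zero]
    conv_rhs => rw [hx]
    rw [inner_add_left, hqv, add_zero]

/-! ### Structures that are built from a family of orthogonal subspaces -/

/-- The Banach space of the structure is a Hilbert space. -/
class IsHilb (M : BanachStr.{u}) : Prop where
  out : InnerProductSpaceable M.X

noncomputable instance (M : BanachStr.{u}) [h : IsHilb M] : InnerProductSpace ℝ M.X :=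
  InnerProductSpace.ofNorm ℝ h.out.parallelogram_identity

/-- A family of components of `M`: the predicate `D` is the distance to the union of their unit
spheres. -/
structure Decomp (M : BanachStr.{u}) [IsHilb M] extends Comps M.X where
  D_of_mem : ∀ (z : M.Ball) (i : I), (z : M.X) ∈ V i → ‖(z : M.X)‖ = 1 → M.D z = 0
  exists_of_D : ∀ z : M.Ball, M.D z = 0 → ∃ i, (z : M.X) ∈ V i ∧ ‖(z : M.X)‖ = 1
  exists_dist_lt : ∀ (x : M.Ball) (ε : ℝ), 0 < ε → ∃ z, M.D z = 0 ∧ dist x z < M.D x + ε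

theorem BanachStr.coe_eq_of_norm_eq_one {M : BanachStr.{u}} {x : M.X} (h : ‖x‖ = 1) :
    ∃ z : M.Ball, (z : M.X) = x := ⟨⟨x, mem_closedBall_zero_iff.2 h.le⟩, rfl⟩

/-! ### The predicate `D` in terms of projections -/

namespace Decomp

variable {M : BanachStr.{u}} [IsHilb M] (d : Decomp M)

/-- The largest norm of a projection to a component. -/
noncomputable def gauge (x : M.X) : ℝ := ⨆ i, ‖d.P (some i) x‖

theorem norm_P_le_gauge (x : M.X) (i : d.I) : ‖d.P (some i) x‖ ≤ d.gauge x :=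
  le_ciSup (f := fun i => ‖d.P (some i) x‖)
    ⟨‖x‖, by rintro _ ⟨i, rfl⟩; exact d.norm_P_le _ _⟩ i

theorem gauge_le {x : M.X} {r : ℝ} (h : ∀ i, ‖d.P (some i) x‖ ≤ r) : d.gauge x ≤ r := ciSup_le h

theorem gauge_nonneg (x : M.X) : 0 ≤ d.gauge x := by
  obtain ⟨i⟩ : Nonempty d.I := inferInstance
  exact (norm_nonneg _).trans (d.norm_P_le_gauge x i)

theorem exists_unit (i : d.I) : ∃ z : M.Ball, (z : M.X) ∈ d.V i ∧ ‖(z : M.X)‖ = 1 := by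
  obtain ⟨e, he, he1, -⟩ := exists_unit_orthogonal (d.V i) (d.infd i) (ι := Empty) (H := M.X)
    Empty.elim
  exact ⟨⟨e, mem_closedBall_zero_iff.2 he1.le⟩, he, he1⟩

/-- For a unit vector `z` of component `i`, `‖x - z‖ ^ 2 = ‖x‖ ^ 2 + 1 - 2 * ⟪x, z⟫`, and the
largest possible inner product is `‖P (some i) x‖`, attained at the normalized projection. Since `D`
is the distance to the set of all these `z`, the supremum over `i` appears. -/
theorem D_sq (x : M.Ball) : M.D x ^ 2 = ‖(x : M.X)‖ ^ 2 + 1 - 2 * d.gauge x := by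
  apply le_antisymm
  · suffices h : d.gauge x ≤ (‖(x : M.X)‖ ^ 2 + 1 - M.D x ^ 2) / 2 by linarith
    refine d.gauge_le fun i => ?_
    obtain ⟨z, hz, hz1, hxz⟩ : ∃ z : M.Ball, (z : M.X) ∈ d.V i ∧ ‖(z : M.X)‖ = 1 ∧
        ⟪(x : M.X), z⟫ = ‖d.P (some i) x‖ := by
      by_cases h0 : d.P (some i) x = 0
      · obtain ⟨z, hz, hz1⟩ := d.exists_unit i
        refine ⟨z, hz, hz1, ?_⟩
        rw [← d.inner_P_left (some i) x hz, h0, inner_zero_left, norm_zero]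
      · have hn := norm_ne_zero_iff.2 h0
        have h1 : ‖‖d.P (some i) (x : M.X)‖⁻¹ • d.P (some i) (x : M.X)‖ = 1 := by
          rw [norm_smul, norm_inv, norm_norm, inv_mul_cancel₀ hn]
        have hm := (d.V i).smul_mem ‖d.P (some i) (x : M.X)‖⁻¹ (d.P_mem (some i) x)
        refine ⟨⟨_, mem_closedBall_zero_iff.2 h1.le⟩, hm, h1, ?_⟩
        rw [← d.inner_P_left (some i) x hm, real_inner_smul_right, real_inner_self_eq_norm_sq]
        field_simp
    have h2 : M.D x ≤ dist x z := by
      have h3 := M.lip.dist_le_mul x z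
      rw [d.D_of_mem z i hz hz1, Real.dist_eq, sub_zero, NNReal.coe_one, one_mul] at h3
      exact (le_abs_self _).trans h3
    have h4 : M.D x ^ 2 ≤ dist x z ^ 2 := pow_le_pow_left₀ (M.nonneg x) h2 2
    rw [Subtype.dist_eq, dist_eq_norm, norm_sub_sq_real, hxz, hz1] at h4
    linarith
  · have h : √(‖(x : M.X)‖ ^ 2 + 1 - 2 * d.gauge x) ≤ M.D x := by
      refine le_of_forall_pos_le_add fun ε hε => ?_
      obtain ⟨z, hz, hxz⟩ := d.exists_dist_lt x ε hε
      obtain ⟨i, hzi, hz1⟩ := d.exists_of_D z hz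
      refine le_trans (Real.sqrt_le_iff.2 ⟨dist_nonneg, ?_⟩) hxz.le
      rw [Subtype.dist_eq, dist_eq_norm, norm_sub_sq_real, hz1,
        ← d.inner_P_left (some i) (x : M.X) hzi]
      have h1 := real_inner_le_norm (d.P (some i) (x : M.X)) z
      rw [hz1, mul_one] at h1
      linarith [d.norm_P_le_gauge x i]
    by_cases h0 : 0 ≤ ‖(x : M.X)‖ ^ 2 + 1 - 2 * d.gauge x
    · exact (Real.sqrt_le_left (M.nonneg x)).1 h
    · linarith [sq_nonneg (M.D x)]

/-- The component of an element of the zero set of `D`. -/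
noncomputable def comp (z : M.Ball) (h : M.D z = 0) : d.I := (d.exists_of_D z h).choose

theorem mem_comp (z : M.Ball) (h : M.D z = 0) : (z : M.X) ∈ d.V (d.comp z h) :=
  (d.exists_of_D z h).choose_spec.1

theorem norm_of_D (d : Decomp M) (z : M.Ball) (h : M.D z = 0) : ‖(z : M.X)‖ = 1 :=
  (d.exists_of_D z h).choose_spec.2

theorem eq_of_mem {i j : d.I} {x : M.X} (hi : x ∈ d.V i) (hj : x ∈ d.V j) (hx : x ≠ 0) : i = j :=
  Option.some_injective _ (d.eq_of_inner_ne_zero (o := some i) (o' := some j) hi hj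
    (inner_self_ne_zero.2 hx))

end Decomp

/-! ### A formula that recognizes when two unit vectors share a component -/

/-- The truncated linear combination of two vectors. -/
noncomputable def BanachStr.comb (M : BanachStr.{u}) (a b : ℝ) (x y : M.Ball) : M.Ball :=
  M.truncate (a • (x : M.X) + b • (y : M.X))

/-- The formula `D(a x + b y)`. -/
def CFormula.DComb {n : ℕ} (a b : ℝ) (s t : CTerm n) : CFormula n :=
  .D (.sigma ![a, b] ![s, t])

/-- The formula `‖a x + b y‖`. -/
def CFormula.normComb {n : ℕ} (a b : ℝ) (s t : CTerm n) : CFormula n :=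
  .norm ![a, b] ![s, t]

theorem CFormula.eval_DComb {M : BanachStr.{u}} {n : ℕ} (a b : ℝ) (s t : CTerm n)
    (v : Fin n → M.Ball) :
    (CFormula.DComb a b s t).eval M v = M.D (M.comb a b (s.eval M v) (t.eval M v)) := by
  simp [CFormula.DComb, CFormula.eval, CTerm.eval, BanachStr.comb, Fin.sum_univ_two]

theorem CFormula.eval_normComb {M : BanachStr.{u}} {n : ℕ} (a b : ℝ) (s t : CTerm n)
    (v : Fin n → M.Ball) :
    (CFormula.normComb a b s t).eval M v =
      ‖a • (s.eval M v : M.X) + b • (t.eval M v : M.X)‖ := by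
  simp [CFormula.normComb, CFormula.eval, Fin.sum_univ_two]

theorem BanachStr.comb_coe {M : BanachStr.{u}} {a b : ℝ} (h : |a| + |b| ≤ 1) (x y : M.Ball) :
    (M.comb a b x y : M.X) = a • (x : M.X) + b • (y : M.X) := by
  refine M.truncate_of_norm_le ((norm_add_le _ _).trans ?_)
  rw [norm_smul, norm_smul, Real.norm_eq_abs, Real.norm_eq_abs]
  have h1 := mul_le_of_le_one_right (abs_nonneg a) x.norm_le
  have h2 := mul_le_of_le_one_right (abs_nonneg b) y.norm_le
  linarith

/-- On unit vectors of components, this is `1` if the components are the same and `√2` otherwise. -/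
noncomputable def BanachStr.E (M : BanachStr.{u}) (x y : M.Ball) : ℝ :=
  M.D (M.comb (1 / 2) (1 / 2) x y) + ‖(1 / 2 : ℝ) • (x : M.X) + (1 / 2 : ℝ) • (y : M.X)‖

/-- The formula for `BanachStr.E`. -/
noncomputable def CFormula.E {n : ℕ} (s t : CTerm n) : CFormula n :=
  .conn (k := 2) ⟨fun r => r 0 + r 1, by fun_prop⟩
    ![.DComb (1 / 2) (1 / 2) s t, .normComb (1 / 2) (1 / 2) s t]

theorem CFormula.eval_E {M : BanachStr.{u}} {n : ℕ} (s t : CTerm n) (v : Fin n → M.Ball) :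
    (CFormula.E s t).eval M v = M.E (s.eval M v) (t.eval M v) := by
  simp [CFormula.E, CFormula.eval, BanachStr.E, CFormula.eval_DComb, CFormula.eval_normComb]

theorem BanachStr.comb_half_coe {M : BanachStr.{u}} (x y : M.Ball) :
    (M.comb (1 / 2) (1 / 2) x y : M.X) = (1 / 2 : ℝ) • (x : M.X) + (1 / 2 : ℝ) • (y : M.X) :=
  BanachStr.comb_coe (by norm_num [abs_of_pos]) x y

namespace Decomp

variable {M : BanachStr.{u}} [IsHilb M] (d : Decomp M)

theorem D_eq_of_mem {i : d.I} {x : M.Ball} (hx : (x : M.X) ∈ d.V i) : M.D x = 1 - ‖(x : M.X)‖ := by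
  have h1 : d.gauge x = ‖(x : M.X)‖ := by
    refine le_antisymm (d.gauge_le fun j => d.norm_P_le _ _) ?_
    have := d.norm_P_le_gauge x i
    rwa [d.P_eq_self (o := some i) hx] at this
  have h2 := d.D_sq x
  rw [h1] at h2
  have h3 : M.D x ^ 2 = (1 - ‖(x : M.X)‖) ^ 2 := by rw [h2]; ring
  exact (sq_eq_sq₀ (M.nonneg x) (by linarith [x.norm_le])).1 h3

theorem E_of_mem {i : d.I} {x y : M.Ball} (hx : (x : M.X) ∈ d.V i) (hy : (y : M.X) ∈ d.V i) :
    M.E x y = 1 := by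
  have := d.D_eq_of_mem (x := M.comb (1 / 2) (1 / 2) x y) (i := i) (by
    rw [BanachStr.comb_half_coe]
    exact (d.V i).add_mem ((d.V i).smul_mem _ hx) ((d.V i).smul_mem _ hy))
  rw [BanachStr.comb_half_coe] at this
  rw [BanachStr.E, this]
  ring

/-- The midpoint of orthogonal unit vectors has squared norm `1 / 2`, and its largest projection has
norm `1 / 2`. By `D_sq` its value of `D` is `√(1 / 2)` as well. -/
theorem E_of_ne {i j : d.I} (hij : i ≠ j) {x y : M.Ball} (hx : (x : M.X) ∈ d.V i)
    (hy : (y : M.X) ∈ d.V j) (hx1 : ‖(x : M.X)‖ = 1) (hy1 : ‖(y : M.X)‖ = 1) : M.E x y = √2 := by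
  have hij' : some i ≠ some j := fun h => hij (Option.some_injective _ h)
  set z := M.comb (1 / 2) (1 / 2) x y with hz
  have hzc : (z : M.X) = (1 / 2 : ℝ) • (x : M.X) + (1 / 2 : ℝ) • (y : M.X) :=
    BanachStr.comb_half_coe x y
  have hxy : ⟪(x : M.X), y⟫ = 0 := d.inner_eq_zero hij' hx hy
  have hn : ‖(z : M.X)‖ ^ 2 = 1 / 2 := by
    rw [hzc, norm_add_sq_real, norm_smul, norm_smul, real_inner_smul_left, real_inner_smul_right,
      hxy, hx1, hy1]
    norm_num
  have hP : ∀ o, d.P o z = (1 / 2 : ℝ) • d.P o x + (1 / 2 : ℝ) • d.P o y := fun o => by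
    rw [hzc, map_add, map_smul, map_smul]
  have hg : d.gauge z = 1 / 2 := by
    apply le_antisymm
    · refine d.gauge_le fun k => ?_
      rw [hP]
      by_cases hk : k = j
      · subst hk
        rw [d.P_eq_zero hij'.symm hx, smul_zero, zero_add, norm_smul,
          d.P_eq_self (o := some k) hy, hy1]
        norm_num
      · rw [d.P_eq_zero (o' := some j) (fun h => hk (Option.some_injective _ h)) hy, smul_zero,
          add_zero, norm_smul]
        have := d.norm_P_le (some k) (x : M.X)
        rw [hx1] at this
        norm_num
        linarith
    · have := d.norm_P_le_gauge z i
      rw [hP, d.P_eq_self (o := some i) hx, d.P_eq_zero hij' hy, smul_zero, add_zero, norm_smul,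
        hx1] at this
      norm_num at this
      linarith
  have hD := d.D_sq z
  rw [hn, hg] at hD
  have h1 : M.D z = √(1 / 2) := by
    rw [eq_comm, Real.sqrt_eq_iff_eq_sq (by norm_num) (M.nonneg z), hD]; norm_num
  have h2 : ‖(z : M.X)‖ = √(1 / 2) := by
    rw [eq_comm, Real.sqrt_eq_iff_eq_sq (by norm_num) (norm_nonneg _), hn]
  rw [BanachStr.E, ← hz, ← hzc, h1, h2]
  have h3 : √2 = 2 * √(1 / 2) := by
    rw [Real.sqrt_eq_iff_eq_sq (by norm_num) (by positivity), mul_pow, Real.sq_sqrt (by norm_num)]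
    norm_num
  rw [h3]; ring

end Decomp

/-! ### Matching tuples -/

section Match

variable {H : Type u} [NormedAddCommGroup H] [InnerProductSpace ℝ H] [CompleteSpace H]
  {K : Type v} [NormedAddCommGroup K] [InnerProductSpace ℝ K] [CompleteSpace K]
  {L : Type w} [NormedAddCommGroup L] [InnerProductSpace ℝ L] [CompleteSpace L]
  {d : Comps H} {e : Comps K} {f : Comps L} {ι : Type*}

/-- The relation `R` matches the components in which the families `v` and `w` live, and the
projections of the families to matched components are isometric. -/
structure MatchVia (d : Comps H) (e : Comps K) (R : Option d.I → Option e.I → Prop) (v : ι → H)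
    (w : ι → K) : Prop where
  none : R none none
  right : ∀ {o o' o''}, R o o' → R o o'' → o' = o''
  left : ∀ {o o' o''}, R o o'' → R o' o'' → o = o'
  unmatched : ∀ o, (∀ o', ¬ R o o') → ∀ k, d.P o (v k) = 0
  unmatched' : ∀ o', (∀ o, ¬ R o o') → ∀ k, e.P o' (w k) = 0
  gram : ∀ {o o'}, R o o' → ∀ k l, ⟪d.P o (v k), d.P o (v l)⟫ = ⟪e.P o' (w k), e.P o' (w l)⟫

/-- The families `v` and `w` match: there is a partial bijection between the components such that
the projections of the families to corresponding components are isometric. -/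
def Match (d : Comps H) (e : Comps K) (v : ι → H) (w : ι → K) : Prop :=
  ∃ R : Option d.I → Option e.I → Prop, MatchVia d e R v w

namespace MatchVia

variable {R : Option d.I → Option e.I → Prop} {v : ι → H} {w : ι → K}

theorem symm (h : MatchVia d e R v w) : MatchVia e d (fun o o' => R o' o) w v where
  none := h.none
  right h1 h2 := h.left h1 h2
  left h1 h2 := h.right h1 h2
  unmatched := h.unmatched'
  unmatched' := h.unmatched
  gram h1 k l := (h.gram h1 k l).symm

theorem eq_some (h : MatchVia d e R v w) {i : d.I} {o' : Option e.I} (hR : R (some i) o') :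
    ∃ j, o' = some j := by
  cases o' with
  | none => exact absurd (h.left hR h.none) (Option.some_ne_none i)
  | some j => exact ⟨j, rfl⟩

/-- `R` is a bijection between the matched indices, and the others contribute nothing, so sums over
all components can be compared termwise. -/
theorem hasSum_iff (h : MatchVia d e R v w) {p : Option d.I → ℝ} {q : Option e.I → ℝ}
    (hpq : ∀ o o', R o o' → p o = q o') (hp : ∀ o, (∀ o', ¬ R o o') → p o = 0)
    (hq : ∀ o', (∀ o, ¬ R o o') → q o' = 0) {a : ℝ} : HasSum p a ↔ HasSum q a := by
  have hex : ∀ o' : Function.support q, ∃ o, R o o' := fun o' => by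
    by_contra! hc
    exact o'.2 (hq _ hc)
  choose g hg using hex
  refine hasSum_iff_hasSum_of_ne_zero_bij g ?_ ?_ fun o' => hpq _ _ (hg o')
  · intro o1 o2 h12
    have := hg o1
    rw [h12] at this
    exact Subtype.ext (h.right this (hg o2))
  · intro o ho
    obtain ⟨o', ho'⟩ : ∃ o', R o o' := by
      by_contra! hc
      exact ho (hp o hc)
    have hs : o' ∈ Function.support q := by
      rw [Function.mem_support, ← hpq o o' ho']
      exact ho
    exact ⟨⟨o', hs⟩, h.left (hg ⟨o', hs⟩) ho'⟩

theorem inner_eq (h : MatchVia d e R v w) (k l : ι) : ⟪v k, v l⟫ = ⟪w k, w l⟫ := by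
  have h1 := d.hasSum_inner (v k) (v l)
  rw [h.hasSum_iff (q := fun o => ⟪e.P o (w k), e.P o (w l)⟫) (fun o o' hR => h.gram hR k l)
    (fun o ho => by rw [h.unmatched o ho k, inner_zero_left])
    (fun o ho => by rw [h.unmatched' o ho k, inner_zero_left])] at h1
  exact h1.unique (e.hasSum_inner (w k) (w l))

theorem norm_P_sum_eq [Fintype ι] (h : MatchVia d e R v w) (c : ι → ℝ) {o : Option d.I}
    {o' : Option e.I} (hR : R o o') :
    ‖d.P o (∑ k, c k • v k)‖ = ‖e.P o' (∑ k, c k • w k)‖ := by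
  refine (sq_eq_sq₀ (norm_nonneg _) (norm_nonneg _)).1 ?_
  rw [← real_inner_self_eq_norm_sq, ← real_inner_self_eq_norm_sq]
  simp only [map_sum, map_smul, sum_inner, inner_sum, real_inner_smul_left, real_inner_smul_right,
    h.gram hR]

theorem norm_sum_eq [Fintype ι] (h : MatchVia d e R v w) (c : ι → ℝ) :
    ‖∑ k, c k • v k‖ = ‖∑ k, c k • w k‖ := by
  refine (sq_eq_sq₀ (norm_nonneg _) (norm_nonneg _)).1 ?_
  rw [← real_inner_self_eq_norm_sq, ← real_inner_self_eq_norm_sq]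
  simp only [sum_inner, inner_sum, real_inner_smul_left, real_inner_smul_right, h.inner_eq]

theorem P_sum_eq_zero [Fintype ι] (h : MatchVia d e R v w) (c : ι → ℝ) {o : Option d.I}
    (ho : ∀ o', ¬ R o o') : d.P o (∑ k, c k • v k) = 0 := by
  rw [map_sum]
  exact Finset.sum_eq_zero fun k _ => by rw [map_smul, h.unmatched o ho, smul_zero]

/-- Extension of a matching to one more vector all of whose nonzero projections are to components
that are already matched, when there are suitable vectors in a closed subspace. -/
theorem exists_mem_extend (h : MatchVia d e R v w) (x : H)
    (hx : ∀ o, (∀ o', ¬ R o o') → d.P o x = 0) (S : Submodule ℝ K) (hS : IsClosed (S : Set K))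
    (hex : ∀ o o', R o o' → ∃ y ∈ e.W o', y ∈ S ∧ ‖y‖ = ‖d.P o x‖ ∧
      ∀ k, ⟪y, e.P o' (w k)⟫ = ⟪d.P o x, d.P o (v k)⟫) :
    ∃ y ∈ S, ∀ (n : ℕ) (a : Fin n → ι),
      MatchVia d e R (Fin.cons x (v ∘ a) : Fin (n + 1) → H)
        (Fin.cons y (w ∘ a) : Fin (n + 1) → K) := by
  classical
  have hex : ∀ o', ∃ y ∈ e.W o', y ∈ S ∧ (∀ o, R o o' → ‖y‖ = ‖d.P o x‖ ∧
      ∀ k, ⟪y, e.P o' (w k)⟫ = ⟪d.P o x, d.P o (v k)⟫) ∧ ((∀ o, ¬ R o o') → y = 0) := by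
    intro o'
    by_cases ho : ∃ o, R o o'
    · obtain ⟨o, ho⟩ := ho
      obtain ⟨y, hy, hyS, hy1, hy2⟩ := hex o o' ho
      refine ⟨y, hy, hyS, fun o1 ho1 => ?_, fun hc => absurd ho (hc o)⟩
      rw [h.left ho1 ho]
      exact ⟨hy1, hy2⟩
    · exact ⟨0, Submodule.zero_mem _, Submodule.zero_mem _, fun o h1 => absurd ⟨o, h1⟩ ho,
        fun _ => rfl⟩
  choose y hyW hyS hyR hy0 using hex
  -- The chosen vectors have the norms of the projections of `x`, so they are square summable and
  -- are the projections of a single vector.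
  have hs : HasSum (fun o' => ‖y o'‖ ^ 2) (‖x‖ ^ 2) := by
    rw [← h.hasSum_iff (p := fun o => ‖d.P o x‖ ^ 2) (fun o o' hR => by rw [(hyR o' o hR).1])
      (fun o ho => by rw [hx o ho, norm_zero, zero_pow two_ne_zero])
      (fun o ho => by rw [hy0 o ho, norm_zero, zero_pow two_ne_zero])]
    exact d.hasSum_norm_sq x
  obtain ⟨z, hz⟩ := e.exists_of_components hyW hs.summable
  refine ⟨z, ?_, fun n a => ⟨h.none, h.right, h.left, fun o ho k => ?_, fun o ho k => ?_,
    fun {o o'} hR k l => ?_⟩⟩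
  · have hzy := e.hasSum_P z
    simp only [hz] at hzy
    exact hS.mem_of_tendsto hzy (Eventually.of_forall fun s => S.sum_mem fun o _ => hyS o)
  · cases k using Fin.cases with
    | zero => exact hx o ho
    | succ k => exact h.unmatched o ho (a k)
  · cases k using Fin.cases with
    | zero => simpa [hz] using hy0 o ho
    | succ k => exact h.unmatched' o ho (a k)
  · cases k using Fin.cases with
    | zero =>
      cases l using Fin.cases with
      | zero =>
        simp only [Fin.cons_zero, hz, real_inner_self_eq_norm_sq, (hyR o' o hR).1]
      | succ l =>
        simpa only [Fin.cons_zero, Fin.cons_succ, hz, Function.comp_apply] using ((hyR o' o hR).2 (a l)).symm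
    | succ k =>
      cases l using Fin.cases with
      | zero =>
        rw [real_inner_comm, real_inner_comm (e.P o' _)]
        simpa only [Fin.cons_zero, Fin.cons_succ, hz, Function.comp_apply] using ((hyR o' o hR).2 (a k)).symm
      | succ l => exact h.gram hR (a k) (a l)

theorem exists_extend {n : ℕ} {v : Fin n → H} {w : Fin n → K} (h : MatchVia d e R v w)
    (he : ¬ FiniteDimensional ℝ (e.W Option.none)) (x : H)
    (hx : ∀ o, (∀ o', ¬ R o o') → d.P o x = 0) :
    ∃ y, MatchVia d e R (Fin.cons x v : Fin (n + 1) → H) (Fin.cons y w : Fin (n + 1) → K) := by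
  have hinf : ∀ o', ¬ FiniteDimensional ℝ (e.W o') := by
    rintro (_ | j)
    · exact he
    · exact e.infd j
  obtain ⟨y, -, hy⟩ := h.exists_mem_extend x hx ⊤ isClosed_univ fun o o' ho => by
    obtain ⟨y, hy, hy1, hy2⟩ := exists_inner_eq (e.W o') (hinf o') (fun k => d.P o (v k))
      (fun k => e.P o' (w k)) (fun k => e.P_mem _ _) (fun k l => h.gram ho k l) (d.P o x)
    exact ⟨y, hy, trivial, hy1, hy2⟩
  exact ⟨y, hy n id⟩

end MatchVia

/-- Room for extensions of matchings. -/
structure Comps.Rich (d : Comps H) : Prop where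
  infinite_none : ¬ FiniteDimensional ℝ (d.W none)
  uncountable : Uncountable d.I

theorem Match.symm {v : ι → H} {w : ι → K} (h : Match d e v w) : Match e d w v :=
  let ⟨_, hR⟩ := h
  ⟨_, hR.symm⟩

theorem Match.trans {v : ι → H} {w : ι → K} {x : ι → L} (h : Match d e v w) (h' : Match e f w x) :
    Match d f v x := by
  obtain ⟨R, hR⟩ := h
  obtain ⟨S, hS⟩ := h'
  refine ⟨fun o o'' => ∃ o', R o o' ∧ S o' o'', ⟨_, hR.none, hS.none⟩, ?_, ?_, ?_, ?_, ?_⟩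
  · rintro o o' o'' ⟨p, h1, h2⟩ ⟨p', h1', h2'⟩
    rw [hR.right h1' h1] at h2'
    exact hS.right h2 h2'
  · rintro o o' o'' ⟨p, h1, h2⟩ ⟨p', h1', h2'⟩
    rw [hS.left h2' h2] at h1'
    exact hR.left h1 h1'
  · intro o ho k
    -- If `o` has a partner under `R` that is lost under `S`, then the family in the middle has zero
    -- projection there, and equality of Gram matrices carries this back to `v`.
    by_cases h1 : ∃ o', R o o'
    · obtain ⟨o', h1⟩ := h1
      have h2 := hS.unmatched o' (fun o'' h2 => ho o'' ⟨o', h1, h2⟩) k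
      have h3 := hR.gram h1 k k
      rwa [h2, inner_zero_left, inner_self_eq_zero] at h3
    · exact hR.unmatched o (not_exists.1 h1) k
  · intro o ho k
    by_cases h1 : ∃ o', S o' o
    · obtain ⟨o', h1⟩ := h1
      have h2 := hR.unmatched' o' (fun o'' h2 => ho o'' ⟨o', h2, h1⟩) k
      have h3 := hS.gram h1 k k
      rwa [h2, inner_zero_left, eq_comm, inner_self_eq_zero] at h3
    · exact hS.unmatched' o (not_exists.1 h1) k
  · rintro o o'' ⟨o', h1, h2⟩ k l
    rw [hR.gram h1, hS.gram h2]

theorem exists_injective_of_countable {α β : Type*} {s : Set α} (hs : s.Countable) {t : Set β}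
    (ht : ¬ t.Countable) : ∃ g : s → β, Function.Injective g ∧ ∀ x, g x ∈ t := by
  have : Infinite t := (Set.infinite_coe_iff).2 fun h => ht h.countable
  have : Countable s := hs
  obtain ⟨n, hn⟩ := exists_injective_nat s
  exact ⟨fun x => Infinite.natEmbedding t (n x), fun x y hxy =>
    hn ((Infinite.natEmbedding t).injective (Subtype.ext hxy)), fun x => Subtype.coe_prop _⟩

/-- One step of back-and-forth. The matching is first cut down to the complement and the countably
many components that `v` meets. This leaves uncountably many components of `e` free to serve as
partners for the further components met by `x`. -/
theorem Match.exists_cons {n : ℕ} {v : Fin n → H} {w : Fin n → K} (h : Match d e v w) (he : e.Rich)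
    (x : H) :
    ∃ y, Match d e (Fin.cons x v : Fin (n + 1) → H) (Fin.cons y w : Fin (n + 1) → K) := by
  obtain ⟨R, hR⟩ := h
  let R1 : Option d.I → Option e.I → Prop := fun o o' => R o o' ∧ (o = none ∨ ∃ k, d.P o (v k) ≠ 0)
  have hS : {o | ∃ o', R1 o o'}.Countable := by
    refine ((Set.countable_singleton none).union
      (Set.countable_iUnion fun k => d.countable_support (v k))).mono ?_
    rintro o ⟨o', -, rfl | ⟨k, hk⟩⟩
    · exact Or.inl rfl
    · exact Or.inr (Set.mem_iUnion.2 ⟨k, hk⟩)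
  have hT : {i : d.I | d.P (some i) x ≠ 0 ∧ ∀ o', ¬ R1 (some i) o'}.Countable := by
    refine ((d.countable_support x).preimage (Option.some_injective _)).mono fun i hi => hi.1
  have hQ : ¬ {j : e.I | ∀ o, ¬ R1 o (some j)}.Countable := by
    intro hc
    have h1 : {j : e.I | ∃ o, R1 o (some j)}.Countable := by
      have : {o' | ∃ o, R1 o o'}.Countable := by
        have := Set.Countable.to_subtype hS
        choose g hg using fun o : {o | ∃ o', R1 o o'} => o.2
        refine (Set.countable_range g).mono ?_
        rintro o' ⟨o, ho⟩
        exact ⟨⟨o, o', ho⟩, hR.right (hg ⟨o, o', ho⟩).1 ho.1⟩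
      exact this.preimage (Option.some_injective _)
    have h2 := hc.union h1
    have := he.uncountable
    refine Set.not_countable_univ (h2.mono fun j _ => ?_)
    by_cases hj : ∃ o, R1 o (some j)
    · exact Or.inr hj
    · exact Or.inl (not_exists.1 hj)
  obtain ⟨g, hg, hgQ⟩ := exists_injective_of_countable hT hQ
  have h1v : ∀ o, (∀ o', ¬ R1 o o') → ∀ k, d.P o (v k) = 0 := by
    intro o ho k
    by_contra hk
    have : ∃ o', R o o' := by
      by_contra hc
      exact hk (hR.unmatched o (not_exists.1 hc) k)
    obtain ⟨o', ho'⟩ := this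
    exact ho o' ⟨ho', Or.inr ⟨k, hk⟩⟩
  have h1w : ∀ o', (∀ o, ¬ R1 o o') → ∀ k, e.P o' (w k) = 0 := by
    intro o' ho k
    by_contra hk
    have : ∃ o, R o o' := by
      by_contra hc
      exact hk (hR.unmatched' o' (not_exists.1 hc) k)
    obtain ⟨o, ho'⟩ := this
    refine ho o ⟨ho', Or.inr ⟨k, fun h0 => hk ?_⟩⟩
    have := hR.gram ho' k k
    rwa [h0, inner_zero_left, eq_comm, inner_self_eq_zero] at this
  have h2 : MatchVia d e (fun o o' => R1 o o' ∨ ∃ t, o = some t.1 ∧ o' = some (g t)) v w := by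
    refine ⟨Or.inl ⟨hR.none, Or.inl rfl⟩, ?_, ?_, ?_, ?_, ?_⟩
    · rintro o o' o'' (h1 | ⟨t, rfl, rfl⟩) (h1' | ⟨t', h2, rfl⟩)
      · exact hR.right h1.1 h1'.1
      · subst h2; exact absurd h1 (t'.2.2 _)
      · exact absurd h1' (t.2.2 _)
      · rw [Subtype.ext (Option.some_injective _ h2)]
    · rintro o o' o'' (h1 | ⟨t, rfl, rfl⟩) (h1' | ⟨t', rfl, h2⟩)
      · exact hR.left h1.1 h1'.1
      · subst h2; exact absurd h1 (hgQ t' _)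
      · exact absurd h1' (hgQ t _)
      · rw [hg (Option.some_injective _ h2)]
    · exact fun o ho => h1v o fun o' h1 => ho o' (Or.inl h1)
    · exact fun o ho => h1w o fun o' h1 => ho o' (Or.inl h1)
    · rintro o o' (h1 | ⟨t, rfl, rfl⟩) k l
      · exact hR.gram h1.1 k l
      · rw [h1v _ t.2.2, h1w _ (hgQ t), inner_zero_left, inner_zero_left]
  obtain ⟨y, hy⟩ := h2.exists_extend he.infinite_none x fun o ho => by
    by_contra hx
    cases o with
    | none => exact ho none (Or.inl ⟨hR.none, Or.inl rfl⟩)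
    | some i =>
      have hi : i ∈ {i : d.I | d.P (some i) x ≠ 0 ∧ ∀ o', ¬ R1 (some i) o'} :=
        ⟨hx, fun o' h1 => ho o' (Or.inl h1)⟩
      exact ho _ (Or.inr ⟨⟨i, hi⟩, rfl, rfl⟩)
  exact ⟨y, _, hy⟩

/-- Adding vectors of components that are generic for the given families. -/
theorem Match.cons_generic {n : ℕ} {v : Fin n → H} {w : Fin n → K} (h : Match d e v w) {i : d.I}
    {j : e.I} {x : H} {y : K} (hx : x ∈ d.V i) (hy : y ∈ e.V j) (hxy : ‖x‖ = ‖y‖)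
    (hv : ∀ k, d.P (some i) (v k) = 0) (hw : ∀ k, e.P (some j) (w k) = 0) :
    Match d e (Fin.cons x v : Fin (n + 1) → H) (Fin.cons y w : Fin (n + 1) → K) := by
  obtain ⟨R, hR⟩ := h
  -- The matching is changed only by pairing `i` with `j`. Former partners of `i` and `j` may become
  -- unmatched, which is harmless: both families have zero projection there, by hypothesis and
  -- equality of Gram matrices.
  refine ⟨fun o o' => (R o o' ∧ o ≠ some i ∧ o' ≠ some j) ∨ (o = some i ∧ o' = some j),
    Or.inl ⟨hR.none, by simp, by simp⟩, ?_, ?_, ?_, ?_, ?_⟩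
  · rintro o o' o'' (⟨h1, h2, h3⟩ | ⟨rfl, rfl⟩) (⟨h1', h2', h3'⟩ | ⟨h2', rfl⟩)
    · exact hR.right h1 h1'
    · exact absurd h2' h2
    · exact absurd rfl h2'
    · rfl
  · rintro o o' o'' (⟨h1, h2, h3⟩ | ⟨rfl, rfl⟩) (⟨h1', h2', h3'⟩ | ⟨rfl, h3'⟩)
    · exact hR.left h1 h1'
    · exact absurd h3' h3
    · exact absurd rfl h3'
    · rfl
  · intro o ho k
    have hoi : o ≠ some i := fun hoi => ho _ (Or.inr ⟨hoi, rfl⟩)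
    cases k using Fin.cases with
    | zero => exact d.P_eq_zero (o' := some i) hoi hx
    | succ k =>
      by_cases h1 : ∃ o', R o o'
      · obtain ⟨o', h1⟩ := h1
        have hoj : o' = some j := by
          by_contra hoj
          exact ho o' (Or.inl ⟨h1, hoi, hoj⟩)
        have h2 := hR.gram h1 k k
        rwa [hoj, hw, inner_zero_left, inner_self_eq_zero] at h2
      · exact hR.unmatched o (not_exists.1 h1) k
  · intro o' ho k
    have hoi : o' ≠ some j := fun hoi => ho _ (Or.inr ⟨rfl, hoi⟩)
    cases k using Fin.cases with
    | zero => exact e.P_eq_zero (o' := some j) hoi hy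
    | succ k =>
      by_cases h1 : ∃ o, R o o'
      · obtain ⟨o, h1⟩ := h1
        have hoj : o = some i := by
          by_contra hoj
          exact ho o (Or.inl ⟨h1, hoj, hoi⟩)
        have h2 := hR.gram h1 k k
        rwa [hoj, hv, inner_zero_left, eq_comm, inner_self_eq_zero] at h2
      · exact hR.unmatched' o' (not_exists.1 h1) k
  · rintro o o' (⟨h1, h2, h3⟩ | ⟨rfl, rfl⟩) k l
    · cases k using Fin.cases with
      | zero =>
        rw [Fin.cons_zero, Fin.cons_zero, d.P_eq_zero (o' := some i) h2 hx,
          e.P_eq_zero (o' := some j) h3 hy, inner_zero_left, inner_zero_left]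
      | succ k =>
        cases l using Fin.cases with
        | zero =>
          rw [Fin.cons_zero, Fin.cons_zero, d.P_eq_zero (o' := some i) h2 hx,
            e.P_eq_zero (o' := some j) h3 hy, inner_zero_right, inner_zero_right]
        | succ l => exact hR.gram h1 k l
    · cases k using Fin.cases with
      | zero =>
        cases l using Fin.cases with
        | zero =>
          rw [Fin.cons_zero, Fin.cons_zero, d.P_eq_self (o := some i) hx,
            e.P_eq_self (o := some j) hy, real_inner_self_eq_norm_sq, real_inner_self_eq_norm_sq,
            hxy]
        | succ l => rw [Fin.cons_succ, Fin.cons_succ, hv, hw, inner_zero_right, inner_zero_right]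
      | succ k => rw [Fin.cons_succ, Fin.cons_succ, hv, hw, inner_zero_left, inner_zero_left]

/-- Families of vectors each of which belongs to a single component. -/
theorem Match.of_mem {v : ι → H} {w : ι → K} {i : ι → d.I} {j : ι → e.I}
    (hv : ∀ k, v k ∈ d.V (i k)) (hw : ∀ k, w k ∈ e.V (j k)) (hij : ∀ k l, i k = i l ↔ j k = j l)
    (hg : ∀ k l, ⟪v k, v l⟫ = ⟪w k, w l⟫) : Match d e v w := by
  refine ⟨fun o o' => (o = none ∧ o' = none) ∨ ∃ k, o = some (i k) ∧ o' = some (j k),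
    Or.inl ⟨rfl, rfl⟩, ?_, ?_, ?_, ?_, ?_⟩
  · rintro o o' o'' (⟨rfl, rfl⟩ | ⟨k, rfl, rfl⟩) (⟨h1, rfl⟩ | ⟨l, h1, rfl⟩)
    · rfl
    · cases h1
    · cases h1
    · rw [(hij k l).1 (Option.some_injective _ h1)]
  · rintro o o' o'' (⟨rfl, rfl⟩ | ⟨k, rfl, rfl⟩) (⟨rfl, h1⟩ | ⟨l, rfl, h1⟩)
    · rfl
    · cases h1
    · cases h1
    · rw [(hij k l).2 (Option.some_injective _ h1)]
  · intro o ho k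
    exact d.P_eq_zero (o' := some (i k)) (fun h => ho _ (Or.inr ⟨k, h, rfl⟩)) (hv k)
  · intro o ho k
    exact e.P_eq_zero (o' := some (j k)) (fun h => ho _ (Or.inr ⟨k, rfl, h⟩)) (hw k)
  · rintro o o' (⟨rfl, rfl⟩ | ⟨m, rfl, rfl⟩) k l
    · rw [d.P_eq_zero (o' := some (i k)) (by simp) (hv k),
        e.P_eq_zero (o' := some (j k)) (by simp) (hw k), inner_zero_left, inner_zero_left]
    · by_cases hk : i m = i k
      · by_cases hl : i m = i l
        · rw [hk, (hij m k).1 hk, d.P_eq_self (o := some (i k)) (hv k),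
            e.P_eq_self (o := some (j k)) (hw k), ← hk, ← (hij m k).1 hk, hl, (hij m l).1 hl,
            d.P_eq_self (o := some (i l)) (hv l), e.P_eq_self (o := some (j l)) (hw l), hg]
        · rw [d.P_eq_zero (o' := some (i l)) (by simpa using hl) (hv l),
            e.P_eq_zero (o' := some (j l)) (by simpa [← hij] using hl) (hw l), inner_zero_right,
            inner_zero_right]
      · rw [d.P_eq_zero (o' := some (i k)) (by simpa using hk) (hv k),
          e.P_eq_zero (o' := some (j k)) (by simpa [← hij] using hk) (hw k), inner_zero_left,
          inner_zero_left]

end Match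

/-! ### Matching tuples of rich structures satisfy the same formulas -/

section Rich

theorem coe_cons {M : BanachStr.{u}} {n : ℕ} (x : M.Ball) (v : Fin n → M.Ball) :
    (fun k => ((Fin.cons x v : Fin (n + 1) → M.Ball) k : M.X)) =
      (Fin.cons (x : M.X) fun k => (v k : M.X) : Fin (n + 1) → M.X) := by
  funext k
  cases k using Fin.cases <;> rfl

variable {M : BanachStr.{u}} {N : BanachStr.{v}} [IsHilb M] [IsHilb N] {d : Decomp M} {e : Decomp N}

theorem Match.gauge_le {n : ℕ} {v : Fin n → M.X} {w : Fin n → N.X}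
    (h : Match d.toComps e.toComps v w) (c : Fin n → ℝ) :
    d.gauge (∑ k, c k • v k) ≤ e.gauge (∑ k, c k • w k) := by
  obtain ⟨R, hR⟩ := h
  refine d.gauge_le fun i => ?_
  by_cases h1 : ∃ o', R (some i) o'
  · obtain ⟨o', h1⟩ := h1
    obtain ⟨j, rfl⟩ := hR.eq_some h1
    rw [hR.norm_P_sum_eq c h1]
    exact e.norm_P_le_gauge _ j
  · rw [hR.P_sum_eq_zero c (not_exists.1 h1), norm_zero]
    exact e.gauge_nonneg _

theorem Match.norm_sum_eq {n : ℕ} {v : Fin n → M.X} {w : Fin n → N.X}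
    (h : Match d.toComps e.toComps v w) (c : Fin n → ℝ) :
    ‖∑ k, c k • v k‖ = ‖∑ k, c k • w k‖ := by
  obtain ⟨R, hR⟩ := h
  exact hR.norm_sum_eq c

theorem Match.D_eq {n : ℕ} {v : Fin n → M.X} {w : Fin n → N.X}
    (h : Match d.toComps e.toComps v w) (c : Fin n → ℝ) {x : M.Ball} {y : N.Ball}
    (hx : (x : M.X) = ∑ k, c k • v k) (hy : (y : N.X) = ∑ k, c k • w k) : M.D x = N.D y := by
  refine (sq_eq_sq₀ (M.nonneg x) (N.nonneg y)).1 ?_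
  rw [d.D_sq, e.D_sq, hx, hy, h.norm_sum_eq c, le_antisymm (h.gauge_le c) (h.symm.gauge_le c)]

/-- A term takes the value of a linear combination whose coefficients depend on the valuation only
through the norms used in truncations. Matching families agree on those norms, so the same
coefficients serve both sides. -/
theorem Match.exists_term_eval_eq {n : ℕ} {v : Fin n → M.Ball} {w : Fin n → N.Ball}
    (h : Match d.toComps e.toComps (fun k => (v k : M.X)) fun k => (w k : N.X)) (t : CTerm n) :
    ∃ c : Fin n → ℝ, (t.eval M v : M.X) = ∑ k, c k • (v k : M.X) ∧
      (t.eval N w : N.X) = ∑ k, c k • (w k : N.X) := by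
  induction t with
  | var i => exact ⟨Pi.single i 1, by simp [CTerm.eval, Pi.single_apply],
      by simp [CTerm.eval, Pi.single_apply]⟩
  | zero => exact ⟨0, by simp [CTerm.eval], by simp [CTerm.eval]⟩
  | @sigma m a t ih =>
    choose c hcM hcN using ih
    have h1 : ∑ i, a i • ((t i).eval M v : M.X) = ∑ k, (∑ i, a i * c i k) • (v k : M.X) := by
      simp only [hcM, Finset.smul_sum, Finset.sum_smul, mul_smul]
      exact Finset.sum_comm
    have h2 : ∑ i, a i • ((t i).eval N w : N.X) = ∑ k, (∑ i, a i * c i k) • (w k : N.X) := by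
      simp only [hcN, Finset.smul_sum, Finset.sum_smul, mul_smul]
      exact Finset.sum_comm
    have h3 := h.norm_sum_eq fun k => ∑ i, a i * c i k
    refine ⟨fun k => (max 1 ‖∑ k, (∑ i, a i * c i k) • (v k : M.X)‖)⁻¹ * ∑ i, a i * c i k, ?_, ?_⟩
    · rw [CTerm.eval, BanachStr.truncate_coe, h1]
      simp only [mul_smul, Finset.smul_sum]
    · rw [CTerm.eval, BanachStr.truncate_coe, h2, h3]
      simp only [mul_smul, Finset.smul_sum]

theorem Match.exists_cons_ball {n : ℕ} {v : Fin n → M.Ball} {w : Fin n → N.Ball}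
    (h : Match d.toComps e.toComps (fun k => (v k : M.X)) fun k => (w k : N.X))
    (he : e.toComps.Rich) (x : M.Ball) :
    ∃ y : N.Ball, Match d.toComps e.toComps
      (fun k => ((Fin.cons x v : Fin (n + 1) → M.Ball) k : M.X))
      fun k => ((Fin.cons y w : Fin (n + 1) → N.Ball) k : N.X) := by
  obtain ⟨y, hy⟩ := h.exists_cons he (x : M.X)
  have hn : ‖y‖ = ‖(x : M.X)‖ := by
    have := hy.norm_sum_eq (Pi.single 0 1)
    simp only [Pi.single_apply, ite_smul, one_smul, zero_smul, Finset.sum_ite_eq',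
      Finset.mem_univ, if_true, Fin.cons_zero] at this
    exact this.symm
  refine ⟨⟨y, mem_closedBall_zero_iff.2 (hn.trans_le x.norm_le)⟩, ?_⟩
  rw [coe_cons, coe_cons]
  exact hy

/-- For quantifiers, back-and-forth shows that the suprema or infima on the two sides are taken over
the same set of reals. -/
theorem CFormula.eval_eq_of_match_of_rich (hd : d.toComps.Rich) (he : e.toComps.Rich) {n : ℕ}
    (φ : CFormula n) {v : Fin n → M.Ball} {w : Fin n → N.Ball}
    (h : Match d.toComps e.toComps (fun k => (v k : M.X)) fun k => (w k : N.X)) :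
    φ.eval M v = φ.eval N w := by
  induction φ with
  | dist s t =>
    obtain ⟨c, hc, hc'⟩ := h.exists_term_eval_eq s
    obtain ⟨b, hb, hb'⟩ := h.exists_term_eval_eq t
    simp only [CFormula.eval, Subtype.dist_eq, dist_eq_norm, hc, hc', hb, hb',
      ← Finset.sum_sub_distrib, ← sub_smul]
    exact h.norm_sum_eq _
  | norm a t =>
    choose c hc hc' using fun i => h.exists_term_eval_eq (t i)
    have h1 : ∑ i, a i • ((t i).eval M v : M.X) = ∑ k, (∑ i, a i * c i k) • (v k : M.X) := by
      simp only [hc, Finset.smul_sum, Finset.sum_smul, mul_smul]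
      exact Finset.sum_comm
    have h2 : ∑ i, a i • ((t i).eval N w : N.X) = ∑ k, (∑ i, a i * c i k) • (w k : N.X) := by
      simp only [hc', Finset.smul_sum, Finset.sum_smul, mul_smul]
      exact Finset.sum_comm
    simp only [CFormula.eval, h1, h2]
    exact h.norm_sum_eq _
  | D t =>
    obtain ⟨c, hc, hc'⟩ := h.exists_term_eval_eq t
    exact h.D_eq c hc hc'
  | conn c φ ih =>
    exact congrArg c (funext fun i => ih i h)
  | sup φ ih =>
    simp only [CFormula.eval]
    refine congrArg sSup (Set.ext fun r => ⟨?_, ?_⟩)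
    · rintro ⟨x, rfl⟩
      obtain ⟨y, hy⟩ := h.exists_cons_ball he x
      exact ⟨y, (ih hy).symm⟩
    · rintro ⟨y, rfl⟩
      obtain ⟨x, hx⟩ := h.symm.exists_cons_ball hd y
      exact ⟨x, ih hx.symm⟩
  | inf φ ih =>
    simp only [CFormula.eval]
    refine congrArg sInf (Set.ext fun r => ⟨?_, ?_⟩)
    · rintro ⟨x, rfl⟩
      obtain ⟨y, hy⟩ := h.exists_cons_ball he x
      exact ⟨y, (ih hy).symm⟩
    · rintro ⟨y, rfl⟩
      obtain ⟨x, hx⟩ := h.symm.exists_cons_ball hd y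
      exact ⟨x, ih hx.symm⟩

end Rich

/-! ### Models of the theory of a structure with components have components -/

/-- A closed cone that contains the sum of any two non-orthogonal elements. -/
structure IsMergingCone {H : Type u} [NormedAddCommGroup H] [InnerProductSpace ℝ H]
    (W : Set H) : Prop where
  smul_mem : ∀ (a : ℝ) {x : H}, x ∈ W → a • x ∈ W
  closed : IsClosed W
  add_mem : ∀ {x y : H}, x ∈ W → y ∈ W → ⟪x, y⟫ ≠ 0 → x + y ∈ W

namespace IsMergingCone

variable {H : Type u} [NormedAddCommGroup H] [InnerProductSpace ℝ H] {W : Set H}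

/-- The largest subspace that contains `z` and is contained in the cone. -/
def sub (hW : IsMergingCone W) (z : H) (hz : z ∈ W) (hz1 : ‖z‖ = 1) : Submodule ℝ H where
  carrier := {x | ∀ a : ℝ, a • z + x ∈ W}
  zero_mem' a := by rw [add_zero]; exact hW.smul_mem a hz
  add_mem' := by
    intro x y hx hy a
    obtain ⟨s, hs⟩ : ∃ s : ℝ, ⟪s • z + x, (a - s) • z + y⟫ ≠ 0 := by
      set B := a + ⟪z, y⟫ - ⟪x, z⟫
      set c := a * ⟪x, z⟫ + ⟪x, y⟫
      -- The inner product is a quadratic polynomial in `s` with leading coefficient `-1`, because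
      -- `‖z‖ = 1`; it is negative at this `s`. Then the merging property applies to two vectors
      -- whose sum is `a • z + (x + y)`.
      refine ⟨|B| + |c| + 1, ne_of_lt ?_⟩
      set s := |B| + |c| + 1 with hs
      have h1 : ⟪s • z + x, (a - s) • z + y⟫ = -s ^ 2 + B * s + c := by
        simp only [inner_add_left, inner_add_right, real_inner_smul_left, real_inner_smul_right,
          real_inner_self_eq_norm_sq, hz1, B, c]
        ring
      rw [h1]
      nlinarith [le_abs_self B, le_abs_self c, abs_nonneg B, abs_nonneg c]
    have h := hW.add_mem (hx s) (hy (a - s)) hs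
    have h2 : s • z + x + ((a - s) • z + y) = a • z + (x + y) := by rw [sub_smul]; abel
    rwa [h2] at h
  smul_mem' := by
    intro b x hx a
    by_cases hb : b = 0
    · rw [hb, zero_smul, add_zero]; exact hW.smul_mem a hz
    · have := hW.smul_mem b (hx (b⁻¹ * a))
      rwa [smul_add, smul_smul, mul_inv_cancel_left₀ hb] at this

variable (hW : IsMergingCone W) {z z' : H} {hz : z ∈ W} {hz1 : ‖z‖ = 1} {hz' : z' ∈ W}
  {hz1' : ‖z'‖ = 1}

theorem mem_sub {x : H} : x ∈ hW.sub z hz hz1 ↔ ∀ a : ℝ, a • z + x ∈ W := Iff.rfl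

theorem self_mem_sub : z ∈ hW.sub z hz hz1 := fun a => by
  have := hW.smul_mem (a + 1) hz
  rwa [add_smul, one_smul] at this

theorem sub_subset {x : H} (hx : x ∈ hW.sub z hz hz1) : x ∈ W := by
  simpa using hx 0

theorem isClosed_sub : IsClosed (hW.sub z hz hz1 : Set H) := by
  have : (hW.sub z hz hz1 : Set H) = ⋂ a : ℝ, (fun x => a • z + x) ⁻¹' W := by
    ext x; simp [mem_sub]
  rw [this]
  exact isClosed_iInter fun a => hW.closed.preimage (by fun_prop)

theorem le_sub {U : Submodule ℝ H} (hU : ∀ x ∈ U, x ∈ W) (hzU : z ∈ U) : U ≤ hW.sub z hz hz1 :=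
  fun _ hx a => hU _ (U.add_mem (U.smul_mem a hzU) hx)

/-- If `x + y` were outside the closed cone, so would be `(x + t • p) + (y + t • q)` for small `t`.
The two summands would then be orthogonal for all these `t`, and the coefficient of `t ^ 2` in their
inner product, which is `⟪p, q⟫`, would vanish. -/
theorem sup_subset (hW : IsMergingCone W) {U U' : Submodule ℝ H} (hU : ∀ x ∈ U, x ∈ W) (hU' : ∀ x ∈ U', x ∈ W) {p q : H}
    (hp : p ∈ U) (hq : q ∈ U') (hpq : ⟪p, q⟫ ≠ 0) : ∀ x ∈ U ⊔ U', x ∈ W := by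
  intro w hw
  obtain ⟨x, hx, y, hy, rfl⟩ := Submodule.mem_sup.1 hw
  by_contra hn
  have hopen : ∀ᶠ t : ℝ in 𝓝 0, (x + t • p) + (y + t • q) ∉ W := by
    have hc : Continuous fun t : ℝ => (x + t • p) + (y + t • q) := by fun_prop
    exact hc.continuousAt.eventually_mem (hW.closed.isOpen_compl.mem_nhds (by simpa using hn))
  obtain ⟨δ, hδ, h⟩ := Metric.eventually_nhds_iff.1 hopen
  have h0 : ∀ t : ℝ, |t| < δ → ⟪x, y⟫ + t * (⟪x, q⟫ + ⟪p, y⟫) + t ^ 2 * ⟪p, q⟫ = 0 := by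
    intro t ht
    by_contra hne
    refine h (y := t) (by simpa using ht) (hW.add_mem (hU _ (U.add_mem hx (U.smul_mem t hp)))
      (hU' _ (U'.add_mem hy (U'.smul_mem t hq))) ?_)
    intro h1
    apply hne
    rw [← h1]
    simp only [inner_add_left, inner_add_right, real_inner_smul_left, real_inner_smul_right]
    ring
  have h1 := h0 0 (by simpa using hδ)
  have h2 := h0 (δ / 2) (by rw [abs_of_pos (half_pos hδ)]; linarith)
  have h3 := h0 (-(δ / 2)) (by rw [abs_neg, abs_of_pos (half_pos hδ)]; linarith)
  apply hpq
  have h4 : δ ^ 2 * ⟪p, q⟫ = 0 := by linarith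
  exact (mul_eq_zero.1 h4).resolve_left (by positivity)

/-- The sum of the two subspaces lies in the cone, so maximality puts it inside each of them. Hence
these subspaces are pairwise equal or orthogonal. -/
theorem sub_eq_sub {p q : H} (hp : p ∈ hW.sub z hz hz1) (hq : q ∈ hW.sub z' hz' hz1')
    (hpq : ⟪p, q⟫ ≠ 0) : hW.sub z hz hz1 = hW.sub z' hz' hz1' := by
  have h := hW.sup_subset (fun _ => hW.sub_subset) (fun _ => hW.sub_subset) hp hq hpq
  have h1 := hW.le_sub (hz := hz) (hz1 := hz1) h (Submodule.mem_sup_left hW.self_mem_sub)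
  have h2 := hW.le_sub (hz := hz') (hz1 := hz1') h (Submodule.mem_sup_right hW.self_mem_sub)
  exact le_antisymm (le_sup_left.trans h2) (le_sup_right.trans h1)

theorem mem_sub_of_inner_ne_zero {p : H} (hp : p ∈ hW.sub z hz hz1) (h : ⟪z', p⟫ ≠ 0)
    (hz' : z' ∈ W) (hz1' : ‖z'‖ = 1) : z' ∈ hW.sub z hz hz1 := by
  rw [← hW.sub_eq_sub (hz := hz') (hz1 := hz1') hW.self_mem_sub hp h]
  exact hW.self_mem_sub

end IsMergingCone

/-- The hypothesis is the approximate form that a sentence can express. Iterating it with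
geometrically decreasing errors gives a Cauchy sequence whose limit is a true zero of `D`. -/
theorem exists_D_eq_zero_of_approx {N : BanachStr.{v}}
    (h : ∀ (x : N.Ball) (ε : ℝ), 0 < ε → ∃ y, N.D y < ε ∧ dist x y < N.D x + ε)
    (x : N.Ball) (ε : ℝ) (hε : 0 < ε) : ∃ z, N.D z = 0 ∧ dist x z < N.D x + ε := by
  have : CompleteSpace N.Ball := Metric.isClosed_closedBall.completeSpace_coe
  -- The first step moves by less than `N.D x + δ`, and all later steps together by at most `4 * δ`.
  set δ := ε / 5 with hδ
  have hδ0 : 0 < δ := by positivity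
  choose F hF1 hF2 using fun (x : N.Ball) (n : ℕ) => h x (δ / 2 ^ n) (by positivity)
  let y : ℕ → N.Ball := fun n => Nat.rec (F x 0) (fun k z => F z (k + 1)) n
  have hy1 : ∀ n, N.D (y n) < δ / 2 ^ n := fun n => by
    cases n with
    | zero => exact hF1 x 0
    | succ n => exact hF1 (y n) (n + 1)
  have hy2 : ∀ n, dist (y n) (y (n + 1)) ≤ 4 * δ / 2 / 2 ^ n := fun n => by
    refine (hF2 (y n) (n + 1)).le.trans ?_
    have h1 := hy1 n
    have h2 : δ / 2 ^ (n + 1) ≤ δ / 2 ^ n :=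
      div_le_div_of_nonneg_left hδ0.le (by positivity)
        (pow_le_pow_right₀ (by norm_num) (Nat.le_succ n))
    have h3 : 4 * δ / 2 / 2 ^ n = 2 * (δ / 2 ^ n) := by ring
    linarith
  obtain ⟨z, hz⟩ := cauchySeq_tendsto_of_complete (cauchySeq_of_le_geometric_two hy2)
  refine ⟨z, ?_, ?_⟩
  · have h1 := (N.lip.continuous.tendsto z).comp hz
    refine tendsto_nhds_unique h1 (squeeze_zero (fun _ => N.nonneg _) (fun n => (hy1 n).le) ?_)
    have := (tendsto_const_nhds (x := δ)).div_atTop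
      (tendsto_pow_atTop_atTop_of_one_lt (r := (2 : ℝ)) (by norm_num))
    exact this
  · have h1 := dist_le_of_le_geometric_two_of_tendsto₀ hy2 hz
    have h2 : dist x (y 0) < N.D x + δ := by
      have := hF2 x 0
      rwa [pow_zero, div_one] at this
    linarith [dist_triangle x (y 0) z]

/-- The formula for the inner product. -/
noncomputable def CFormula.ip {n : ℕ} (s t : CTerm n) : CFormula n :=
  .conn (k := 2) ⟨fun r => (r 0 * r 0 - r 1 * r 1) / 4, by fun_prop⟩
    ![.normComb 1 1 s t, .normComb 1 (-1) s t]

theorem CFormula.eval_ip {M : BanachStr.{u}} [IsHilb M] {n : ℕ} (s t : CTerm n)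
    (v : Fin n → M.Ball) :
    (CFormula.ip s t).eval M v = ⟪(s.eval M v : M.X), (t.eval M v : M.X)⟫ := by
  have h := re_inner_eq_norm_add_mul_self_sub_norm_sub_mul_self_div_four (𝕜 := ℝ)
    (s.eval M v : M.X) (t.eval M v)
  rw [RCLike.re_to_real] at h
  rw [h]
  simp [CFormula.ip, CFormula.eval, CFormula.eval_normComb, sub_eq_add_neg]

/-- The sum of finitely many formulas. -/
def CFormula.sum {n k : ℕ} (φ : Fin k → CFormula n) : CFormula n :=
  .conn ⟨fun r => ∑ i, r i, by fun_prop⟩ φ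

theorem CFormula.eval_sum {M : BanachStr.{u}} {n k : ℕ} (φ : Fin k → CFormula n)
    (v : Fin n → M.Ball) : (CFormula.sum φ).eval M v = ∑ i, (φ i).eval M v := rfl

theorem isHilb_of_models {M : BanachStr.{u}} {N : BanachStr.{v}} [IsHilb M]
    (h : N.Models M.theory) : IsHilb N := by
  let φ : CFormula 2 := .conn (k := 4)
    ⟨fun r => r 0 * r 0 + r 1 * r 1 - 2 * (r 2 * r 2 + r 3 * r 3), by fun_prop⟩
    ![.normComb 1 1 (.var 0) (.var 1), .normComb 1 (-1) (.var 0) (.var 1),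
      .normComb 1 0 (.var 0) (.var 1), .normComb 0 1 (.var 0) (.var 1)]
  have hφ := eval_eq_zero_of_models h φ fun w => by
    have := parallelogram_law_with_norm_mul ℝ (w 0 : M.X) (w 1)
    simp only [φ, CFormula.eval, ContinuousMap.coe_mk, Matrix.cons_val, CFormula.eval_normComb,
      CTerm.eval, one_smul, zero_smul, add_zero, zero_add, neg_smul, ← sub_eq_add_neg]
    linarith
  refine ⟨⟨fun x y => ?_⟩⟩
  set t := ‖x‖ + ‖y‖ + 1 with ht
  have ht0 : 0 < t := by positivity
  have hx : ‖t⁻¹ • x‖ ≤ 1 := by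
    rw [norm_smul, norm_inv, Real.norm_of_nonneg ht0.le, inv_mul_le_iff₀ ht0]
    linarith [norm_nonneg y]
  have hy : ‖t⁻¹ • y‖ ≤ 1 := by
    rw [norm_smul, norm_inv, Real.norm_of_nonneg ht0.le, inv_mul_le_iff₀ ht0]
    linarith [norm_nonneg x]
  have h1 := hφ ![⟨_, mem_closedBall_zero_iff.2 hx⟩, ⟨_, mem_closedBall_zero_iff.2 hy⟩]
  simp only [φ, CFormula.eval, ContinuousMap.coe_mk, Matrix.cons_val, CFormula.eval_normComb,
      CTerm.eval, one_smul, zero_smul, add_zero, zero_add, neg_smul, ← sub_eq_add_neg, ← smul_add,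
      ← smul_sub, norm_smul, norm_inv, Real.norm_of_nonneg ht0.le] at h1
  field_simp at h1
  linarith

section Models

variable {M : BanachStr.{u}} {N : BanachStr.{v}} [IsHilb M] (d : Decomp M)
  (h : N.Models M.theory)

include d h

/-- The sentences used say that every `x` has `y` with `D y` and `dist x y - D x` arbitrarily small.
Together with the limit argument above, they make `D` the distance to its zero set in every model.
-/
theorem exists_dist_lt_of_models (x : N.Ball) (ε : ℝ) (hε : 0 < ε) :
    ∃ z, N.D z = 0 ∧ dist x z < N.D x + ε := by
  refine exists_D_eq_zero_of_approx (fun x ε hε => ?_) x ε hε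
  let ψ : CFormula 2 := .conn (k := 3) ⟨fun r => max (r 0) (r 2 - r 1), by fun_prop⟩
    ![.D (.var 0), .D (.var 1), .dist (.var 1) (.var 0)]
  have hψM : ∀ (y : M.Ball) (w : Fin 1 → M.Ball), ψ.eval M (Fin.cons y w) =
      max (M.D y) (dist (w 0) y - M.D (w 0)) := fun y w => by
    simp [ψ, CFormula.eval, CTerm.eval]
  have hψN : ∀ (y : N.Ball) (w : Fin 1 → N.Ball), ψ.eval N (Fin.cons y w) =
      max (N.D y) (dist (w 0) y - N.D (w 0)) := fun y w => by
    simp [ψ, CFormula.eval, CTerm.eval]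
  have h1 := eval_eq_zero_of_models h ψ.inf (fun w => by
    refine le_antisymm (le_of_forall_pos_le_add fun δ hδ => ?_) (ψ.le_inf w fun y => ?_)
    · obtain ⟨z, hz, hxz⟩ := d.exists_dist_lt (w 0) δ hδ
      refine (ψ.inf_le_eval w z).trans ?_
      rw [hψM, hz]
      exact max_le (by linarith) (by linarith)
    · rw [hψM]
      exact (M.nonneg y).trans (le_max_left _ _)) fun _ => x
  obtain ⟨y, hy⟩ := ψ.exists_lt_of_inf_lt _ (h1.trans_lt hε)
  rw [hψN, max_lt_iff] at hy
  exact ⟨y, hy.1, by linarith [hy.2]⟩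

theorem norm_eq_one_of_models {z : N.Ball} (hz : N.D z = 0) : ‖(z : N.X)‖ = 1 := by
  let φ : CFormula 1 := .conn (k := 1) ⟨fun r => r 0 - 1, by fun_prop⟩ fun _ =>
    .normComb 1 0 (.var 0) (.var 0)
  have h1 := eval_eq_zero_of_models_of_zeros h d.exists_dist_lt φ (fun w hw => by
    have := d.norm_of_D (w 0) (hw 0)
    simp [φ, CFormula.eval, CFormula.eval_normComb, CTerm.eval, this]) (fun _ => z) fun _ => hz
  simp [φ, CFormula.eval, CFormula.eval_normComb, CTerm.eval] at h1
  linarith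

theorem D_comb_eq_zero_of_models [IsHilb N] {z z' : N.Ball} (hz : N.D z = 0) (hz' : N.D z' = 0)
    (hzz : ⟪(z : N.X), z'⟫ ≠ 0) {a b : ℝ} (hab : 1 < ‖a • (z : N.X) + b • (z' : N.X)‖) :
    N.D (N.comb a b z z') = 0 := by
  -- A product encodes the implication: either the inner product is `0`, or the norm is at most `1`,
  -- or `D` vanishes. A norm above `1` guarantees that truncation yields a unit vector.
  let φ : CFormula 2 := .conn (k := 3) ⟨fun r => r 0 * max (r 1 - 1) 0 * r 2, by fun_prop⟩
    ![.ip (.var 0) (.var 1), .normComb a b (.var 0) (.var 1), .DComb a b (.var 0) (.var 1)]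
  have h1 := eval_eq_zero_of_models_of_zeros h d.exists_dist_lt φ (fun w hw => by
    simp only [φ, CFormula.eval, ContinuousMap.coe_mk, Matrix.cons_val, CFormula.eval_ip,
      CFormula.eval_normComb, CFormula.eval_DComb, CTerm.eval]
    by_cases hi : ⟪(w 0 : M.X), w 1⟫ = 0
    · rw [hi, zero_mul, zero_mul]
    by_cases hn : ‖a • (w 0 : M.X) + b • (w 1 : M.X)‖ ≤ 1
    · rw [max_eq_right (by linarith), mul_zero, zero_mul]
    · have hm := d.mem_comp _ (hw 0)
      have hij := d.eq_of_inner_ne_zero (o := some _) (o' := some _) hm (d.mem_comp _ (hw 1)) hi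
      have hm' : (w 1 : M.X) ∈ d.V (d.comp _ (hw 0)) := by
        rw [Option.some_injective _ hij]; exact d.mem_comp _ (hw 1)
      rw [d.D_of_mem (M.comb a b (w 0) (w 1)) (d.comp _ (hw 0)), mul_zero]
      · exact (d.V _).smul_mem _ ((d.V _).add_mem ((d.V _).smul_mem _ hm) ((d.V _).smul_mem _ hm'))
      · rw [BanachStr.comb, BanachStr.truncate_of_one_le (not_le.1 hn).le, norm_smul, norm_inv,
          norm_norm, inv_mul_cancel₀ (by linarith)]) ![z, z'] (by
    intro i; fin_cases i
    · exact hz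
    · exact hz')
  simp only [φ, CFormula.eval, ContinuousMap.coe_mk, Matrix.cons_val, CFormula.eval_ip,
      CFormula.eval_normComb, CFormula.eval_DComb, CTerm.eval, mul_eq_zero, hzz, false_or] at h1
  refine h1.resolve_left ?_
  rw [max_eq_left (by linarith)]
  linarith

/-- This excludes finite dimensional components in a model: a unit vector `q` that looks like half
of `z 0` to all the `z j` needs a direction outside their span. -/
theorem exists_inner_near_of_models [IsHilb N] {n : ℕ} (z : Fin (n + 1) → N.Ball)
    (hz : ∀ j, N.D (z j) = 0) {ε : ℝ} (hε : 0 < ε) :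
    ∃ q, N.D q = 0 ∧ ∀ j, |⟪(q : N.X), z j⟫ - 1 / 2 * ⟪(z 0 : N.X), z j⟫| < ε := by
  let χ : Fin (n + 1) → CFormula (n + 2) := fun j =>
    .conn (k := 2) ⟨fun r => |r 0 - 1 / 2 * r 1|, by fun_prop⟩
      ![.ip (.var 0) (.var j.succ), .ip (.var (Fin.succ 0)) (.var j.succ)]
  let ψ : CFormula (n + 2) := .sum (k := n + 2) (Fin.cons (.D (.var 0)) χ)
  have hψM : ∀ (y : M.Ball) (w : Fin (n + 1) → M.Ball), ψ.eval M (Fin.cons y w) =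
      M.D y + ∑ j, |⟪(y : M.X), w j⟫ - 1 / 2 * ⟪(w 0 : M.X), w j⟫| := fun y w => by
    simp only [ψ, CFormula.eval_sum, Fin.sum_univ_succ (n := n + 1), χ, Fin.cons_zero,
      Fin.cons_succ, CFormula.eval, CTerm.eval, CFormula.eval_ip, ContinuousMap.coe_mk,
      Matrix.cons_val]
  have hψN : ∀ (y : N.Ball) (w : Fin (n + 1) → N.Ball), ψ.eval N (Fin.cons y w) =
      N.D y + ∑ j, |⟪(y : N.X), w j⟫ - 1 / 2 * ⟪(w 0 : N.X), w j⟫| := fun y w => by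
    simp only [ψ, CFormula.eval_sum, Fin.sum_univ_succ (n := n + 1), χ, Fin.cons_zero,
      Fin.cons_succ, CFormula.eval, CTerm.eval, CFormula.eval_ip, ContinuousMap.coe_mk,
      Matrix.cons_val]
  have h1 := eval_eq_zero_of_models_of_zeros h d.exists_dist_lt ψ.inf (fun w hw => by
    refine le_antisymm ?_ (ψ.le_inf w fun y => ?_)
    · obtain ⟨e, he, he1, hew⟩ := exists_unit_orthogonal (d.V (d.comp _ (hw 0))) (d.infd _)
        fun j => (w j : M.X)
      have hw0 := d.norm_of_D _ (hw 0)
      -- Half of `w 0` is completed to a unit vector by a multiple of `e`, which lies in the same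
      -- component and is orthogonal to every `w j`.
      set q : M.X := (1 / 2 : ℝ) • (w 0 : M.X) + (√3 / 2) • e with hq
      have hqn : ‖q‖ = 1 := by
        have : ‖q‖ ^ 2 = 1 ^ 2 := by
          rw [hq, norm_add_sq_real, real_inner_smul_left, real_inner_smul_right, hew, norm_smul,
            norm_smul, hw0, he1, mul_one, mul_one, mul_zero, mul_zero, mul_zero, add_zero,
            Real.norm_eq_abs, Real.norm_eq_abs, sq_abs, sq_abs, div_pow, div_pow,
            Real.sq_sqrt (by norm_num)]
          norm_num
        exact (sq_eq_sq₀ (norm_nonneg _) zero_le_one).1 this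
      obtain ⟨q', hq'⟩ := BanachStr.coe_eq_of_norm_eq_one hqn
      refine (ψ.inf_le_eval w q').trans_eq ?_
      rw [hψM, d.D_of_mem q' (d.comp _ (hw 0)), zero_add]
      · refine Finset.sum_eq_zero fun j _ => ?_
        rw [hq', hq, inner_add_left, real_inner_smul_left, real_inner_smul_left,
          real_inner_comm _ e, hew j, mul_zero, add_zero, sub_self, abs_zero]
      · rw [hq']
        exact (d.V _).add_mem ((d.V _).smul_mem _ (d.mem_comp _ _)) ((d.V _).smul_mem _ he)
      · rw [hq', hqn]
    · rw [hψM]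
      exact add_nonneg (M.nonneg _) (Finset.sum_nonneg fun _ _ => abs_nonneg _)) z hz
  obtain ⟨y, hy⟩ := ψ.exists_lt_of_inf_lt _ (h1.trans_lt (show 0 < ε / 3 by positivity))
  rw [hψN] at hy
  have hs : 0 ≤ ∑ j, |⟪(y : N.X), z j⟫ - 1 / 2 * ⟪(z 0 : N.X), z j⟫| :=
    Finset.sum_nonneg fun _ _ => abs_nonneg _
  obtain ⟨q, hq, hyq⟩ := exists_dist_lt_of_models d h y (ε / 3) (by positivity)
  refine ⟨q, hq, fun j => ?_⟩
  have h2 := Finset.single_le_sum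
    (f := fun j => |⟪(y : N.X), z j⟫ - 1 / 2 * ⟪(z 0 : N.X), z j⟫|)
    (fun j _ => abs_nonneg _) (Finset.mem_univ j)
  have h3 : |⟪(q : N.X), z j⟫ - ⟪(y : N.X), z j⟫| ≤ dist y q := by
    rw [← inner_sub_left, Subtype.dist_eq, dist_eq_norm, norm_sub_rev]
    refine (abs_real_inner_le_norm _ _).trans ?_
    exact mul_le_of_le_one_right (norm_nonneg _) (z j).norm_le
  have h4 := N.nonneg y
  have h5 := abs_sub_le ⟪(q : N.X), z j⟫ ⟪(y : N.X), z j⟫ (1 / 2 * ⟪(z 0 : N.X), z j⟫)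
  linarith

omit d h in
theorem BanachStr.abs_E_sub_E_le (x y z : N.Ball) : N.E x z ≤ N.E y z + dist x y := by
  have h1 : dist (N.comb (1 / 2) (1 / 2) x z) (N.comb (1 / 2) (1 / 2) y z) = dist x y / 2 := by
    rw [Subtype.dist_eq, Subtype.dist_eq, dist_eq_norm, dist_eq_norm, BanachStr.comb_half_coe,
      BanachStr.comb_half_coe, add_sub_add_right_eq_sub, ← smul_sub, norm_smul]
    norm_num
    ring
  have h2 := N.lip.dist_le_mul (N.comb (1 / 2) (1 / 2) x z) (N.comb (1 / 2) (1 / 2) y z)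
  rw [h1, Real.dist_eq, NNReal.coe_one, one_mul] at h2
  rw [Subtype.dist_eq, dist_eq_norm, BanachStr.comb_half_coe, BanachStr.comb_half_coe] at h1
  have h3 := norm_sub_norm_le ((1 / 2 : ℝ) • (x : N.X) + (1 / 2 : ℝ) • (z : N.X))
    ((1 / 2 : ℝ) • (y : N.X) + (1 / 2 : ℝ) • (z : N.X))
  rw [BanachStr.E, BanachStr.E]
  linarith [le_abs_self (N.D (N.comb (1 / 2) (1 / 2) x z) - N.D (N.comb (1 / 2) (1 / 2) y z))]

/-- This forces infinitely many components in a model. The threshold `7 / 5` is below `√2`, the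
value of `E` for distinct components, and stays above `1` after losing at most `1 / 10` twice. -/
theorem exists_E_gt_of_models {n : ℕ} (z : Fin n → N.Ball) (hz : ∀ j, N.D (z j) = 0) :
    ∃ q, N.D q = 0 ∧ ∀ j, 1 < N.E q (z j) := by
  let χ : Fin n → CFormula (n + 1) := fun j =>
    .conn (k := 1) ⟨fun r => max (7 / 5 - r 0) 0, by fun_prop⟩ fun _ => .E (.var 0) (.var j.succ)
  let ψ : CFormula (n + 1) := .sum (k := n + 1) (Fin.cons (.D (.var 0)) χ)
  have hψM : ∀ (y : M.Ball) (w : Fin n → M.Ball), ψ.eval M (Fin.cons y w) =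
      M.D y + ∑ j, max (7 / 5 - M.E y (w j)) 0 := fun y w => by
    simp only [ψ, CFormula.eval_sum, Fin.sum_univ_succ (n := n), χ, Fin.cons_zero,
      Fin.cons_succ, CFormula.eval, CTerm.eval, CFormula.eval_E, ContinuousMap.coe_mk]
  have hψN : ∀ (y : N.Ball) (w : Fin n → N.Ball), ψ.eval N (Fin.cons y w) =
      N.D y + ∑ j, max (7 / 5 - N.E y (w j)) 0 := fun y w => by
    simp only [ψ, CFormula.eval_sum, Fin.sum_univ_succ (n := n), χ, Fin.cons_zero,
      Fin.cons_succ, CFormula.eval, CTerm.eval, CFormula.eval_E, ContinuousMap.coe_mk]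
  have h1 := eval_eq_zero_of_models_of_zeros h d.exists_dist_lt ψ.inf (fun w hw => by
    refine le_antisymm ?_ (ψ.le_inf w fun y => ?_)
    · classical
      obtain ⟨i, hi⟩ := Infinite.exists_notMem_finset
        (Finset.univ.image fun j => d.comp (w j) (hw j))
      have hi' : ∀ j, i ≠ d.comp (w j) (hw j) := fun j hij =>
        hi (Finset.mem_image.2 ⟨j, Finset.mem_univ j, hij.symm⟩)
      obtain ⟨q, hqi, hq1⟩ := d.exists_unit i
      refine (ψ.inf_le_eval w q).trans_eq ?_
      rw [hψM, d.D_of_mem q i hqi hq1, zero_add]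
      refine Finset.sum_eq_zero fun j _ => max_eq_right ?_
      rw [d.E_of_ne (hi' j) hqi (d.mem_comp _ (hw j)) hq1 (d.norm_of_D _ (hw j))]
      have : (7 / 5 : ℝ) ≤ √2 := Real.le_sqrt_of_sq_le (by norm_num)
      linarith
    · rw [hψM]
      exact add_nonneg (M.nonneg _) (Finset.sum_nonneg fun _ _ => le_max_right _ _)) z hz
  obtain ⟨y, hy⟩ := ψ.exists_lt_of_inf_lt _ (h1.trans_lt (show (0 : ℝ) < 1 / 10 by norm_num))
  rw [hψN] at hy
  have hs : 0 ≤ ∑ j, max (7 / 5 - N.E y (z j)) 0 := Finset.sum_nonneg fun _ _ => le_max_right _ _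
  obtain ⟨q, hq, hyq⟩ := exists_dist_lt_of_models d h y (1 / 10) (by norm_num)
  refine ⟨q, hq, fun j => ?_⟩
  have h2 := Finset.single_le_sum (f := fun j => max (7 / 5 - N.E y (z j)) 0)
    (fun j _ => le_max_right _ _) (Finset.mem_univ j)
  have h3 := le_max_left (7 / 5 - N.E y (z j)) 0
  have h4 := N.nonneg y
  have h5 := N.abs_E_sub_E_le y q (z j)
  linarith

/-- The cone spanned by the zero set of `D`. -/
theorem isMergingCone_of_models [IsHilb N] :
    IsMergingCone {x : N.X | ∃ (t : ℝ) (z : N.Ball), N.D z = 0 ∧ x = t • (z : N.X)} := by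
  have hn1 := fun {z} => norm_eq_one_of_models d h (z := z)
  have hneg : ∀ z : N.Ball, N.D z = 0 → N.D (N.truncate (-(z : N.X))) = 0 := by
    intro z hz
    -- The coefficient `-2` makes the norm exceed `1`, so truncation gives exactly `-z`.
    have h1 := D_comb_eq_zero_of_models d h hz hz (by
      rw [real_inner_self_eq_norm_sq, hn1 hz]; norm_num) (a := -2) (b := 0) (by
      rw [zero_smul, add_zero, norm_smul, hn1 hz]; norm_num)
    have h2 : N.comb (-2) 0 z z = N.truncate (-(z : N.X)) := by
      apply Subtype.ext
      rw [BanachStr.comb, zero_smul, add_zero, BanachStr.truncate_of_one_le,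
        BanachStr.truncate_of_norm_le, norm_smul, hn1 hz, smul_smul]
      · norm_num
      · rw [norm_neg, hn1 hz]
      · rw [norm_smul, hn1 hz]; norm_num
    rwa [h2] at h1
  have hnorm : ∀ x : N.X, x ≠ 0 → (∃ (t : ℝ) (z : N.Ball), N.D z = 0 ∧ x = t • (z : N.X)) →
      N.D (N.truncate (‖x‖⁻¹ • x)) = 0 := by
    rintro x hx ⟨t, z, hz, rfl⟩
    have ht : t ≠ 0 := fun ht => hx (by rw [ht, zero_smul])
    rw [norm_smul, hn1 hz, mul_one, smul_smul, Real.norm_eq_abs]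
    rcases lt_or_gt_of_ne ht with h0 | h0
    · rw [abs_of_neg h0, inv_neg, neg_mul, inv_mul_cancel₀ ht, neg_one_smul]
      exact hneg z hz
    · rw [abs_of_pos h0, inv_mul_cancel₀ ht, one_smul]
      have : N.truncate (z : N.X) = z := Subtype.ext (N.truncate_of_norm_le z.norm_le)
      rwa [this]
  refine ⟨?_, ?_, ?_⟩
  · rintro a x ⟨t, z, hz, rfl⟩
    exact ⟨a * t, z, hz, by rw [mul_smul]⟩
  · refine isClosed_of_closure_subset fun x hx => ?_
    obtain ⟨y, hy, hyx⟩ := mem_closure_iff_seq_limit.1 hx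
    by_cases hx0 : x = 0
    · obtain ⟨t, z, hz, -⟩ := hy 0
      exact ⟨0, z, hz, by rw [zero_smul, hx0]⟩
    · have h1 : Tendsto (fun k => N.D (N.truncate (‖y k‖⁻¹ • y k))) atTop
          (𝓝 (N.D (N.truncate (‖x‖⁻¹ • x)))) := by
        refine ((N.lip.continuous.comp N.lipschitzWith_truncate.continuous).tendsto _).comp ?_
        exact (hyx.norm.inv₀ (norm_ne_zero_iff.2 hx0)).smul hyx
      have h2 : N.D (N.truncate (‖x‖⁻¹ • x)) = 0 := by
        refine tendsto_nhds_unique h1 (tendsto_const_nhds.congr' ?_)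
        filter_upwards [hyx.eventually_ne hx0] with k hk using (hnorm _ hk (hy k)).symm
      refine ⟨‖x‖, _, h2, ?_⟩
      have hn : ‖x‖ ≠ 0 := norm_ne_zero_iff.2 hx0
      rw [BanachStr.truncate_of_norm_le, smul_smul, mul_inv_cancel₀ hn, one_smul]
      rw [norm_smul, norm_inv, norm_norm, inv_mul_cancel₀ hn]
  · rintro _ _ ⟨s, z, hz, rfl⟩ ⟨t, z', hz', rfl⟩ hst
    rw [real_inner_smul_left, real_inner_smul_right] at hst
    have hzz : ⟪(z : N.X), z'⟫ ≠ 0 := fun h0 => hst (by rw [h0, mul_zero, mul_zero])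
    by_cases h0 : s • (z : N.X) + t • (z' : N.X) = 0
    · exact ⟨0, z, hz, by rw [zero_smul, h0]⟩
    · set n := ‖s • (z : N.X) + t • (z' : N.X)‖ with hn
      have hn0 : n ≠ 0 := norm_ne_zero_iff.2 h0
      have hnp : 0 < n := lt_of_le_of_ne (norm_nonneg _) hn0.symm
      -- Rescaling the sum to norm `2` puts it in the range where truncation normalizes.
      have h1 : (2 / n * s) • (z : N.X) + (2 / n * t) • (z' : N.X) =
          (2 / n) • (s • (z : N.X) + t • (z' : N.X)) := by rw [smul_add, smul_smul, smul_smul]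
      have h2 : ‖(2 / n * s) • (z : N.X) + (2 / n * t) • (z' : N.X)‖ = 2 := by
        rw [h1, norm_smul, ← hn, Real.norm_of_nonneg (by positivity), div_mul_cancel₀ _ hn0]
      refine ⟨n, _, D_comb_eq_zero_of_models d h hz hz' hzz (a := 2 / n * s) (b := 2 / n * t)
        (by rw [h2]; norm_num), ?_⟩
      rw [BanachStr.comb, BanachStr.truncate_of_one_le (by rw [h2]; norm_num), h2, h1, smul_smul,
        smul_smul]
      have : n * 2⁻¹ * (2 / n) = 1 := by field_simp
      rw [this, one_smul]

/-- The components of `N` are the maximal subspaces of the cone through the zeros of `D`. The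
merging property makes distinct ones orthogonal; the two approximate sentences give infinite
dimension and infinite number. -/
theorem nonempty_decomp_of_models [IsHilb N] : Nonempty (Decomp N) := by
  have hW := isMergingCone_of_models d h
  set W := {x : N.X | ∃ (t : ℝ) (z : N.Ball), N.D z = 0 ∧ x = t • (z : N.X)} with hWdef
  have hn1 := fun {z} => norm_eq_one_of_models d h (z := z)
  have hZW : ∀ z : N.Ball, N.D z = 0 → (z : N.X) ∈ W := fun z hz => ⟨1, z, hz, (one_smul _ _).symm⟩
  have hD1 : ∀ z : N.Ball, (z : N.X) ∈ W → N.D z ≤ 1 - ‖(z : N.X)‖ := by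
    rintro z ⟨t, y, hy, hzy⟩
    obtain ⟨t', y', hy', hzy', ht'⟩ :
        ∃ (t' : ℝ) (y' : N.Ball), N.D y' = 0 ∧ (z : N.X) = t' • (y' : N.X) ∧ 0 ≤ t' := by
      rcases le_or_gt 0 t with ht | ht
      · exact ⟨t, y, hy, hzy, ht⟩
      · have h1 : N.D (N.comb (-2) 0 y y) = 0 := D_comb_eq_zero_of_models d h hy hy (by
          rw [real_inner_self_eq_norm_sq, hn1 hy]; norm_num) (by
          rw [zero_smul, add_zero, norm_smul, hn1 hy]; norm_num)
        refine ⟨-t, _, h1, ?_, by linarith⟩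
        rw [BanachStr.comb, zero_smul, add_zero, BanachStr.truncate_of_one_le, norm_smul, hn1 hy,
          smul_smul, smul_smul, hzy]
        · congr 1
          norm_num
          ring
        · rw [norm_smul, hn1 hy]; norm_num
    have hzn : ‖(z : N.X)‖ = t' := by
      rw [hzy', norm_smul, hn1 hy', mul_one, Real.norm_of_nonneg ht']
    have h1 := N.lip.dist_le_mul z y'
    have ht1 := z.norm_le
    have h2 : (z : N.X) - y' = (t' - 1) • (y' : N.X) := by rw [hzy', sub_smul, one_smul]
    rw [hzn] at ht1
    rw [hy', Real.dist_eq, sub_zero, NNReal.coe_one, one_mul, Subtype.dist_eq, dist_eq_norm, h2,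
      norm_smul, hn1 hy', mul_one, Real.norm_eq_abs] at h1
    have h3 : |t' - 1| = 1 - t' := by rw [abs_of_nonpos (by linarith)]; ring
    rw [h3] at h1
    rw [hzn]
    linarith [le_abs_self (N.D z)]
  have hWZ : ∀ z : N.Ball, (z : N.X) ∈ W → ‖(z : N.X)‖ = 1 → N.D z = 0 := fun z hz hz1 =>
    le_antisymm ((hD1 z hz).trans (by rw [hz1, sub_self])) (N.nonneg z)
  have hmem : ∀ (z : N.Ball) (hz : N.D z = 0),
      (z : N.X) ∈ hW.sub (z : N.X) (hZW z hz) (hn1 hz) := fun _ _ => hW.self_mem_sub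
  let I := {U : Submodule ℝ N.X // ∃ (z : N.Ball) (hz : N.D z = 0),
    U = hW.sub (z : N.X) (hZW z hz) (hn1 hz)}
  have hinfd : ∀ (z : N.Ball) (hz : N.D z = 0),
      ¬ FiniteDimensional ℝ (hW.sub (z : N.X) (hZW z hz) (hn1 hz)) := by
    intro z hz hfin
    set U := hW.sub (z : N.X) (hZW z hz) (hn1 hz) with hU
    have hzU : (z : N.X) ∈ U := hW.self_mem_sub
    have hz0 : (z : N.X) ≠ 0 := norm_ne_zero_iff.1 (by rw [hn1 hz]; norm_num)
    obtain ⟨n, hn⟩ : ∃ n, Module.finrank ℝ U = n + 1 := by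
      refine Nat.exists_eq_succ_of_ne_zero fun h0 => hz0 ?_
      have := Module.finrank_zero_iff.1 h0
      exact congrArg Subtype.val (Subsingleton.elim (⟨z, hzU⟩ : U) 0)
    let b : OrthonormalBasis (Fin (n + 1)) ℝ U := (stdOrthonormalBasis ℝ U).reindex (finCongr hn)
    have hb1 : ∀ j, ‖(b j : N.X)‖ = 1 := fun j => b.norm_eq_one j
    choose c hc using fun j => BanachStr.coe_eq_of_norm_eq_one (hb1 j)
    have hcD : ∀ j, N.D (c j) = 0 := fun j => hWZ (c j) (by
      rw [hc]; exact hW.sub_subset (b j).2) (by rw [hc, hb1])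
    -- With an orthonormal basis of `U` as test vectors, `q` lies in `U` and is within squared
    -- distance `(n + 1) * ε ^ 2 ≤ 1 / 16` of `(1 / 2) • b 0`. But unit length forces a distance of
    -- at least `1 / 2`.
    set ε : ℝ := 1 / (4 * (n + 1)) with hε
    have hε0 : 0 < ε := by positivity
    obtain ⟨q, hq, hqc⟩ := exists_inner_near_of_models d h c hcD hε0
    have hε1 : ε ≤ 1 / 4 := by
      rw [hε]
      exact one_div_le_one_div_of_le (by norm_num) (by linarith [(Nat.cast_nonneg n : (0:ℝ) ≤ n)])
    have hqU : (q : N.X) ∈ U := by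
      refine hW.mem_sub_of_inner_ne_zero (p := c 0) (by rw [hc]; exact (b 0).2) ?_
        (hZW q hq) (hn1 hq)
      have := hqc 0
      rw [real_inner_self_eq_norm_sq, hc, hb1] at this
      intro h0
      rw [hc] at h0
      rw [h0, abs_lt] at this
      linarith [this.1]
    have hsum := b.sum_sq_norm_inner_right (⟨q, hqU⟩ - (1 / 2 : ℝ) • b 0)
    have hle : ∀ j, ‖⟪b j, (⟨q, hqU⟩ - (1 / 2 : ℝ) • b 0 : U)⟫‖ ^ 2 ≤ ε ^ 2 := by
      intro j
      refine pow_le_pow_left₀ (norm_nonneg _) ?_ 2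
      have h2 : ⟪b j, (⟨q, hqU⟩ - (1 / 2 : ℝ) • b 0 : U)⟫ =
          ⟪(q : N.X), c j⟫ - 1 / 2 * ⟪(c 0 : N.X), c j⟫ := by
        rw [real_inner_comm, inner_sub_left, real_inner_smul_left, hc, hc]
        rfl
      rw [h2]
      exact (hqc j).le
    have h3 : ‖(⟨q, hqU⟩ - (1 / 2 : ℝ) • b 0 : U)‖ ^ 2 ≤ (n + 1) * ε ^ 2 := by
      rw [← hsum]
      refine (Finset.sum_le_sum fun j _ => hle j).trans ?_
      simp
    have h4 : 1 / 2 ≤ ‖(⟨q, hqU⟩ - (1 / 2 : ℝ) • b 0 : U)‖ := by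
      have h5 := norm_sub_norm_le (⟨q, hqU⟩ : U) ((1 / 2 : ℝ) • b 0)
      have h6 : ‖(⟨q, hqU⟩ : U)‖ = 1 := hn1 hq
      rw [norm_smul, b.norm_eq_one, h6] at h5
      norm_num at h5 ⊢
      linarith
    have h5 : (n + 1) * ε ^ 2 ≤ 1 / 16 := by
      have h6 : (n + 1) * ε = 1 / 4 := by rw [hε]; field_simp
      calc (n + 1) * ε ^ 2 = ((n + 1) * ε) * ε := by ring
        _ ≤ 1 / 4 * (1 / 4) := by rw [h6]; linarith
        _ = 1 / 16 := by norm_num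
    nlinarith
  have hinfI : Infinite I := by
    refine not_finite_iff_infinite.1 fun hfin => ?_
    obtain ⟨n, ⟨f⟩⟩ := Finite.exists_equiv_fin I
    choose z hz hzV using fun j => (f.symm j).2
    -- `q` lies in one of the finitely many components, where `D` is at most `1 - ‖·‖`, so `E` of
    -- `q` and its representative is at most `1`.
    obtain ⟨q, hq, hqE⟩ := exists_E_gt_of_models d h z hz
    let i : I := ⟨_, q, hq, rfl⟩
    have hq1 : (q : N.X) ∈ i.1 := hmem q hq
    have h1 := hzV (f i)
    rw [f.symm_apply_apply] at h1
    have hz1 : (z (f i) : N.X) ∈ i.1 := by rw [h1]; exact hW.self_mem_sub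
    have h2 := hD1 (N.comb (1 / 2) (1 / 2) q (z (f i))) (by
      rw [BanachStr.comb_half_coe]
      exact hW.sub_subset (hz := hZW q hq) (hz1 := hn1 hq) (Submodule.add_mem _ (Submodule.smul_mem _ _ hq1)
        (Submodule.smul_mem _ _ hz1)))
    have h3 := hqE (f i)
    rw [BanachStr.E] at h3
    rw [BanachStr.comb_half_coe] at h2
    linarith
  exact ⟨{
    I := I
    V := fun U => U.1
    closed := by rintro ⟨_, z, hz, rfl⟩; exact hW.isClosed_sub (hz := hZW z hz) (hz1 := hn1 hz)
    orth := by
      rintro ⟨_, z, hz, rfl⟩ ⟨_, z', hz', rfl⟩ hne x hx y hy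
      by_contra hxy
      exact hne (Subtype.ext (hW.sub_eq_sub (hz := hZW z hz) (hz1 := hn1 hz) (hz' := hZW z' hz')
        (hz1' := hn1 hz') hx hy hxy))
    infd := by rintro ⟨_, z, hz, rfl⟩; exact hinfd z hz
    infI := hinfI
    D_of_mem := by
      rintro z ⟨_, y, hy, rfl⟩ hzy hz1
      exact hWZ z (hW.sub_subset (hz := hZW y hy) (hz1 := hn1 hy) hzy) hz1
    exists_of_D := fun z hz => ⟨⟨_, z, hz, rfl⟩, hmem z hz, hn1 hz⟩
    exists_dist_lt := exists_dist_lt_of_models d h }⟩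

end Models

/-! ### The sum of countably many copies of `ℓ₂` -/

theorem not_finiteDimensional_ellTwo : ¬ FiniteDimensional ℝ EllTwo := fun _ =>
  have b : HilbertBasis ℕ ℝ EllTwo := .ofRepr (LinearIsometryEquiv.refl ℝ EllTwo)
  have := b.orthonormal.linearIndependent.finite
  not_finite ℕ

/-- The summands of `ℓ₂ ⊕ ℓ₂ ⊕ …`. -/
def ellTwoSummand (n : ℕ) : Submodule ℝ EllTwoSum where
  carrier := {x | ∀ m, m ≠ n → x m = 0}
  zero_mem' _ _ := rfl
  add_mem' hx hy m hm := by rw [lp.coeFn_add, Pi.add_apply, hx m hm, hy m hm, add_zero]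
  smul_mem' c x hx m hm := by rw [lp.coeFn_smul, Pi.smul_apply, hx m hm, smul_zero]

theorem mem_ellTwoSummand {n : ℕ} {x : EllTwoSum} :
    x ∈ ellTwoSummand n ↔ ∀ m, m ≠ n → x m = 0 := Iff.rfl

theorem continuous_apply_ellTwoSum (m : ℕ) : Continuous fun x : EllTwoSum => x m :=
  (lp.evalCLM ℝ (fun _ : ℕ => EllTwo) 2 m).continuous

theorem single_mem_ellTwoSummand (n : ℕ) (s : EllTwo) :
    (lp.single 2 n s : EllTwoSum) ∈ ellTwoSummand n := fun m hm => by
  rw [lp.single_apply, Pi.single_eq_of_ne hm]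

theorem eq_single_of_mem_ellTwoSummand {n : ℕ} {x : EllTwoSum} (h : x ∈ ellTwoSummand n) :
    x = lp.single 2 n (x n) := by
  refine lp.ext (funext fun m => ?_)
  rw [lp.single_apply]
  by_cases hm : m = n
  · subst hm; rw [Pi.single_eq_same]
  · rw [h m hm, Pi.single_eq_of_ne hm]

theorem mem_unionOfSpheres {y : EllTwoSum} :
    y ∈ unionOfSpheres ↔ ‖y‖ = 1 ∧ ∃ n, y ∈ ellTwoSummand n := by
  constructor
  · intro h
    refine ⟨norm_of_mem_unionOfSpheres h, ?_⟩
    obtain ⟨n, s, -, rfl⟩ := h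
    exact ⟨n, single_mem_ellTwoSummand n s⟩
  · rintro ⟨h1, n, hn⟩
    have h2 := eq_single_of_mem_ellTwoSummand hn
    refine ⟨n, y n, ?_, h2⟩
    rw [h2, lp.norm_single (by norm_num)] at h1
    exact h1

/-- For vectors of norm `1`, lying in a single summand means that of any two coordinates one
vanishes, a closed condition. Closedness is needed to identify the zeros of the distance function
`D`. -/
theorem isClosed_unionOfSpheres : IsClosed unionOfSpheres := by
  have h : unionOfSpheres = {y | ‖y‖ = 1} ∩ ⋂ (m : ℕ) (k : ℕ) (_ : m ≠ k),
      ({y : EllTwoSum | y m = 0} ∪ {y : EllTwoSum | y k = 0}) := by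
    ext y
    simp only [Set.mem_inter_iff, Set.mem_ofPred_eq, Set.mem_iInter, Set.mem_union]
    rw [mem_unionOfSpheres]
    refine and_congr_right fun hy => ⟨?_, fun h => ?_⟩
    · rintro ⟨n, hn⟩ m k hmk
      by_cases hm : m = n
      · exact Or.inr (hn k fun hk => hmk (hm.trans hk.symm))
      · exact Or.inl (hn m hm)
    · obtain ⟨n, hn⟩ : ∃ n, y n ≠ 0 := by
        by_contra! hc
        have : y = 0 := lp.ext (funext hc)
        rw [this, norm_zero] at hy
        exact zero_ne_one hy
      exact ⟨n, fun m hm => (h m n hm).resolve_right hn⟩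
  rw [h]
  refine (isClosed_eq continuous_norm continuous_const).inter (isClosed_iInter fun m =>
    isClosed_iInter fun k => isClosed_iInter fun _ => ?_)
  exact (isClosed_eq (continuous_apply_ellTwoSum m) continuous_const).union
    (isClosed_eq (continuous_apply_ellTwoSum k) continuous_const)

/-- The inner product of the structure is recovered from the norm, so orthogonality of the summands
is obtained by polarization from this equality. -/
theorem norm_add_eq_norm_sub_ellTwoSummand {i j : ℕ} (hij : i ≠ j) {x y : EllTwoSum}
    (hx : x ∈ ellTwoSummand i) (hy : y ∈ ellTwoSummand j) : ‖x + y‖ = ‖x - y‖ := by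
  rw [lp.norm_eq_tsum_rpow (by norm_num), lp.norm_eq_tsum_rpow (by norm_num)]
  have h : ∀ m, ‖(x + y) m‖ = ‖(x - y) m‖ := fun m => by
    rw [lp.coeFn_add, lp.coeFn_sub, Pi.add_apply, Pi.sub_apply]
    by_cases hm : m = i
    · rw [hy m (fun h => hij (hm.symm.trans h)), add_zero, sub_zero]
    · rw [hx m hm, zero_add, zero_sub, norm_neg]
  simp only [h]

theorem isClosed_ellTwoSummand (n : ℕ) : IsClosed (ellTwoSummand n : Set EllTwoSum) := by
  have : (ellTwoSummand n : Set EllTwoSum) = ⋂ (m : ℕ) (_ : m ≠ n), {x | x m = 0} := by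
    ext x; simp [mem_ellTwoSummand]
  rw [this]
  exact isClosed_iInter fun m => isClosed_iInter fun _ =>
    isClosed_eq (continuous_apply_ellTwoSum m) continuous_const

theorem not_finiteDimensional_ellTwoSummand (n : ℕ) :
    ¬ FiniteDimensional ℝ (ellTwoSummand n) := fun hn => by
  let f : EllTwo →ₗ[ℝ] ellTwoSummand n :=
    (lp.lsingle 2 n).codRestrict (ellTwoSummand n) (single_mem_ellTwoSummand n)
  refine not_finiteDimensional_ellTwo (FiniteDimensional.of_injective f fun s t hst => ?_)
  have h1 : (lp.single 2 n s : EllTwoSum) = lp.single 2 n t := congrArg Subtype.val hst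
  have h2 := congrArg (fun x : EllTwoSum => x n) h1
  simpa [lp.single_apply] using h2

instance : IsHilb sumOfSpheres := ⟨(inferInstance : InnerProductSpaceable EllTwoSum)⟩

/-- The components of `ℓ₂ ⊕ ℓ₂ ⊕ …`. -/
noncomputable def decompSumOfSpheres : Decomp sumOfSpheres where
  I := ℕ
  V := ellTwoSummand
  closed := isClosed_ellTwoSummand
  orth i j hij x hx y hy := by
    have h := re_inner_eq_norm_add_mul_self_sub_norm_sub_mul_self_div_four (𝕜 := ℝ)
      (E := sumOfSpheres.X) x y
    have h1 : ‖(x + y : sumOfSpheres.X)‖ = ‖x - y‖ := norm_add_eq_norm_sub_ellTwoSummand hij hx hy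
    rw [RCLike.re_to_real, h1, sub_self, zero_div] at h
    exact h
  infd := not_finiteDimensional_ellTwoSummand
  infI := inferInstanceAs (Infinite ℕ)
  D_of_mem z i hz hz1 := Metric.infDist_zero_of_mem (mem_unionOfSpheres.2 ⟨hz1, i, hz⟩)
  exists_of_D z hz := by
    have h := (isClosed_unionOfSpheres.mem_iff_infDist_zero unionOfSpheres_nonempty).2 hz
    obtain ⟨h1, i, hi⟩ := mem_unionOfSpheres.1 h
    exact ⟨i, hi, h1⟩
  exists_dist_lt x ε hε := by
    obtain ⟨y, hy, hxy⟩ := (Metric.infDist_lt_iff unionOfSpheres_nonempty).1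
      (lt_add_of_pos_right (Metric.infDist (Subtype.val x : EllTwoSum) unionOfSpheres) hε)
    exact ⟨⟨y, mem_closedBall_zero_iff.2 (norm_of_mem_unionOfSpheres hy).le⟩,
      Metric.infDist_zero_of_mem hy, hxy⟩

/-! ### Elementary embeddings -/

theorem BanachStr.exists_smul_ball {M : BanachStr.{u}} (x : M.X) :
    ∃ (c : ℝ) (b : M.Ball), 0 < c ∧ x = c • (b : M.X) := by
  have h : 0 < ‖x‖ + 1 := by positivity
  refine ⟨‖x‖ + 1, ⟨(‖x‖ + 1)⁻¹ • x, ?_⟩, h, ?_⟩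
  · rw [mem_closedBall_zero_iff, norm_smul, norm_inv, Real.norm_of_nonneg h.le, inv_mul_le_iff₀ h]
    linarith
  · rw [smul_smul, mul_inv_cancel₀ h.ne', one_smul]

section Elementary

variable {M N : BanachStr.{u}} {f : M.Ball → N.Ball}

theorem IsElementary.models (hf : IsElementary f) : N.Models M.theory := fun φ hφ => by
  have := hf 0 φ Fin.elim0
  rw [show (fun i : Fin 0 => f (Fin.elim0 i)) = Fin.elim0 from funext fun i => i.elim0] at this
  exact this.trans hφ

theorem IsElementary.norm_sum (hf : IsElementary f) {k : ℕ} (a : Fin k → ℝ) (x : Fin k → M.Ball) :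
    ‖∑ i, a i • (f (x i) : N.X)‖ = ‖∑ i, a i • (x i : M.X)‖ :=
  hf k (.norm a .var) x

theorem IsElementary.D (hf : IsElementary f) (x : M.Ball) : N.D (f x) = M.D x :=
  hf 1 (.D (.var 0)) fun _ => x

theorem IsElementary.E (hf : IsElementary f) (x y : M.Ball) : N.E (f x) (f y) = M.E x y := by
  have := hf 2 (.E (.var 0) (.var 1)) ![x, y]
  rw [CFormula.eval_E, CFormula.eval_E] at this
  exact this

/-- Each vector is a multiple of a vector in the ball, on which `f` is defined. Since `f` preserves
norms of linear combinations, every linear relation in the ball persists, which gives both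
independence of the multiple chosen and linearity. -/
theorem IsElementary.exists_linearIsometry (hf : IsElementary f) :
    ∃ L : M.X →ₗᵢ[ℝ] N.X, ∀ x : M.Ball, L x = f x := by
  choose c b hc hb using fun x : M.X => M.exists_smul_ball x
  have key : ∀ {k : ℕ} (a : Fin k → ℝ) (x : Fin k → M.Ball), ∑ i, a i • (x i : M.X) = 0 →
      ∑ i, a i • (f (x i) : N.X) = 0 := fun a x h => by
    rw [← norm_eq_zero, hf.norm_sum, h, norm_zero]
  refine ⟨⟨⟨⟨fun x => c x • (f (b x) : N.X), fun x y => ?_⟩, fun r x => ?_⟩, fun x => ?_⟩,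
    fun x => ?_⟩
  · have := key ![c (x + y), -c x, -c y] ![b (x + y), b x, b y] (by
      simp only [Fin.sum_univ_three, Matrix.cons_val, neg_smul, ← hb]; abel)
    simp only [Fin.sum_univ_three, Matrix.cons_val, neg_smul] at this
    refine sub_eq_zero.1 (Eq.trans ?_ this); abel
  · have := key ![c (r • x), -(r * c x)] ![b (r • x), b x] (by
      simp only [Fin.sum_univ_two, Matrix.cons_val_zero, Matrix.cons_val_one, neg_smul, mul_smul,
        ← hb]; abel)
    simp only [Fin.sum_univ_two, Matrix.cons_val_zero, Matrix.cons_val_one, neg_smul,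
      mul_smul] at this
    refine sub_eq_zero.1 (Eq.trans ?_ this); simp only [RingHom.id_apply]; abel
  · have := hf.norm_sum ![c x] ![b x]
    simp only [Fin.sum_univ_one, Matrix.cons_val_zero, ← hb] at this
    exact this
  · have := key ![c x, -1] ![b x, x] (by
      simp only [Fin.sum_univ_two, Matrix.cons_val_zero, Matrix.cons_val_one, ← hb]
      simp)
    simp only [Fin.sum_univ_two, Matrix.cons_val_zero, Matrix.cons_val_one, neg_smul,
      one_smul] at this
    exact sub_eq_zero.1 (Eq.trans (sub_eq_add_neg _ _) this)

variable [IsHilb M] [IsHilb N]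

/-- The linear map and the map between components that are induced by an elementary embedding. -/
structure Decomp.Emb (d : Decomp M) (e : Decomp N) (f : M.Ball → N.Ball) where
  L : M.X →ₗᵢ[ℝ] N.X
  L_coe : ∀ x : M.Ball, L x = f x
  β : d.I → e.I
  injective : Function.Injective β
  mem_W : ∀ o x, x ∈ d.W o → L x ∈ e.W (o.map β)

theorem Decomp.comp_eq_iff (d : Decomp M) {x y : M.Ball} (hx : M.D x = 0) (hy : M.D y = 0) :
    d.comp x hx = d.comp y hy ↔ M.E x y = 1 := by
  refine ⟨fun h => d.E_of_mem (d.mem_comp x hx) (h ▸ d.mem_comp y hy), fun h => ?_⟩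
  by_contra hne
  rw [d.E_of_ne hne (d.mem_comp x hx) (d.mem_comp y hy) (d.norm_of_D x hx) (d.norm_of_D y hy)] at h
  nlinarith [Real.sq_sqrt (show (0 : ℝ) ≤ 2 by norm_num)]

theorem Decomp.comp_eq_of_mem (d : Decomp M) {x : M.Ball} (hx : M.D x = 0) {i : d.I}
    (h : (x : M.X) ∈ d.V i) : d.comp x hx = i :=
  d.eq_of_mem (d.mem_comp x hx) h (norm_ne_zero_iff.1 (by rw [d.norm_of_D x hx]; exact one_ne_zero))

theorem Decomp.mem_W_none_of_D (d : Decomp M) {x : M.Ball} (h : M.D x ^ 2 = ‖(x : M.X)‖ ^ 2 + 1) :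
    (x : M.X) ∈ d.W none := by
  have h1 := d.D_sq x
  refine d.mem_W_none.2 fun i y hy => ?_
  have h2 := d.norm_P_le_gauge (x : M.X) i
  have h3 : d.P (some i) (x : M.X) = 0 := norm_eq_zero.1 (le_antisymm (by linarith) (norm_nonneg _))
  rw [← d.inner_P_right (some i) _ hy, h3, inner_zero_right]

theorem Decomp.D_sq_of_mem_W_none (d : Decomp M) {x : M.Ball} (h : (x : M.X) ∈ d.W none) :
    M.D x ^ 2 = ‖(x : M.X)‖ ^ 2 + 1 := by
  have h1 : d.gauge x = 0 := le_antisymm (d.gauge_le fun i => by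
    rw [d.P_eq_zero (o' := none) (Option.some_ne_none i) h, norm_zero]) (d.gauge_nonneg _)
  rw [d.D_sq, h1, mul_zero, sub_zero]

/-- Both kinds of summand are visible to formulas: unit vectors in components share one exactly when
`E` is `1`, and lying in the complement means `D ^ 2 = ‖·‖ ^ 2 + 1`. -/
theorem IsElementary.nonempty_emb (hf : IsElementary f) (d : Decomp M) (e : Decomp N) :
    Nonempty (d.Emb e f) := by
  obtain ⟨L, hL⟩ := hf.exists_linearIsometry
  choose z hz hz1 using d.exists_unit
  have hz0 := fun i => d.D_of_mem (z i) i (hz i) (hz1 i)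
  have hfz : ∀ i, N.D (f (z i)) = 0 := fun i => (hf.D _).trans (hz0 i)
  refine ⟨⟨L, hL, fun i => e.comp (f (z i)) (hfz i), fun i j hij => ?_, ?_⟩⟩
  · have h1 := (e.comp_eq_iff (hfz i) (hfz j)).1 hij
    rw [hf.E, ← d.comp_eq_iff (hz0 i) (hz0 j), d.comp_eq_of_mem (hz0 i) (hz i),
      d.comp_eq_of_mem (hz0 j) (hz j)] at h1
    exact h1
  · rintro (_ | i) x hx
    · obtain ⟨c, b, hc, rfl⟩ := M.exists_smul_ball x
      rw [map_smul]
      refine Submodule.smul_mem _ _ ?_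
      have hb : (b : M.X) ∈ d.W none := (Submodule.smul_mem_iff _ hc.ne').1 hx
      rw [hL]
      refine e.mem_W_none_of_D ?_
      rw [hf.D, d.D_sq_of_mem_W_none hb, ← hL, L.norm_map]
    · by_cases h0 : x = 0
      · rw [h0, map_zero]; exact Submodule.zero_mem _
      · have hn := norm_ne_zero_iff.2 h0
        obtain ⟨y, hy⟩ := BanachStr.coe_eq_of_norm_eq_one (M := M) (x := ‖x‖⁻¹ • x) (by
          rw [norm_smul, norm_inv, norm_norm, inv_mul_cancel₀ hn])
        have hyV : (y : M.X) ∈ d.V i := hy ▸ (d.V i).smul_mem _ hx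
        have hy0 : M.D y = 0 := d.D_of_mem y i hyV (by
          rw [hy, norm_smul, norm_inv, norm_norm, inv_mul_cancel₀ hn])
        have hx' : x = ‖x‖ • (y : M.X) := by rw [hy, smul_smul, mul_inv_cancel₀ hn, one_smul]
        rw [hx', map_smul, hL]
        refine Submodule.smul_mem _ _ ?_
        have h1 : e.comp (f y) ((hf.D y).trans hy0) = e.comp (f (z i)) (hfz i) := by
          rw [e.comp_eq_iff, hf.E, d.E_of_mem hyV (hz i)]
        rw [Option.map_some, e.W_some, ← h1]
        exact e.mem_comp _ _

namespace Decomp.Emb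

variable {d : Decomp M} {e : Decomp N} (F : d.Emb e f)

theorem hasSum_extend (x : M.X) :
    HasSum (Function.extend (Option.map F.β) (fun o => F.L (d.P o x)) 0) (F.L x) := by
  rw [hasSum_extend_zero (Option.map_injective F.injective)]
  exact (d.hasSum_P x).mapL F.L.toContinuousLinearMap

theorem P_eq_extend (x : M.X) (o' : Option e.I) : e.P o' (F.L x) =
    Function.extend (Option.map F.β) (fun o => F.L (d.P o x)) 0 o' := by
  refine e.P_eq_of_hasSum (fun o => ?_) (F.hasSum_extend x) o'
  by_cases h : ∃ p, Option.map F.β p = o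
  · obtain ⟨p, rfl⟩ := h
    rw [(Option.map_injective F.injective).extend_apply]
    exact F.mem_W p _ (d.P_mem p x)
  · rw [Function.extend_apply' _ _ _ h]
    exact Submodule.zero_mem _

theorem P_map (x : M.X) (o : Option d.I) : e.P (o.map F.β) (F.L x) = F.L (d.P o x) := by
  rw [F.P_eq_extend, (Option.map_injective F.injective).extend_apply]

theorem P_eq_zero (x : M.X) {j : e.I} (h : ∀ i, F.β i ≠ j) : e.P (some j) (F.L x) = 0 := by
  rw [F.P_eq_extend, Function.extend_apply']
  · rfl
  · rintro ⟨_ | i, hi⟩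
    · cases hi
    · exact h i (Option.some_injective _ hi)

theorem isMatch {ι : Type*} (v : ι → M.X) :
    Match d.toComps e.toComps v fun k => F.L (v k) := by
  refine ⟨fun o o' => o' = o.map F.β, rfl, ?_, ?_, ?_, ?_, ?_⟩
  · rintro o o' o'' rfl rfl; rfl
  · rintro o o' o'' rfl h
    exact Option.map_injective F.injective h
  · exact fun o ho => absurd rfl (ho _)
  · rintro (_ | j) ho k
    · exact absurd rfl (ho none)
    · exact F.P_eq_zero _ fun i hi => ho (some i) (by rw [← hi]; rfl)
  · rintro o o' rfl k l
    rw [F.P_map, F.P_map, F.L.inner_map_map]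

end Decomp.Emb

end Elementary

/-! ### The ultrapower has new components and new directions -/

theorem not_finiteDimensional_of_orthonormal {H : Type*} [NormedAddCommGroup H]
    [InnerProductSpace ℝ H] {V : Submodule ℝ H} {s : ℕ → H} (hs : Orthonormal ℝ s)
    (hV : ∀ n, s n ∈ V) : ¬ FiniteDimensional ℝ V := fun _ =>
  have h : LinearIndependent ℝ fun n => (⟨s n, hV n⟩ : V) :=
    LinearIndependent.of_comp V.subtype hs.linearIndependent
  have := h.finite
  not_finite ℕ

theorem exists_orthonormal_seq {H : Type*} [NormedAddCommGroup H] [InnerProductSpace ℝ H]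
    (V : Submodule ℝ H) (hV : ¬ FiniteDimensional ℝ V) :
    ∃ s : ℕ → H, (∀ n, s n ∈ V) ∧ Orthonormal ℝ s := by
  have : Std.Symm fun x y : H => ⟪x, y⟫ = 0 := ⟨fun x y h => by rw [real_inner_comm]; exact h⟩
  obtain ⟨s, hs, hs'⟩ := exists_seq_of_forall_finset_exists' (fun x : H => x ∈ V ∧ ‖x‖ = 1)
    (fun x y => ⟪x, y⟫ = 0) fun S _ => by
      obtain ⟨e, heV, he, h⟩ := exists_unit_orthogonal V hV (fun x : S => (x : H))
      exact ⟨e, ⟨heV, he⟩, fun x hx => h ⟨x, hx⟩⟩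
  exact ⟨s, fun n => (hs n).1, fun n => (hs n).2, hs'⟩

theorem Orthonormal.tendsto_inner_zero {H : Type*} [NormedAddCommGroup H] [InnerProductSpace ℝ H]
    {ι : Type*} {s : ι → H} (hs : Orthonormal ℝ s) (x : H) :
    Tendsto (fun n => ⟪x, s n⟫) cofinite (𝓝 0) := by
  have h := (hs.inner_products_summable x).tendsto_cofinite_zero
  have h1 := h.sqrt
  rw [Real.sqrt_zero] at h1
  refine squeeze_zero_norm (fun n => ?_) h1
  rw [Real.sqrt_sq (norm_nonneg _), real_inner_comm]

open BanachStr

section EmbDiag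

variable {M : BanachStr.{u}} [IsHilb M]

instance : IsHilb M.ultrapower := isHilb_of_models (isElementary_diag (M := M)).models

theorem tendsto_inner_cls (x y : ℕ → M.Ball) :
    Tendsto (fun k => ⟪(x k : M.X), y k⟫) (hyperfilter ℕ : Filter ℕ)
      (𝓝 ⟪(cls x : M.ultrapower.X), cls y⟫) := by
  have := (CFormula.ip (n := 2) (.var 0) (.var 1)).tendsto_eval_ultrapower ![x, y]
  simp only [CFormula.eval_ip] at this
  exact this

omit [IsHilb M] in
theorem tendsto_E_cls (x y : ℕ → M.Ball) :
    Tendsto (fun k => M.E (x k) (y k)) (hyperfilter ℕ : Filter ℕ)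
      (𝓝 (M.ultrapower.E (cls x) (cls y))) := by
  have := (CFormula.E (n := 2) (.var 0) (.var 1)).tendsto_eval_ultrapower ![x, y]
  simp only [CFormula.eval_E] at this
  exact this

/-- By Bessel's inequality an orthonormal sequence tends weakly to `0`, so its class is a new
direction. -/
theorem inner_cls_eq_zero_of_orthonormal {s : ℕ → M.Ball}
    (hs : Orthonormal ℝ fun n => (s n : M.X)) (x : M.Ball) :
    ⟪(diag x : M.ultrapower.X), cls s⟫ = 0 :=
  tendsto_nhds_unique (tendsto_inner_cls _ _)
    ((hs.tendsto_inner_zero (x : M.X)).mono_left hyperfilter_le_cofinite)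

theorem eventually_hyperfilter_of_injective {α : Type*} {f : ℕ → α} (hf : Function.Injective f)
    (a : α) : ∀ᶠ k in (hyperfilter ℕ : Filter ℕ), f k ≠ a :=
  hyperfilter_le_cofinite (hf.tendsto_cofinite.eventually (Set.finite_singleton a).compl_mem_cofinite)

namespace Decomp.Emb

variable {d : Decomp M} {e : Decomp M.ultrapower} (F : d.Emb e diag)

theorem inner_L_eq_zero {y : M.ultrapower.X}
    (h : ∀ x : M.Ball, ⟪(diag x : M.ultrapower.X), y⟫ = 0) (x : M.X) : ⟪F.L x, y⟫ = 0 := by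
  obtain ⟨c, b, -, rfl⟩ := M.exists_smul_ball x
  rw [map_smul, real_inner_smul_left, F.L_coe, h, mul_zero]

theorem exists_unit_orthogonal (i : d.I) :
    ∃ u : M.ultrapower.Ball, (u : M.ultrapower.X) ∈ e.V (F.β i) ∧ ‖(u : M.ultrapower.X)‖ = 1 ∧
      ∀ x, ⟪F.L x, (u : M.ultrapower.X)⟫ = 0 := by
  obtain ⟨s, hsV, hs⟩ := exists_orthonormal_seq (d.V i) (d.infd i)
  choose t ht using fun n => BanachStr.coe_eq_of_norm_eq_one (M := M) (hs.1 n)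
  obtain rfl : (fun n => (t n : M.X)) = s := funext ht
  have hD : ∀ n, M.D (t n) = 0 := fun n => d.D_of_mem _ i (hsV n) (hs.1 n)
  have hD' : M.ultrapower.D (cls t) = 0 := by
    refine tendsto_nhds_unique (tendsto_D_cls t) ?_
    simp only [hD]
    exact tendsto_const_nhds
  refine ⟨cls t, ?_, e.norm_of_D _ hD', F.inner_L_eq_zero fun x =>
    inner_cls_eq_zero_of_orthonormal hs x⟩
  have hD0 : M.ultrapower.D (diag (t 0)) = 0 := (isElementary_diag.D _).trans (hD 0)
  have h1 : e.comp (cls t) hD' = e.comp (diag (t 0)) hD0 := by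
    rw [e.comp_eq_iff]
    refine tendsto_nhds_unique (tendsto_E_cls t fun _ => t 0) ?_
    simp only [d.E_of_mem (hsV _) (hsV 0)]
    exact tendsto_const_nhds
  have h2 : e.comp (diag (t 0)) hD0 = F.β i := e.comp_eq_of_mem _ (by
    rw [← F.L_coe]
    exact F.mem_W (some i) _ (hsV 0))
  rw [← h2, ← h1]
  exact e.mem_comp _ _

/-- For a set `α` of natural numbers, an injective sequence that encodes its initial segments. -/
noncomputable def _root_.initialSegments (α : Set ℕ) (k : ℕ) : ℕ × Finset ℕ := by
  classical exact (k, (Finset.range k).filter (· ∈ α))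

theorem _root_.initialSegments_injective (α : Set ℕ) : Function.Injective (initialSegments α) :=
  fun _ _ h => congrArg Prod.fst h

theorem _root_.eventually_initialSegments_ne {α α' : Set ℕ} (h : α ≠ α') :
    ∀ᶠ k in (hyperfilter ℕ : Filter ℕ), initialSegments α k ≠ initialSegments α' k := by
  obtain ⟨n, hn⟩ : ∃ n, ¬ (n ∈ α ↔ n ∈ α') := by
    by_contra! hc
    exact h (Set.ext hc)
  have h1 : ∀ᶠ k in atTop, n < k := eventually_gt_atTop n
  refine (hyperfilter_le_cofinite.trans_eq Nat.cofinite_eq_atTop) ?_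
  filter_upwards [h1] with k hk heq
  have h2 := congrArg (n ∈ ·.2) heq
  simp only [initialSegments, Finset.mem_filter, Finset.mem_range, hk, true_and, eq_iff_iff] at h2
  exact hn h2

/-- The initial segments of a set of natural numbers label a sequence of distinct components of `M`,
and unit vectors along it define a point of the ultrapower. Different sets give sequences that
eventually differ, hence different components, and injectivity keeps these away from the components
of `M`. So there are at least as many new components as subsets of `ℕ`. -/
theorem not_countable_compl_range : ¬ {j | ∀ i, F.β i ≠ j}.Countable := by
  intro hc
  obtain ⟨ν⟩ : Nonempty (ℕ × Finset ℕ ↪ d.I) := by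
    have := (Denumerable.eqv (ℕ × Finset ℕ)).toEmbedding.trans (Infinite.natEmbedding d.I)
    exact ⟨this⟩
  choose z hz hz1 using fun p => d.exists_unit (ν p)
  have hz0 : ∀ p, M.D (z p) = 0 := fun p => d.D_of_mem _ _ (hz p) (hz1 p)
  let y : Set ℕ → M.ultrapower.Ball := fun α => cls fun k => z (initialSegments α k)
  have hy : ∀ α, M.ultrapower.D (y α) = 0 := fun α => by
    refine tendsto_nhds_unique (tendsto_D_cls _) ?_
    simp only [hz0]
    exact tendsto_const_nhds
  have hsqrt : (√2 : ℝ) ≠ 1 := fun h => by nlinarith [Real.sq_sqrt (show (0 : ℝ) ≤ 2 by norm_num)]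
  have hinj : Function.Injective fun α => e.comp (y α) (hy α) := by
    intro α α' h
    by_contra hne
    rw [e.comp_eq_iff] at h
    refine hsqrt (tendsto_nhds_unique (tendsto_const_nhds.congr' ?_)
      (h ▸ tendsto_E_cls (fun k => z (initialSegments α k)) fun k => z (initialSegments α' k)))
    filter_upwards [eventually_initialSegments_ne hne] with k hk
    exact (d.E_of_ne (fun h' => hk (ν.injective h')) (hz _) (hz _) (hz1 _) (hz1 _)).symm
  have hnew : ∀ α i, F.β i ≠ e.comp (y α) (hy α) := by
    intro α i h
    obtain ⟨x, hx, hx1⟩ := d.exists_unit i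
    have hx0 := d.D_of_mem x i hx hx1
    have hx0' : M.ultrapower.D (diag x) = 0 := (isElementary_diag.D _).trans hx0
    have h2 : e.comp (diag x) hx0' = F.β i := e.comp_eq_of_mem _ (by
      rw [← F.L_coe]
      exact F.mem_W (some i) _ hx)
    rw [← h2, eq_comm, e.comp_eq_iff] at h
    refine hsqrt (tendsto_nhds_unique (tendsto_const_nhds.congr' ?_)
      (h ▸ tendsto_E_cls (fun k => z (initialSegments α k)) fun _ => x))
    filter_upwards [eventually_hyperfilter_of_injective
      (ν.injective.comp (initialSegments_injective α)) i] with k hk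
    exact (d.E_of_ne hk (hz _) hx (hz1 _) hx1).symm
  have hc' := hc.to_subtype
  have : Function.Injective fun α : Set ℕ =>
      (⟨e.comp (y α) (hy α), fun i => hnew α i⟩ : {j | ∀ i, F.β i ≠ j}) :=
    fun α α' h => hinj (congrArg Subtype.val h)
  have := this.countable
  obtain ⟨g, hg⟩ := exists_injective_nat (Set ℕ)
  exact Function.cantor_injective g hg

/-- Normalized sums over pairwise disjoint blocks of an orthonormal sequence. -/
theorem _root_.Orthonormal.blocks {H : Type*} [NormedAddCommGroup H] [InnerProductSpace ℝ H]
    {z : ℕ × ℕ → H} (hz : Orthonormal ℝ z) (c : ℕ → ℕ) : Orthonormal ℝ fun n =>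
      (√(c n + 1))⁻¹ • ∑ l ∈ Finset.range (c n + 1), z (n, l) := by
  classical
  rw [orthonormal_iff_ite]
  intro m n
  have h1 := orthonormal_iff_ite.1 hz
  rw [real_inner_smul_left, real_inner_smul_right, sum_inner]
  simp only [inner_sum, h1, Prod.mk.injEq]
  split_ifs with h
  · subst h
    simp only [true_and, Finset.sum_ite_eq]
    rw [Finset.sum_congr rfl fun i hi => if_pos hi, Finset.sum_const, Finset.card_range]
    have h2 : √(c m + 1 : ℝ) * √(c m + 1) = c m + 1 := Real.mul_self_sqrt (by positivity)
    simp only [nsmul_eq_mul, mul_one, Nat.cast_add, Nat.cast_one]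
    rw [← mul_assoc, ← mul_inv, h2, inv_mul_cancel₀ (by positivity)]
  · simp [h]

/-- A normalized sum of `k + 1` unit vectors from distinct components has projections of norm at
most `1 / √(k + 1)`. As `k` grows the gauge tends to `0`, so the class lies in the complement.
Pairing numbers `m` and `k` provides infinitely many mutually orthogonal sequences of this kind. -/
theorem exists_orthonormal_none : ∃ y : ℕ → M.ultrapower.X, Orthonormal ℝ y ∧
    (∀ m, y m ∈ e.W none) ∧ ∀ m x, ⟪F.L x, y m⟫ = 0 := by
  obtain ⟨ν⟩ : Nonempty (ℕ × ℕ ↪ d.I) :=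
    ⟨(Denumerable.eqv (ℕ × ℕ)).toEmbedding.trans (Infinite.natEmbedding d.I)⟩
  choose z hz hz1 using fun p => d.exists_unit (ν p)
  have hzo : Orthonormal ℝ fun p => (z p : M.X) := ⟨hz1, fun p q hpq =>
    d.orth _ _ (fun h => hpq (ν.injective h)) _ (hz p) _ (hz q)⟩
  let c : ℕ → ℕ := fun n => n.unpair.2
  have hY := hzo.blocks c
  choose Y hYeq using fun n => BanachStr.coe_eq_of_norm_eq_one (M := M) (hY.1 n)
  simp only [← hYeq] at hY
  have hpair : ∀ m : ℕ, Function.Injective fun k => Nat.pair m k := fun m k k' h =>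
    (Nat.pair_eq_pair.1 h).2
  have hinner : ∀ m m', ⟪(cls fun k => Y (Nat.pair m k) : M.ultrapower.X),
      cls fun k => Y (Nat.pair m' k)⟫ = if m = m' then 1 else 0 := fun m m' => by
    refine tendsto_nhds_unique (tendsto_inner_cls _ _) (tendsto_const_nhds.congr fun k => ?_)
    rw [orthonormal_iff_ite.1 hY]
    simp [Nat.pair_eq_pair]
  have ho : Orthonormal ℝ fun m => (cls fun k => Y (Nat.pair m k) : M.ultrapower.X) :=
    orthonormal_iff_ite.2 hinner
  refine ⟨_, ho, fun m => ?_, fun m => F.inner_L_eq_zero fun x =>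
    inner_cls_eq_zero_of_orthonormal (hY.comp _ (hpair m)) x⟩
  refine e.mem_W_none_of_D ?_
  rw [ho.1 m]
  refine tendsto_nhds_unique ((tendsto_D_cls _).pow 2) ?_
  have hg : ∀ n, d.gauge (Y n) ≤ (√(c n + 1))⁻¹ := fun n => by
    refine d.gauge_le fun i => ?_
    rw [hYeq, map_smul, norm_smul, norm_inv, Real.norm_of_nonneg (Real.sqrt_nonneg _)]
    refine mul_le_of_le_one_right (by positivity) ?_
    rw [map_sum]
    by_cases hi : ∃ l, ν (n, l) = i
    · obtain ⟨l, rfl⟩ := hi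
      have h1 : ∀ l' ∈ Finset.range (c n + 1), l' ≠ l →
          d.P (some (ν (n, l))) (z (n, l') : M.X) = 0 := fun l' _ hl' =>
        d.P_eq_zero (o' := some (ν (n, l'))) (fun h => hl' (by
          have := ν.injective (Option.some_injective _ h)
          simpa using this.symm)) (hz _)
      by_cases hl : l ∈ Finset.range (c n + 1)
      · rw [Finset.sum_eq_single_of_mem l hl h1]
        exact (d.norm_P_le _ _).trans (hz1 _).le
      · rw [Finset.sum_eq_zero fun l' hl' => h1 l' hl' fun h => hl (h ▸ hl'), norm_zero]
        exact zero_le_one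
    · rw [Finset.sum_eq_zero fun l _ => d.P_eq_zero (o' := some (ν (n, l)))
        (fun h => hi ⟨l, (Option.some_injective _ h).symm⟩) (hz _), norm_zero]
      exact zero_le_one
  have hg0 : Tendsto (fun k => d.gauge (Y (Nat.pair m k))) atTop (𝓝 0) := by
    refine squeeze_zero (fun k => d.gauge_nonneg _) (fun k => hg _) ?_
    simp only [c, Nat.unpair_pair]
    exact tendsto_inv_atTop_zero.comp (Real.tendsto_sqrt_atTop.comp
      (tendsto_atTop_add_const_right _ _ tendsto_natCast_atTop_atTop))
  have h2 := (hg0.const_mul 2).const_sub ((1 : ℝ) ^ 2 + 1)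
  rw [mul_zero, sub_zero] at h2
  refine (h2.mono_left (hyperfilter_le_cofinite.trans_eq Nat.cofinite_eq_atTop)).congr fun k => ?_
  rw [d.D_sq, hY.1]

theorem rich (F : d.Emb e diag) : e.toComps.Rich where
  infinite_none := by
    obtain ⟨y, hy, hyW, -⟩ := F.exists_orthonormal_none
    exact not_finiteDimensional_of_orthonormal hy hyW
  uncountable := by
    rw [← not_countable_iff]
    exact fun _ => F.not_countable_compl_range (Set.to_countable _)

end Decomp.Emb

theorem Decomp.exists_emb_diag (d : Decomp M) :
    ∃ e : Decomp M.ultrapower, Nonempty (d.Emb e diag) := by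
  obtain ⟨e⟩ := nonempty_decomp_of_models d (isElementary_diag (M := M)).models
  exact ⟨e, isElementary_diag.nonempty_emb d e⟩

/-- Matching tuples satisfy the same formulas. -/
theorem CFormula.eval_eq_of_match {N : BanachStr.{v}} [IsHilb N] {d : Decomp M} {e : Decomp N}
    {n : ℕ} (φ : CFormula n) {v : Fin n → M.Ball} {w : Fin n → N.Ball}
    (h : Match d.toComps e.toComps (fun k => (v k : M.X)) fun k => (w k : N.X)) :
    φ.eval M v = φ.eval N w := by
  -- The diagonal embeddings into the rich ultrapowers change neither the matching nor the values of
  -- formulas.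
  obtain ⟨d', ⟨F⟩⟩ := d.exists_emb_diag
  obtain ⟨e', ⟨G⟩⟩ := e.exists_emb_diag
  have h1 := ((F.isMatch fun k => (v k : M.X)).symm.trans h).trans (G.isMatch fun k => (w k : N.X))
  simp only [F.L_coe, G.L_coe] at h1
  have h2 := φ.eval_eq_of_match_of_rich F.rich G.rich (v := fun k => diag (v k))
    (w := fun k => diag (w k)) h1
  rwa [isElementary_diag, isElementary_diag] at h2

end EmbDiag

/-! ### Generic types -/

/-- For a unit vector `x` of a component, this vanishes if and only if the projection of `y` to that
component does. -/
noncomputable def BanachStr.perp (M : BanachStr.{u}) (x y : M.Ball) : ℝ :=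
  |‖(1 / 2 : ℝ) • (x : M.X) + (1 / 4 : ℝ) • (y : M.X)‖ ^ 2 - M.D (M.comb (1 / 2) (1 / 4) x y) ^ 2| +
    |‖(1 / 2 : ℝ) • (x : M.X) + (-1 / 4 : ℝ) • (y : M.X)‖ ^ 2 -
      M.D (M.comb (1 / 2) (-1 / 4) x y) ^ 2|

/-- The formula for `BanachStr.perp`. -/
noncomputable def CFormula.perp {n : ℕ} (s t : CTerm n) : CFormula n :=
  .conn (k := 4) ⟨fun r => |r 0 ^ 2 - r 1 ^ 2| + |r 2 ^ 2 - r 3 ^ 2|, by fun_prop⟩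
    ![.normComb (1 / 2) (1 / 4) s t, .DComb (1 / 2) (1 / 4) s t, .normComb (1 / 2) (-1 / 4) s t,
      .DComb (1 / 2) (-1 / 4) s t]

theorem CFormula.eval_perp {M : BanachStr.{u}} {n : ℕ} (s t : CTerm n) (v : Fin n → M.Ball) :
    (CFormula.perp s t).eval M v = M.perp (s.eval M v) (t.eval M v) := by
  simp [CFormula.perp, CFormula.eval, BanachStr.perp, CFormula.eval_DComb, CFormula.eval_normComb]

theorem BanachStr.perp_nonneg (M : BanachStr.{u}) (x y : M.Ball) : 0 ≤ M.perp x y := by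
  unfold BanachStr.perp; positivity

/-- By `D_sq` both differences have the form `2 * gauge (x / 2 ± y / 4) - 1`. If the projection of
`y` vanishes, the gauge is `1 / 2`, since other components contribute at most `1 / 4`. Conversely,
gauge `1 / 2` for both signs contradicts the parallelogram law unless the projection is `0`. -/
theorem Decomp.perp_eq_zero_iff {M : BanachStr.{u}} [IsHilb M] (d : Decomp M) {i : d.I} {x : M.Ball}
    (hx : (x : M.X) ∈ d.V i) (hx1 : ‖(x : M.X)‖ = 1) (y : M.Ball) :
    M.perp x y = 0 ↔ d.P (some i) (y : M.X) = 0 := by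
  have h1 : ∀ b : ℝ, |b| ≤ 1 / 4 → ‖(1 / 2 : ℝ) • (x : M.X) + b • (y : M.X)‖ ^ 2 -
      M.D (M.comb (1 / 2) b x y) ^ 2 =
        2 * d.gauge ((1 / 2 : ℝ) • (x : M.X) + b • (y : M.X)) - 1 := fun b hb => by
    rw [d.D_sq, BanachStr.comb_coe]
    · ring
    · rw [abs_of_pos (show (0 : ℝ) < 1 / 2 by norm_num)]; linarith
  have h2 : ∀ b : ℝ, ∀ j, d.P (some j) ((1 / 2 : ℝ) • (x : M.X) + b • (y : M.X)) =
      (1 / 2 : ℝ) • d.P (some j) (x : M.X) + b • d.P (some j) (y : M.X) := fun b j => by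
    rw [map_add, map_smul, map_smul]
  have hxi : d.P (some i) (x : M.X) = x := d.P_eq_self (o := some i) hx
  rw [BanachStr.perp, h1 _ (by norm_num [abs_of_pos]), h1 _ (by norm_num [abs_of_pos])]
  constructor
  · intro h
    have h3 := (add_eq_zero_iff_of_nonneg (abs_nonneg _) (abs_nonneg _)).1 h
    have h4 := d.norm_P_le_gauge ((1 / 2 : ℝ) • (x : M.X) + (1 / 4 : ℝ) • (y : M.X)) i
    have h5 := d.norm_P_le_gauge ((1 / 2 : ℝ) • (x : M.X) + (-1 / 4 : ℝ) • (y : M.X)) i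
    rw [h2, hxi] at h4 h5
    have h6 := abs_eq_zero.1 h3.1
    have h7 := abs_eq_zero.1 h3.2
    have h8 := parallelogram_law_with_norm_mul ℝ ((1 / 2 : ℝ) • (x : M.X))
      ((1 / 4 : ℝ) • d.P (some i) (y : M.X))
    rw [norm_smul, norm_smul, hx1, sub_eq_add_neg, ← neg_smul, ← neg_div,
      Real.norm_of_nonneg (by norm_num), Real.norm_of_nonneg (by norm_num)] at h8
    have h9 : ‖d.P (some i) (y : M.X)‖ ^ 2 ≤ 0 := by
      nlinarith [norm_nonneg ((1 / 2 : ℝ) • (x : M.X) + (1 / 4 : ℝ) • d.P (some i) (y : M.X)),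
        norm_nonneg ((1 / 2 : ℝ) • (x : M.X) + (-1 / 4 : ℝ) • d.P (some i) (y : M.X))]
    simpa using le_antisymm h9 (sq_nonneg _)
  · intro h
    have h3 : ∀ b : ℝ, |b| ≤ 1 / 4 →
        d.gauge ((1 / 2 : ℝ) • (x : M.X) + b • (y : M.X)) = 1 / 2 := fun b hb => by
      apply le_antisymm
      · refine d.gauge_le fun j => ?_
        rw [h2]
        by_cases hj : j = i
        · rw [hj, h, smul_zero, add_zero, norm_smul, hxi, hx1]; norm_num
        · rw [d.P_eq_zero (o' := some i) (fun h => hj (Option.some_injective _ h)) hx, smul_zero,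
            zero_add, norm_smul, Real.norm_eq_abs]
          have := mul_le_mul hb ((d.norm_P_le (some j) _).trans y.norm_le) (norm_nonneg _)
            (by norm_num)
          linarith
      · have := d.norm_P_le_gauge ((1 / 2 : ℝ) • (x : M.X) + b • (y : M.X)) i
        rw [h2, h, smul_zero, add_zero, norm_smul, hxi, hx1] at this
        norm_num at this
        linarith
    rw [h3 _ (by norm_num [abs_of_pos]), h3 _ (by norm_num [abs_of_pos])]
    norm_num

/-- The conditions place `b` and `b'` in components in which no parameter has a nonzero projection,
so `Match.cons_generic` and quantifier elimination identify their types. -/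
theorem IsElementary.tpFun_eq_of_perp {C N N' : BanachStr.{u}} [IsHilb C] (d : Decomp C)
    {f : C.Ball → N.Ball} {g : C.Ball → N'.Ball} (hf : IsElementary f) (hg : IsElementary g)
    {A : Set C.Ball} {b : N.Ball} {b' : N'.Ball} (hb : N.D b = 0) (hb' : N'.D b' = 0)
    (h : ∀ a ∈ A, N.perp b (f a) = 0) (h' : ∀ a ∈ A, N'.perp b' (g a) = 0) :
    tpFun f A b = tpFun g A b' := by
  have := isHilb_of_models hf.models
  have := isHilb_of_models hg.models
  obtain ⟨e⟩ := nonempty_decomp_of_models d hf.models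
  obtain ⟨e'⟩ := nonempty_decomp_of_models d hg.models
  obtain ⟨F⟩ := hf.nonempty_emb d e
  obtain ⟨G⟩ := hg.nonempty_emb d e'
  funext m φ a
  refine φ.eval_eq_of_match (d := e) (e := e') ?_
  rw [coe_cons, coe_cons]
  have h1 := (F.isMatch fun k => (a k : C.X)).symm.trans (G.isMatch fun k => (a k : C.X))
  simp only [F.L_coe, G.L_coe] at h1
  refine h1.cons_generic (e.mem_comp b hb) (e'.mem_comp b' hb')
    ((e.norm_of_D b hb).trans (e'.norm_of_D b' hb').symm) (fun k => ?_) fun k => ?_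
  · exact (e.perp_eq_zero_iff (e.mem_comp b hb) (e.norm_of_D b hb) _).1 (h _ (a k).2)
  · exact (e'.perp_eq_zero_iff (e'.mem_comp b' hb') (e'.norm_of_D b' hb') _).1 (h' _ (a k).2)

/-- The type of a unit vector of a component that is orthogonal to the set of parameters. -/
def CType.IsGeneric {C : BanachStr.{u}} {A : Set C.Ball} (p : CType C A) : Prop :=
  ∀ (N : BanachStr.{u}) (f : C.Ball → N.Ball) (b : N.Ball), IsElementary f →
    (p.RealizedBy f b ↔ N.D b = 0 ∧ ∀ a ∈ A, N.perp b (f a) = 0)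

theorem tpFun_D {C N : BanachStr.{u}} (f : C.Ball → N.Ball) (A : Set C.Ball) (b : N.Ball) :
    tpFun f A b 0 (.D (.var 0)) Fin.elim0 = N.D b := rfl

theorem tpFun_perp {C N : BanachStr.{u}} (f : C.Ball → N.Ball) (A : Set C.Ball) (b : N.Ball)
    (a : A) : tpFun f A b 1 (.perp (.var 0) (.var 1)) (fun _ => a) = N.perp b (f a) := by
  rw [tpFun, CFormula.eval_perp]
  rfl

theorem CType.isGeneric_of_realizedBy {C N : BanachStr.{u}} [IsHilb C] (d : Decomp C)
    {A : Set C.Ball} {p : CType C A} {f : C.Ball → N.Ball} (hf : IsElementary f) {b : N.Ball}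
    (hp : p.RealizedBy f b) (hb : N.D b = 0) (h : ∀ a ∈ A, N.perp b (f a) = 0) : p.IsGeneric := by
  intro N' g c hg
  constructor
  · intro hc
    have h1 : tpFun g A c = tpFun f A b := Eq.trans hc hp.symm
    refine ⟨?_, fun a ha => ?_⟩
    · rw [← tpFun_D g A c, h1, tpFun_D, hb]
    · rw [← tpFun_perp g A c ⟨a, ha⟩, h1, tpFun_perp, h a ha]
  · rintro ⟨h1, h2⟩
    exact (hg.tpFun_eq_of_perp d hf h1 hb h2 h).trans hp

theorem CType.RealizedBy.restrict {C N : BanachStr.{u}} {A B : Set C.Ball} {p : CType C B}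
    {f : C.Ball → N.Ball} {b : N.Ball} (hp : p.RealizedBy f b) (h : A ⊆ B) :
    (p.restrict A h).RealizedBy f b :=
  funext fun m => funext fun φ => funext fun a =>
    congrFun (congrFun (congrFun hp m) φ) fun i => ⟨a i, h (a i).2⟩

theorem CType.IsGeneric.restrict {C : BanachStr.{u}} [IsHilb C] (d : Decomp C) {A B : Set C.Ball}
    {p : CType C B} (hp : p.IsGeneric) (h : A ⊆ B) : (p.restrict A h).IsGeneric := by
  obtain ⟨N, f, b, hf, hb⟩ := p.2
  obtain ⟨h1, h2⟩ := (hp N f b hf).1 hb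
  exact CType.isGeneric_of_realizedBy d hf (CType.RealizedBy.restrict hb h) h1 fun a ha =>
    h2 a (h ha)

theorem CType.IsGeneric.mem_realizations_iff {C : BanachStr.{u}} {A : Set C.Ball} {p : CType C A}
    (hp : p.IsGeneric) (b : C.Ball) :
    b ∈ p.realizations ↔ C.D b = 0 ∧ ∀ a ∈ A, C.perp b a = 0 :=
  Subtype.ext_iff.trans (hp C id b fun _ _ _ => rfl)

theorem CType.eq_of_realizedBy {C N : BanachStr.{u}} {A : Set C.Ball} {p q : CType C A}
    {f : C.Ball → N.Ball} {b : N.Ball} (hp : p.RealizedBy f b) (hq : q.RealizedBy f b) : p = q :=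
  Subtype.ext (Eq.trans hp.symm hq)

theorem Decomp.Emb.exists_new {C : BanachStr.{u}} [IsHilb C] {d : Decomp C}
    {e : Decomp C.ultrapower} (F : d.Emb e diag) : ∃ j : e.I, ∀ i, F.β i ≠ j := by
  by_contra! hc
  refine F.not_countable_compl_range ((Set.countable_empty).mono fun j hj => ?_)
  obtain ⟨i, hi⟩ := hc j
  exact hj i hi

theorem Decomp.Emb.perp_eq_zero {C N : BanachStr.{u}} [IsHilb C] [IsHilb N] {d : Decomp C}
    {e : Decomp N} {f : C.Ball → N.Ball} (F : d.Emb e f) {j : e.I} (hj : ∀ i, F.β i ≠ j)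
    {u : N.Ball} (hu : (u : N.X) ∈ e.V j) (hu1 : ‖(u : N.X)‖ = 1) (a : C.Ball) :
    N.perp u (f a) = 0 := by
  rw [e.perp_eq_zero_iff hu hu1, ← F.L_coe, F.P_eq_zero _ hj]

theorem CType.exists_isGeneric {C : BanachStr.{u}} [IsHilb C] (d : Decomp C) (A : Set C.Ball) :
    ∃ p : CType C A, p.IsGeneric := by
  obtain ⟨e, ⟨F⟩⟩ := d.exists_emb_diag
  obtain ⟨j, hj⟩ := F.exists_new
  obtain ⟨u, hu, hu1⟩ := e.exists_unit j
  exact ⟨⟨tpFun diag A u, _, _, u, isElementary_diag, rfl⟩, CType.isGeneric_of_realizedBy d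
    isElementary_diag (b := u) rfl (e.D_of_mem u j hu hu1) fun a _ => F.perp_eq_zero hj hu hu1 a⟩

theorem CType.IsGeneric.isWide {C : BanachStr.{u}} [IsHilb C] (d : Decomp C) {A : Set C.Ball}
    {p : CType C A} (hp : p.IsGeneric) : p.IsWide := by
  obtain ⟨e, ⟨F⟩⟩ := d.exists_emb_diag
  obtain ⟨j, hj⟩ := F.exists_new
  exact ⟨C.ultrapower, diag, e.V j, isElementary_diag, e.infd j, fun x hx hx1 =>
    (hp _ _ _ isElementary_diag).2
      ⟨e.D_of_mem x j hx hx1, fun a _ => F.perp_eq_zero hj hx hx1 a⟩⟩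

theorem CType.IsGeneric.containsDZero {C : BanachStr.{u}} {A : Set C.Ball} {p : CType C A}
    (hp : p.IsGeneric) : p.ContainsDZero := by
  obtain ⟨N, f, b, hf, hb⟩ := p.2
  rw [CType.ContainsDZero, ← hb, tpFun_D]
  exact ((hp N f b hf).1 hb).1

/-! ### Forking -/

/-- The generic global type is invariant: it treats tuples of the same type in the same way. -/
theorem eval_eq_of_generic {C : BanachStr.{u}} [IsHilb C] (d : Decomp C) {u : C.ultrapower.Ball}
    (hu : C.ultrapower.D u = 0) (hu' : ∀ a, C.ultrapower.perp u (diag a) = 0) {m : ℕ}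
    (φ : CFormula (m + 1)) {b b' : Fin m → C.Ball}
    (h : ∀ ψ : CFormula m, ψ.eval C b = ψ.eval C b') :
    φ.eval C.ultrapower (Fin.cons u fun j => diag (b j)) =
      φ.eval C.ultrapower (Fin.cons u fun j => diag (b' j)) := by
  set r := φ.eval C.ultrapower (Fin.cons u fun j => diag (b j)) with hr
  -- `ψ` vanishes at `x` if `x` is generic over the parameters and gives `φ` the value `r`. Its
  -- infimum is `0` at `b`, hence at `b'`, and is attained over `b'` in the ultrapower. By
  -- uniqueness of the generic type, `u` also gives `φ` the value `r` over `b'`.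
  let ψ : CFormula (m + 1) := .sum (k := m + 2) (Fin.cons (.D (.var 0))
    (Fin.cons (.conn (k := 1) ⟨fun s => |s 0 - r|, by fun_prop⟩ fun _ => φ) fun j : Fin m =>
      .perp (.var 0) (.var j.succ)))
  have hψ : ∀ {N : BanachStr.{u}} (x : N.Ball) (w : Fin m → N.Ball), ψ.eval N (Fin.cons x w) =
      N.D x + (|φ.eval N (Fin.cons x w) - r| + ∑ j, N.perp x (w j)) := fun x w => by
    simp only [ψ, CFormula.eval_sum, Fin.sum_univ_succ (n := m + 1), Fin.sum_univ_succ (n := m),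
      Fin.cons_zero, Fin.cons_succ, CFormula.eval, CTerm.eval, CFormula.eval_perp,
      ContinuousMap.coe_mk]
  have hψ0 : ∀ {N : BanachStr.{u}} (x : N.Ball) (w : Fin m → N.Ball),
      0 ≤ ψ.eval N (Fin.cons x w) := fun {N} x w => by
    rw [hψ]
    exact add_nonneg (N.nonneg x) (add_nonneg (abs_nonneg _)
      (Finset.sum_nonneg fun j _ => N.perp_nonneg _ _))
  have h1 : (CFormula.inf ψ).eval C b' = 0 := by
    rw [← h, ← isElementary_diag (M := C)]
    refine le_antisymm (((ψ.inf_le_eval _ u).trans_eq ?_)) (ψ.le_inf _ fun x => hψ0 x _)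
    rw [hψ, hu, ← hr]
    simp [hu']
  obtain ⟨z, hz⟩ := exists_eval_diag_eq_zero ψ b' fun ε hε => by
    obtain ⟨x, hx⟩ := ψ.exists_lt_of_inf_lt b' (h1.trans_lt hε)
    exact ⟨x, by rwa [abs_of_nonneg (hψ0 x _)]⟩
  rw [hψ] at hz
  have hs : 0 ≤ ∑ j, C.ultrapower.perp z (diag (b' j)) :=
    Finset.sum_nonneg fun j _ => C.ultrapower.perp_nonneg _ _
  have hz1 := (add_eq_zero_iff_of_nonneg (C.ultrapower.nonneg z)
    (add_nonneg (abs_nonneg _) hs)).1 hz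
  have hz2 := (add_eq_zero_iff_of_nonneg (abs_nonneg _) hs).1 hz1.2
  have hz3 := (Finset.sum_eq_zero_iff_of_nonneg fun j _ => C.ultrapower.perp_nonneg _ _).1 hz2.2
  have h2 := isElementary_diag.tpFun_eq_of_perp d isElementary_diag (A := Set.range b') hz1.1 hu
    (by rintro _ ⟨j, rfl⟩; exact hz3 j (Finset.mem_univ _)) fun a _ => hu' a
  have h3 := congrFun (congrFun (congrFun h2 m) φ) fun j => ⟨b' j, j, rfl⟩
  exact (sub_eq_zero.1 (abs_eq_zero.1 hz2.1)).symm.trans h3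

/-- By invariance, a generic point that satisfies one instance of a formula satisfies all instances
along an indiscernible sequence, so none of the disjuncts it satisfies can divide. -/
theorem CType.IsGeneric.not_forks {C : BanachStr.{u}} [IsHilb C] (d : Decomp C)
    {p : CType C Set.univ} (hp : p.IsGeneric) : ¬ p.Forks ∅ := by
  rintro ⟨k, m, φ, b, hdiv, himp⟩
  obtain ⟨e, ⟨F⟩⟩ := d.exists_emb_diag
  obtain ⟨j, hj⟩ := F.exists_new
  obtain ⟨u, hu, hu1⟩ := e.exists_unit j
  have hu0 := e.D_of_mem u j hu hu1
  have hu' := fun a => F.perp_eq_zero hj hu hu1 a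
  obtain ⟨i, hi⟩ := himp _ _ u isElementary_diag
    ((hp _ _ _ isElementary_diag).2 ⟨hu0, fun a _ => hu' a⟩)
  obtain ⟨s, hs0, hs, hcons⟩ := hdiv i
  refine hcons ⟨_, _, u, isElementary_diag, fun n => ?_⟩
  rw [← hi, ← hs0, eq_comm]
  refine eval_eq_of_generic d hu0 hu' (φ i) fun ψ => ?_
  exact hs 1 (fun _ => 0) (fun _ => n) (Subsingleton.strictMono _) (Subsingleton.strictMono _) _ ψ
    fun j => Sum.inl (0, j)

theorem exists_embedding_apply_zero {α : Type*} [Infinite α] (a : α) : ∃ ν : ℕ ↪ α, ν 0 = a := by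
  classical
  let g := Infinite.natEmbedding α
  exact ⟨g.trans (Equiv.swap (g 0) a).toEmbedding, by simp⟩

/-- A realization `x` of `q` that is not generic lies in the component of some unit vector `c 0` of
`C`, which `D x = 0` and `E x (c 0) = 1` express. Unit vectors from distinct components form an
indiscernible sequence by quantifier elimination, and no unit vector lies in two components. -/
theorem CType.forks_of_not_isGeneric {C : BanachStr.{u}} [IsHilb C] (d : Decomp C)
    {p q : CType C Set.univ} (hp : p.IsGeneric) (hq : q.ContainsDZero) (hqp : q ≠ p) :
    q.Forks ∅ := by
  obtain ⟨N, f, x, hf, hx⟩ := q.2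
  have := isHilb_of_models hf.models
  obtain ⟨e⟩ := nonempty_decomp_of_models d hf.models
  obtain ⟨F⟩ := hf.nonempty_emb d e
  have hx0 : N.D x = 0 := by rwa [CType.ContainsDZero, ← hx, tpFun_D] at hq
  obtain ⟨i, hi⟩ : ∃ i, F.β i = e.comp x hx0 := by
    by_contra! hc
    exact hqp (CType.eq_of_realizedBy hx ((hp N f x hf).2 ⟨hx0, fun a _ =>
      F.perp_eq_zero hc (e.mem_comp x hx0) (e.norm_of_D x hx0) a⟩))
  obtain ⟨ν, hν⟩ := exists_embedding_apply_zero i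
  choose c hc hc1 using fun n => d.exists_unit (ν n)
  have hc0 : ∀ n, C.D (c n) = 0 := fun n => d.D_of_mem _ _ (hc n) (hc1 n)
  let φ : CFormula 2 := .sum (k := 2) ![.D (.var 0), .conn (k := 1)
    ⟨fun r => |r 0 - 1|, by fun_prop⟩ fun _ => .E (.var 0) (.var 1)]
  have hφ : ∀ {N' : BanachStr.{u}} (y : N'.Ball) (w : Fin 1 → N'.Ball),
      φ.eval N' (Fin.cons y w) = N'.D y + |N'.E y (w 0) - 1| := fun y w => by
    simp only [φ, CFormula.eval_sum, Fin.sum_univ_two, Matrix.cons_val_zero, Matrix.cons_val_one,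
      CFormula.eval, CFormula.eval_E, ContinuousMap.coe_mk]
    rfl
  refine ⟨1, fun _ => 1, fun _ => φ, fun _ _ => c 0, fun _ => ⟨fun n _ => c n, rfl, ?_, ?_⟩, ?_⟩
  · intro n s t hs ht k ψ v
    have hv : ∀ j, ∃ l : Fin n × Fin 1, v j = Sum.inl l := fun j => by
      rcases hvj : v j with l | a
      · exact ⟨l, rfl⟩
      · exact a.2.elim
    choose l hl using hv
    obtain rfl : v = fun j => Sum.inl (l j) := funext hl
    change ψ.eval C (fun j => c (s (l j).1)) = ψ.eval C fun j => c (t (l j).1)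
    refine ψ.eval_eq_of_match (d := d) (e := d) (Match.of_mem (fun j => hc _) (fun j => hc _)
      (fun j j' => ?_) fun j j' => ?_)
    · rw [ν.injective.eq_iff, ν.injective.eq_iff, hs.injective.eq_iff, ht.injective.eq_iff]
    · by_cases hj : (l j).1 = (l j').1
      · rw [hj, real_inner_self_eq_norm_sq, real_inner_self_eq_norm_sq, hc1, hc1]
      · rw [d.orth _ _ (fun h => hj (hs.injective (ν.injective h))) _ (hc _) _ (hc _),
          d.orth _ _ (fun h => hj (ht.injective (ν.injective h))) _ (hc _) _ (hc _)]
  · rintro ⟨N', g, y, hg, hy⟩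
    have := isHilb_of_models hg.models
    obtain ⟨e'⟩ := nonempty_decomp_of_models d hg.models
    have h1 : ∀ n, N'.D y = 0 ∧ N'.E y (g (c n)) = 1 := fun n => by
      have := hy n
      rw [hφ] at this
      have h2 := (add_eq_zero_iff_of_nonneg (N'.nonneg y) (abs_nonneg _)).1 this
      exact ⟨h2.1, sub_eq_zero.1 (abs_eq_zero.1 h2.2)⟩
    have hg0 : ∀ n, N'.D (g (c n)) = 0 := fun n => (hg.D _).trans (hc0 n)
    have h3 := fun n => (e'.comp_eq_iff (h1 n).1 (hg0 n)).2 (h1 n).2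
    have h4 := (e'.comp_eq_iff (hg0 0) (hg0 1)).1 ((h3 0).symm.trans (h3 1))
    rw [hg.E, ← d.comp_eq_iff (hc0 0) (hc0 1), d.comp_eq_of_mem (hc0 0) (hc 0),
      d.comp_eq_of_mem (hc0 1) (hc 1)] at h4
    exact zero_ne_one (ν.injective h4)
  · intro N' g y hg hy
    have h1 : tpFun g Set.univ y = tpFun f Set.univ x := Eq.trans hy hx.symm
    have h2 : φ.eval N (Fin.cons x fun _ => f (c 0)) = 0 := by
      rw [hφ, hx0, e.E_of_mem (e.mem_comp x hx0) (by
        rw [← hi, ← hν, ← F.L_coe]; exact F.mem_W (some (ν 0)) _ (hc 0)), sub_self, abs_zero,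
        add_zero]
    refine ⟨0, ?_⟩
    rw [← h2]
    exact congrFun (congrFun (congrFun h1 1) φ) fun _ => ⟨c 0, trivial⟩

/-! ### Morley sequences -/

theorem CType.IsGeneric.comp_ne_of_isMorleySequence {C : BanachStr.{u}} [IsHilb C] (d : Decomp C)
    {p : CType C Set.univ} (hp : p.IsGeneric) {B : Set C.Ball} {ι : Type v} [LinearOrder ι]
    {c : ι → C.Ball} (hc : IsMorleySequence p B c) (hc0 : ∀ i, C.D (c i) = 0) {i j : ι}
    (hij : i < j) : d.comp (c i) (hc0 i) ≠ d.comp (c j) (hc0 j) := by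
  intro h
  have h1 := (((hp.restrict d (Set.subset_univ _)).mem_realizations_iff _).1 (hc j)).2 (c i)
    (Or.inr ⟨i, hij, rfl⟩)
  rw [d.perp_eq_zero_iff (d.mem_comp _ (hc0 j)) (d.norm_of_D _ (hc0 j)), ← h,
    d.P_eq_self (o := some _) (d.mem_comp _ (hc0 i))] at h1
  have h2 := d.norm_of_D _ (hc0 i)
  rw [h1, norm_zero] at h2
  exact zero_ne_one h2

/-- Two terms lie in different components. Their normalized sum has nonzero inner product with both,
so a component containing it would have to be both of these. -/
theorem CType.IsGeneric.not_unitSphereOf_subset {C : BanachStr.{u}} [IsHilb C] (d : Decomp C)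
    {p : CType C Set.univ} (hp : p.IsGeneric) {B : Set C.Ball} {ι : Type v} [LinearOrder ι]
    [Nontrivial ι] {c : ι → C.Ball} (hc : IsMorleySequence p B c) :
    ¬ unitSphereOf (spanOf c) ⊆ (p.restrict ∅ (Set.empty_subset _)).realizations := by
  intro hsub
  have hc0 : ∀ i, C.D (c i) = 0 := fun i =>
    (((hp.restrict d (Set.subset_univ _)).mem_realizations_iff _).1 (hc i)).1
  obtain ⟨i, j, hij⟩ := exists_pair_lt ι
  have hne := hp.comp_ne_of_isMorleySequence d hc hc0 hij
  have h0 : ⟪(c i : C.X), c j⟫ = 0 := d.orth _ _ hne _ (d.mem_comp _ _) _ (d.mem_comp _ _)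
  set a : ℝ := (√2)⁻¹ with ha
  have ha0 : a ≠ 0 := by positivity
  have ha2 : a ^ 2 = 1 / 2 := by rw [ha, inv_pow, Real.sq_sqrt (by norm_num)]; norm_num
  have hn : ‖a • (c i : C.X) + a • (c j : C.X)‖ = 1 := by
    have h1 : ‖a • (c i : C.X) + a • (c j : C.X)‖ ^ 2 = 1 ^ 2 := by
      rw [norm_add_sq_real, real_inner_smul_left, real_inner_smul_right, h0, norm_smul, norm_smul,
        d.norm_of_D _ (hc0 i), d.norm_of_D _ (hc0 j), Real.norm_eq_abs, mul_one, sq_abs, ha2]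
      norm_num
    exact (sq_eq_sq₀ (norm_nonneg _) zero_le_one).1 h1
  obtain ⟨x, hx⟩ := BanachStr.coe_eq_of_norm_eq_one hn
  have hx0 := (((hp.restrict d (Set.empty_subset _)).mem_realizations_iff _).1 (hsub (a := x)
    ⟨hx ▸ Submodule.add_mem _ (Submodule.smul_mem _ _ (Submodule.subset_span ⟨i, rfl⟩))
      (Submodule.smul_mem _ _ (Submodule.subset_span ⟨j, rfl⟩)), hx ▸ hn⟩)).1
  have h1 : d.comp x hx0 = d.comp (c i) (hc0 i) := Option.some_injective _
    (d.eq_of_inner_ne_zero (o := some _) (o' := some _) (d.mem_comp _ _) (d.mem_comp _ _) (by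
      rw [hx, inner_add_left, real_inner_smul_left, real_inner_smul_left, real_inner_comm (c i : C.X) (c j),
        h0, real_inner_self_eq_norm_sq, d.norm_of_D _ (hc0 i)]
      simpa using ha0))
  have h2 : d.comp x hx0 = d.comp (c j) (hc0 j) := Option.some_injective _
    (d.eq_of_inner_ne_zero (o := some _) (o' := some _) (d.mem_comp _ _) (d.mem_comp _ _) (by
      rw [hx, inner_add_left, real_inner_smul_left, real_inner_smul_left, h0,
        real_inner_self_eq_norm_sq, d.norm_of_D _ (hc0 j)]
      simpa using ha0))
  exact hne (h1.symm.trans h2)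

theorem CType.IsGeneric.exists_isMorleySequence {C : BanachStr.{u}} [IsHilb C] (d : Decomp C)
    {p : CType C Set.univ} (hp : p.IsGeneric) : ∃ c : ℕ → C.Ball, IsMorleySequence p ∅ c := by
  choose c hc hc1 using fun n => d.exists_unit (Infinite.natEmbedding d.I n)
  refine ⟨c, fun n => ((hp.restrict d (Set.subset_univ _)).mem_realizations_iff _).2
    ⟨d.D_of_mem _ _ (hc n) (hc1 n), ?_⟩⟩
  rintro _ (h | ⟨m, hm, rfl⟩)
  · exact h.elim
  · rw [d.perp_eq_zero_iff (hc n) (hc1 n)]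
    refine d.P_eq_zero (o' := some _) (fun h => ?_) (hc m)
    exact (ne_of_gt hm) ((Infinite.natEmbedding d.I).injective (Option.some_injective _ h))

/-- Over one unit vector `t 0` of a component there are two wide extensions: the generic type and
the type of a unit vector of the same component orthogonal to `t 0`. -/
theorem CType.IsGeneric.not_isMinimalWide {C : BanachStr.{u}} [IsHilb C] (d : Decomp C)
    {p : CType C ∅} (hp : p.IsGeneric) : ¬ p.IsMinimalWide := by
  rintro ⟨-, hmin⟩
  obtain ⟨i⟩ : Nonempty d.I := inferInstance
  obtain ⟨s, hsV, hs⟩ := exists_orthonormal_seq (d.V i) (d.infd i)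
  choose t ht using fun n => BanachStr.coe_eq_of_norm_eq_one (M := C) (hs.1 n)
  obtain rfl : (fun n => (t n : C.X)) = s := funext ht
  have hid : IsElementary (id : C.Ball → C.Ball) := fun _ _ _ => rfl
  -- Over the empty set, `D = 0` alone determines the type.
  have hres : ∀ q : CType C {t 0}, q.ContainsDZero → q.restrict ∅ (Set.empty_subset _) = p := by
    intro q hq
    obtain ⟨N, f, b, hf, hb⟩ := q.2
    have h1 : N.D b = 0 := by rwa [CType.ContainsDZero, ← hb, tpFun_D] at hq
    exact CType.eq_of_realizedBy (CType.RealizedBy.restrict hb _)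
      ((hp N f b hf).2 ⟨h1, fun a ha => ha.elim⟩)
  obtain ⟨q, -, hq⟩ := hmin {t 0} (Set.empty_subset _)
  obtain ⟨q1, hq1⟩ := CType.exists_isGeneric d {t 0}
  have ho : ∀ n, ⟪(t 0 : C.X), t (n + 1)⟫ = 0 := fun n => hs.2 (by simp)
  let U : Submodule ℝ C.X := d.V i ⊓ LinearMap.ker (innerₛₗ ℝ (t 0 : C.X))
  have hU : ∀ x ∈ U, ⟪(t 0 : C.X), x⟫ = 0 := fun x hx => hx.2
  have hD : ∀ n, C.D (t n) = 0 := fun n => d.D_of_mem _ _ (hsV n) (hs.1 n)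
  let q2 : CType C {t 0} := tp {t 0} (t 1)
  have hq2 : q2.IsWide := by
    refine ⟨C, id, U, hid, not_finiteDimensional_of_orthonormal
      (hs.comp _ (Nat.succ_injective)) fun n => ⟨hsV _, ho n⟩, fun x hx hx1 => ?_⟩
    funext m φ a
    refine φ.eval_eq_of_match (d := d) (e := d) (Match.of_mem (i := fun _ => i) (j := fun _ => i)
      (fun k => ?_) (fun k => ?_) (fun _ _ => Iff.rfl) fun k l => ?_)
    · cases k using Fin.cases with
      | zero => exact hx.1
      | succ k => rw [Fin.cons_succ, (a k).2]; exact hsV 0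
    · cases k using Fin.cases with
      | zero => exact hsV 1
      | succ k => rw [Fin.cons_succ, (a k).2]; exact hsV 0
    · have ha : ∀ k, (a k : C.Ball) = t 0 := fun k => (a k).2
      cases k using Fin.cases with
      | zero =>
        cases l using Fin.cases with
        | zero =>
          simp only [Fin.cons_zero, real_inner_self_eq_norm_sq]
          rw [hx1, hs.1 1]
        | succ l =>
          simp only [Fin.cons_zero, Fin.cons_succ, id, ha]
          rw [real_inner_comm, hU _ hx, real_inner_comm, ho 0]
      | succ k =>
        cases l using Fin.cases with
        | zero =>
          simp only [Fin.cons_zero, Fin.cons_succ, id, ha]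
          rw [hU _ hx, ho 0]
        | succ l => rfl
  have h1 := hq q1 ⟨hres q1 hq1.containsDZero, hq1.isWide d⟩
  have h2 := hq q2 ⟨hres q2 (hD 1), hq2⟩
  have h3 := ((hq1.mem_realizations_iff (t 1)).1 (h2.trans h1.symm)).2 (t 0) rfl
  rw [d.perp_eq_zero_iff (hsV 1) (hs.1 1), d.P_eq_self (o := some i) (hsV 0)] at h3
  exact hs.ne_zero 0 h3

/-! ### Stability -/

/-- The vector is the projection to `E` of the image of `b` under the adjoint of `L`. It records all
inner products of `b` with the parameters by a vector in the closed space they generate. -/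
theorem LinearIsometry.exists_mem_inner_eq {H K : Type*} [NormedAddCommGroup H]
    [InnerProductSpace ℝ H] [CompleteSpace H] [NormedAddCommGroup K] [InnerProductSpace ℝ K]
    [CompleteSpace K] (L : H →ₗᵢ[ℝ] K) (E : Submodule ℝ H) (hE : IsClosed (E : Set H)) (b : K) :
    ∃ y ∈ E, ∀ x ∈ E, ⟪y, x⟫ = ⟪b, L x⟫ := by
  have : CompleteSpace E := hE.completeSpace_coe
  set a := ContinuousLinearMap.adjoint L.toContinuousLinearMap b
  refine ⟨E.starProjection a, E.starProjection_apply_mem a, fun x hx => ?_⟩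
  have h := E.starProjection_inner_eq_zero a x hx
  rw [inner_sub_left, sub_eq_zero] at h
  rw [← h]
  exact ContinuousLinearMap.adjoint_inner_left L.toContinuousLinearMap x b

theorem Decomp.Emb.P_eq_zero_of_forall {M N : BanachStr.{u}} [IsHilb M] [IsHilb N] {d : Decomp M}
    {e : Decomp N} {f : M.Ball → N.Ball} (F : d.Emb e f) {T : Set (Option d.I)} {x : M.X}
    (hT : ∀ p ∉ T, d.P p x = 0) {o : Option e.I} (ho : ∀ p ∈ T, p.map F.β ≠ o) :
    e.P o (F.L x) = 0 := by
  by_cases h : ∃ p : Option d.I, p.map F.β = o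
  · obtain ⟨p, rfl⟩ := h
    rw [F.P_map, hT p fun hp => ho p hp rfl, map_zero]
  · rw [F.P_eq_extend, Function.extend_apply' _ _ _ h]
    rfl

section Stable

variable {M : BanachStr.{u}} [IsHilb M] {d : Decomp M} {e : Decomp M.ultrapower}

theorem Decomp.Emb.exists_unit_orthogonal_W (F : d.Emb e diag) (p : Option d.I) :
    ∃ y ∈ e.W (p.map F.β), ‖y‖ = 1 ∧ ∀ x, ⟪F.L x, y⟫ = 0 := by
  cases p with
  | none =>
    obtain ⟨y, hy, hyW, hy0⟩ := F.exists_orthonormal_none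
    exact ⟨y 0, hyW 0, hy.1 0, hy0 0⟩
  | some i =>
    obtain ⟨y, hy, hy1, hy0⟩ := F.exists_unit_orthogonal i
    exact ⟨y, hy, hy1, hy0⟩

/-- Over a countable set of parameters, all types are realized in a separable subspace of the
ultrapower. -/
theorem Decomp.Emb.exists_isSeparable (F : d.Emb e diag) {A : Set M.Ball} (hA : A.Countable) :
    ∃ S : Submodule ℝ M.ultrapower.X, TopologicalSpace.IsSeparable (S : Set M.ultrapower.X) ∧
      ∀ (N : BanachStr.{u}) (g : M.Ball → N.Ball) (b : N.Ball), IsElementary g →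
        ∃ y : M.ultrapower.Ball, (y : M.ultrapower.X) ∈ S ∧ tpFun diag A y = tpFun g A b := by
  let T : Set (Option d.I) := {p | p = none ∨ ∃ a ∈ A, d.P p (a : M.X) ≠ 0}
  have hTc : T.Countable := by
    refine ((Set.countable_singleton none).union
      (hA.biUnion fun a _ => d.countable_support (a : M.X))).mono ?_
    rintro p (rfl | ⟨a, ha, hp⟩)
    · exact Or.inl rfl
    · exact Or.inr (Set.mem_biUnion ha hp)
  have hT0 : ∀ a ∈ A, ∀ p ∉ T, d.P p (a : M.X) = 0 := fun a ha p hp => by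
    by_contra h
    exact hp (Or.inr ⟨a, ha, h⟩)
  choose u huW hu1 hu0 using F.exists_unit_orthogonal_W
  have : Infinite {j | ∀ i, F.β i ≠ j} := Set.infinite_coe_iff.2 fun h =>
    F.not_countable_compl_range h.countable
  let J : ℕ ↪ {j | ∀ i, F.β i ≠ j} := Infinite.natEmbedding _
  have hJ : ∀ n (p : Option d.I), p.map F.β ≠ some (J n).1 := by
    rintro n (_ | i) h
    · cases h
    · exact (J n).2 i (Option.some_injective _ h)
  choose z hzV hz1 using fun n => e.exists_unit (J n).1
  let gens : Set M.X := {x | ∃ a ∈ A, ∃ p ∈ T, d.P p (a : M.X) = x}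
  have hgens : gens.Countable := by
    have : gens = Set.image2 (fun (a : M.Ball) p => d.P p (a : M.X)) A T := by
      ext x
      simp [gens, Set.mem_image2]
    rw [this]
    exact hA.image2 hTc _
  -- Three countable supplies: projections of the parameters, one direction orthogonal to `M` in
  -- each summand of `T`, and unit vectors in new components for the parts of a realization that are
  -- foreign to the parameters.
  let Y : Set M.ultrapower.X := F.L '' gens ∪ (u '' T ∪ Set.range fun n => (z n : M.ultrapower.X))
  have hY : Y.Countable := (hgens.image _).union ((hTc.image _).union (Set.countable_range _))
  let S := (Submodule.span ℝ Y).topologicalClosure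
  have hYS : ∀ y ∈ Y, y ∈ S := fun y hy =>
    (Submodule.span ℝ Y).le_topologicalClosure (Submodule.subset_span hy)
  have hSc : IsClosed (S : Set M.ultrapower.X) := (Submodule.span ℝ Y).isClosed_topologicalClosure
  let E := (Submodule.span ℝ gens).topologicalClosure
  have hEc : IsClosed (E : Set M.X) := (Submodule.span ℝ gens).isClosed_topologicalClosure
  have hgE : ∀ x ∈ gens, x ∈ E := fun x hx =>
    (Submodule.span ℝ gens).le_topologicalClosure (Submodule.subset_span hx)
  have hFE : E ≤ S.comap F.L.toLinearMap := by
    refine Submodule.topologicalClosure_minimal _ (Submodule.span_le.2 fun x hx => ?_)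
      (hSc.preimage F.L.continuous)
    exact hYS _ (Or.inl ⟨x, hx, rfl⟩)
  have hPE : ∀ p, E ≤ E.comap (d.P p).toLinearMap := fun p => by
    refine Submodule.topologicalClosure_minimal _ (Submodule.span_le.2 ?_)
      (hEc.preimage (d.P p).continuous)
    rintro _ ⟨a, ha, p', hp', rfl⟩
    change d.P p (d.P p' (a : M.X)) ∈ E
    by_cases h : p = p'
    · rw [h, d.P_eq_self (d.P_mem p' _)]
      exact hgE _ ⟨a, ha, p', hp', rfl⟩
    · rw [d.P_eq_zero h (d.P_mem p' _)]
      exact Submodule.zero_mem _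
  refine ⟨S, hY.isSeparable.span (R := ℝ) |>.closure, fun N g b hg => ?_⟩
  have := isHilb_of_models hg.models
  obtain ⟨e'⟩ := nonempty_decomp_of_models d hg.models
  obtain ⟨G⟩ := hg.nonempty_emb d e'
  let X : Set e'.I := {t | e'.P (some t) (b : N.X) ≠ 0 ∧ ∀ p ∈ T, p.map G.β ≠ some t}
  have hX : X.Countable :=
    ((e'.countable_support (b : N.X)).preimage (Option.some_injective _)).mono fun t ht => ht.1
  have := hX.to_subtype
  obtain ⟨n, hn⟩ := exists_injective_nat X
  -- Summands in `T` are matched through `M`; the countably many other components that `b` meets are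
  -- sent to the reserved new components.
  let R : Option e'.I → Option e.I → Prop := fun o o' =>
    (∃ p ∈ T, o = p.map G.β ∧ o' = p.map F.β) ∨ ∃ t : X, o = some t.1 ∧ o' = some (J (n t)).1
  have hG0 : ∀ o, (∀ p ∈ T, p.map G.β ≠ o) → ∀ a : A, e'.P o (g a : N.X) = 0 := fun o ho a => by
    rw [← G.L_coe]
    exact G.P_eq_zero_of_forall (hT0 a a.2) ho
  have hF0 : ∀ o, (∀ p ∈ T, p.map F.β ≠ o) → ∀ a : A,
      e.P o (diag (a : M.Ball) : M.ultrapower.X) = 0 := fun o ho a => by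
    rw [← F.L_coe]
    exact F.P_eq_zero_of_forall (hT0 a a.2) ho
  have hR : MatchVia e'.toComps e.toComps R (fun a : A => (g a : N.X))
      fun a : A => (diag (a : M.Ball) : M.ultrapower.X) := by
    refine ⟨Or.inl ⟨none, Or.inl rfl, rfl, rfl⟩, ?_, ?_, ?_, ?_, ?_⟩
    · rintro o o' o'' (⟨p, hp, rfl, rfl⟩ | ⟨t, rfl, rfl⟩) (⟨p', hp', h, rfl⟩ | ⟨t', h, rfl⟩)
      · rw [Option.map_injective G.injective h]
      · exact absurd h (t'.2.2 p hp)
      · exact absurd h.symm (t.2.2 p' hp')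
      · rw [Subtype.ext (Option.some_injective _ h)]
    · rintro o o' o'' (⟨p, hp, rfl, rfl⟩ | ⟨t, rfl, rfl⟩) (⟨p', hp', rfl, h⟩ | ⟨t', rfl, h⟩)
      · rw [Option.map_injective F.injective h]
      · exact absurd h (hJ _ p)
      · exact absurd h.symm (hJ _ p')
      · rw [hn (J.injective (Subtype.ext (Option.some_injective _ h)))]
    · exact fun o ho => hG0 o fun p hp h => ho _ (Or.inl ⟨p, hp, h.symm, rfl⟩)
    · exact fun o ho => hF0 o fun p hp h => ho _ (Or.inl ⟨p, hp, rfl, h.symm⟩)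
    · rintro o o' (⟨p, hp, rfl, rfl⟩ | ⟨t, rfl, rfl⟩) a a'
      · simp only [← F.L_coe, ← G.L_coe]
        rw [F.P_map, F.P_map, G.P_map, G.P_map, F.L.inner_map_map, G.L.inner_map_map]
      · rw [hG0 _ t.2.2, hF0 _ fun p _ => hJ _ p, inner_zero_left, inner_zero_left]
  obtain ⟨y0, hy0E, hy0⟩ := G.L.exists_mem_inner_eq E hEc (b : N.X)
  obtain ⟨y, hyS, hy⟩ := hR.exists_mem_extend (b : N.X) (fun o ho => by
    by_contra hb
    cases o with
    | none => exact ho none (Or.inl ⟨none, Or.inl rfl, rfl, rfl⟩)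
    | some t =>
      have ht : t ∈ X := ⟨hb, fun p hp h => ho _ (Or.inl ⟨p, hp, h.symm, rfl⟩)⟩
      exact ho _ (Or.inr ⟨⟨t, ht⟩, rfl, rfl⟩)) S hSc (by
    rintro o o' (⟨p, hp, rfl, rfl⟩ | ⟨t, rfl, rfl⟩)
    · set c := e'.P (p.map G.β) (b : N.X)
      have h1 : ∀ x ∈ E, ⟪d.P p y0, d.P p x⟫ = ⟪c, G.L (d.P p x)⟫ := fun x hx => by
        have h3 := hy0 (d.P p x) (hPE p hx)
        rw [d.inner_P_left p y0 (d.P_mem p x), h3,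
          e'.inner_P_left _ _ (G.mem_W p _ (d.P_mem p x))]
      have h2 : ‖d.P p y0‖ ^ 2 ≤ ‖c‖ ^ 2 := by
        have h3 := h1 y0 hy0E
        rw [real_inner_self_eq_norm_sq] at h3
        have h4 := real_inner_le_norm c (G.L (d.P p y0))
        rw [G.L.norm_map, ← h3] at h4
        nlinarith [norm_nonneg c, norm_nonneg (d.P p y0), sq_nonneg (‖c‖ - ‖d.P p y0‖)]
      -- The first term has the right inner products with the parameters. It is no longer than `c`
      -- by Cauchy–Schwarz, and the missing length is supplied in the direction `u p`, which is
      -- orthogonal to `M`.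
      refine ⟨F.L (d.P p y0) + √(‖c‖ ^ 2 - ‖d.P p y0‖ ^ 2) • u p,
        Submodule.add_mem _ (F.mem_W p _ (d.P_mem p y0)) (Submodule.smul_mem _ _ (huW p)),
        S.add_mem (hFE (hPE p hy0E)) (S.smul_mem _ (hYS _ (Or.inr (Or.inl ⟨p, hp, rfl⟩)))), ?_,
        fun a => ?_⟩
      · refine (sq_eq_sq₀ (norm_nonneg _) (norm_nonneg _)).1 ?_
        rw [norm_add_sq_real, real_inner_smul_right, hu0, F.L.norm_map, norm_smul, hu1,
          Real.norm_of_nonneg (Real.sqrt_nonneg _), mul_one, Real.sq_sqrt (by linarith)]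
        ring
      · have h5 : d.P p (a : M.X) ∈ E := hgE _ ⟨a, a.2, p, hp, rfl⟩
        have h6 := h1 _ h5
        rw [d.P_eq_self (d.P_mem p _)] at h6
        rw [← F.L_coe, ← G.L_coe, F.P_map, G.P_map, inner_add_left, real_inner_smul_left,
          real_inner_comm (F.L (d.P p (a : M.X))) (u p), hu0, F.L.inner_map_map, mul_zero, add_zero,
          h6]
    · refine ⟨‖e'.P (some t.1) (b : N.X)‖ • (z (n t) : M.ultrapower.X),
        Submodule.smul_mem _ _ (hzV _), S.smul_mem _ (hYS _ (Or.inr (Or.inr ⟨_, rfl⟩))), ?_,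
        fun a => ?_⟩
      · rw [norm_smul, norm_norm, hz1, mul_one]
      · rw [hG0 _ t.2.2, hF0 _ fun p _ => hJ _ p, inner_zero_right, inner_zero_right])
  have hyb : ‖y‖ = ‖(b : N.X)‖ := by
    have h := (hy 0 Fin.elim0).inner_eq 0 0
    rw [Fin.cons_zero, Fin.cons_zero, real_inner_self_eq_norm_sq, real_inner_self_eq_norm_sq] at h
    exact ((sq_eq_sq₀ (norm_nonneg _) (norm_nonneg _)).1 h).symm
  refine ⟨⟨y, mem_closedBall_zero_iff.2 (hyb.trans_le b.norm_le)⟩, hyS, ?_⟩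
  funext m φ a
  refine (φ.eval_eq_of_match (d := e') (e := e) ?_).symm
  rw [coe_cons, coe_cons]
  exact ⟨R, hy m a⟩

end Stable

/-- Realizations in a separable set can be approximated from a countable dense subset, and distances
within the ultrapower bound distances between types. -/
theorem exists_countable_dense_types {M : BanachStr.{u}} [IsHilb M] (d : Decomp M) {A : Set M.Ball}
    (hA : A.Countable) : ∃ Q : Set (CType M A), Q.Countable ∧
      ∀ (p : CType M A) (ε : ℝ), 0 < ε → ∃ q ∈ Q, p.DistLT q ε := by
  obtain ⟨e, ⟨F⟩⟩ := d.exists_emb_diag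
  obtain ⟨S, hS, hreal⟩ := F.exists_isSeparable hA
  obtain ⟨t, hts, htc, htd⟩ :=
    (hS.mono (Set.inter_subset_left (t := Metric.closedBall 0 1))).exists_countable_dense_subset
  let τ : M.ultrapower.Ball → CType M A := fun y =>
    ⟨tpFun diag A y, _, diag, y, isElementary_diag, rfl⟩
  refine ⟨τ '' (Subtype.val ⁻¹' t), (htc.preimage Subtype.val_injective).image τ,
    fun p ε hε => ?_⟩
  obtain ⟨N, g, b, hg, hb⟩ := p.2
  obtain ⟨y, hyS, hy⟩ := hreal N g b hg
  obtain ⟨x, hxt, hxy⟩ := Metric.mem_closure_iff.1 (htd ⟨hyS, y.2⟩) ε hε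
  exact ⟨τ ⟨x, (hts hxt).2⟩, ⟨_, hxt, rfl⟩, M.ultrapower, diag, y, ⟨x, (hts hxt).2⟩,
    isElementary_diag, hy.trans hb, rfl, hxy⟩

/-! ### The main theorem -/

theorem mainTheorem6 :
    IsHilbertTheory.{0} sumOfSpheres.theory ∧ IsOmegaStable.{u} sumOfSpheres.theory ∧
    ∀ (κ : Cardinal.{u}) (C : BanachStr.{u}), Cardinal.aleph0 < κ →
      C.Models sumOfSpheres.theory → C.IsSaturated κ →
      ∃ p : CType C Set.univ,
        -- `p` is the unique global non-forking extension of `{D = 0}`, and it is wide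
        (∀ q : CType C Set.univ, (q.ContainsDZero ∧ ¬ q.Forks ∅) ↔ q = p) ∧
        p.IsWide ∧
        -- the unit sphere of the span of a Morley sequence is not contained in `p(C)`
        (∀ (B : Set C.Ball) (ι : Type v) [LinearOrder ι] [WellFoundedLT ι] [Nontrivial ι]
          (c : ι → C.Ball), IsMorleySequence p B c →
            ¬ unitSphereOf (spanOf c) ⊆
              (p.restrict ∅ (Set.empty_subset _)).realizations) ∧
        -- the type of `p` over `∅` is wide but not minimal wide, and there are infinite Morley
        -- sequences in `p` that are not orthonormal bases of indiscernible subspaces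
        (p.restrict ∅ (Set.empty_subset _)).IsWide ∧
        ¬ (p.restrict ∅ (Set.empty_subset _)).IsMinimalWide ∧
        ∃ c : ℕ → C.Ball, IsMorleySequence p ∅ c ∧
          ¬ ∃ V : Submodule ℝ C.X,
            (p.restrict ∅ (Set.empty_subset _)).IsIndiscernibleSubspace V ∧
              IsOrthonormalBasisOf c V := by
  refine ⟨⟨sumOfSpheres, IsHilb.out, rfl⟩, fun M hM A hA => ?_, fun κ C _ hC _ => ?_⟩
  · have := isHilb_of_models hM
    obtain ⟨d⟩ := nonempty_decomp_of_models decompSumOfSpheres hM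
    exact exists_countable_dense_types d hA
  · have := isHilb_of_models hC
    obtain ⟨d⟩ := nonempty_decomp_of_models decompSumOfSpheres hC
    obtain ⟨p, hp⟩ := CType.exists_isGeneric d (Set.univ : Set C.Ball)
    have hp0 := hp.restrict d (Set.empty_subset _)
    refine ⟨p, fun q => ⟨fun hq => ?_, ?_⟩, hp.isWide d, fun B ι _ _ _ c hc =>
      hp.not_unitSphereOf_subset d hc, hp0.isWide d, hp0.not_isMinimalWide d, ?_⟩
    · by_contra hne
      exact hq.2 (CType.forks_of_not_isGeneric d hp hq.1 hne)
    · rintro rfl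
      exact ⟨hp.containsDZero, hp.not_forks d⟩
    · obtain ⟨c, hc⟩ := hp.exists_isMorleySequence d
      refine ⟨c, hc, ?_⟩
      rintro ⟨V, hV, hcV⟩
      -- An indiscernible subspace with basis `c` contains the span of `c`, so its unit sphere would
      -- put that of the span into the zero set of `D`.
      refine hp.not_unitSphereOf_subset d hc (Set.Subset.trans ?_ hV.2)
      rintro x ⟨hx, hx1⟩
      exact ⟨hcV.2 ▸ (spanOf c).le_topologicalClosure hx, hx1⟩
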